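/- **Definitions.** For a real matrix $A\in\mathbb R^{m\times n}$ let $\mathrm{nnz}(A)$ be its number of non-zero entries, $\|\cdot\|_{\max}$ the largest and $\min_+(\cdot)$ the smallest non-zero absolute value of an entry of a matrix or vector ($1/\min_+(0)$ is read as $0$), $\Pi_A$ the orthogonal projection onto $\mathrm{im}(A)$, and, for $A\ne0$, $\kappa(A)=\sigma_{\max}(A)/\sigma_{\min}(A)$, where $\sigma_{\max}(A)=\max_{x\ne0}\|Ax\|_2/\|x\|_2$ and $\sigma_{\min}(A)=\min_{0\neq x\perp\ker A}\|Ax\|_2/\|x\|_2$. A *linear system approximation (LSA) instance* is a triple $(A,c,\epsilon)$ with $0\ne A\in\mathbb R^{m\times n}$, $\mathrm{nnz}(A)\ge\max(m,n)$, $c\in\mathbb R^m$ and $0<\epsilon\le1$; a *solution* is an $x\in\mathbb R^n$ with $\|Ax-\Pi_Ac\|_2\le\epsilon\|\Pi_Ac\|_2$. Its *sparse parameter complexity* is $$\mathcal S(A,c,\epsilon)=\Bigl(\mathrm{nnz}(A),\ \max\bigl(\|A\|_{\max},\|c\|_{\max},\tfrac1{\min_+(A)},\tfrac1{\min_+(c)}\bigr),\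 \kappa(A),\ \epsilon^{-1}\Bigr).$$ Let $f:[1,\infty)^4\to[0,\infty)^4$ be non-decreasing. A class $\mathcal M_1$ of matrices is *efficiently $f$-reducible* to a class $\mathcal M_2$, written $\mathcal M_1\le_f\mathcal M_2$, if there are two algorithms $\mathcal A_{1\to2}$ and $\mathcal A_{1\leftarrow2}$ such that for every LSA instance $(M^1,c^1,\epsilon_1)$ with $M^1\in\mathcal M_1$: the call $\mathcal A_{1\to2}(M^1,c^1,\epsilon_1)$ returns an LSA instance $(M^2,c^2,\epsilon_2)$ with $M^2\in\mathcal M_2$; for every solution $x^2$ of $(M^2,c^2,\epsilon_2)$ the vector $\mathcal A_{1\leftarrow2}(M^1,M^2,x^2)$ is a solution of $(M^1,c^1,\epsilon_1)$; coordinatewise $\mathcal S(M^2,c^2,\epsilon_2)\le f(\mathcal S(M^1,c^1,\epsilon_1))$; and both calls take time $O(\mathrm{nnz}(M^1))$. (Algorithms run on a real random access machine: arithmetic operations, square roots and comparisons of real numbers, and index arithmetic and array accesses, cost one step each; matrices are stored as lists of their non-zero entries in row-major order.) $\mathcal G_{z,2}$ is the class of integer matrices with at least one non-zero entry in every row and every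 column, in which every row has sum zero and in every row the sum of the positive entries is a power of $2$. $\mathcal T_2$ is the class of 2D truss incidence matrices: given a graph whose vertices are distinct points $s^1,\dots,s^N\in\mathbb R^2$, and a real weight $w_e$ for each edge $e$, the matrix has $2N$ columns, in pairs $x^1,\dots,x^N\in\mathbb R^2$ of variables, and one row for each edge $e=\{i,j\}$, namely the linear form $w_e\,(s^i-s^j)^\top(x^i-x^j)$. **Lemma.** There is a constant $C>0$ such that, with $$f(s,U,K,\epsilon^{-1})=\Bigl(C\,s\log(sU),\ C\,s^{3/2}U\log^{1/2}(sU),\ C\,K s^4U^2\log^2(sU),\ C\,sU^2\epsilon^{-1}\Bigr),$$ we have $\mathcal G_{z,2}\le_f\mathcal T_2$. -/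

import Mathlib

noncomputable section

namespace TrussReduction

/-! ### Sparse matrices and parameters of linear systems -/

/-- A matrix class: a property of real matrices of every size. -/
abbrev MatrixClass : Type :=
  ∀ ⦃m n : ℕ⦄, Matrix (Fin m) (Fin n) ℝ → Prop

/-- The positions of the non-zero entries of `A`, listed in row-major order. -/
def entries {m n : ℕ} (A : Matrix (Fin m) (Fin n) ℝ) : List (Fin m × Fin n) :=
  open Classical in
  (List.finRange m ×ˢ List.finRange n).filter fun p => decide (A p.1 p.2 ≠ 0)

/-- The number of non-zero entries. -/
def nnz {m n : ℕ} (A : Matrix (Fin m) (Fin n) ℝ) : ℕ :=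
  open Classical in
  (Finset.univ.filter fun p : Fin m × Fin n => A p.1 p.2 ≠ 0).card

theorem length_entries {m n : ℕ} (A : Matrix (Fin m) (Fin n) ℝ) :
    (entries A).length = nnz A := by
  classical
  have hnd : (entries A).Nodup :=
    ((List.nodup_finRange m).product (List.nodup_finRange n)).filter _
  rw [nnz, ← List.toFinset_card_of_nodup hnd]
  congr 1
  ext ⟨a, b⟩
  simp [entries, List.mem_product]

/-- The largest absolute value of an entry. -/
def maxAbs {ι : Type} (v : ι → ℝ) : ℝ := ⨆ i, |v i|

/-- The smallest absolute value of a non-zero entry.  If all entries vanish it is `0`, so that its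
reciprocal, which is what is used below, is `0` as well and does not affect a maximum. -/
def minNonzeroAbs {ι : Type} (v : ι → ℝ) : ℝ := sInf {a | ∃ i, v i ≠ 0 ∧ a = |v i|}

/-- The action of a matrix on Euclidean vectors. -/
def act {m n : ℕ} (A : Matrix (Fin m) (Fin n) ℝ) :
    EuclideanSpace ℝ (Fin n) →ₗ[ℝ] EuclideanSpace ℝ (Fin m) :=
  Matrix.toEuclideanLin A

/-- The maximum singular value. -/
def sigmaMax {m n : ℕ} (A : Matrix (Fin m) (Fin n) ℝ) : ℝ :=
  sSup {r | ∃ x : EuclideanSpace ℝ (Fin n), x ≠ 0 ∧ r = ‖act A x‖ / ‖x‖}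

/-- The minimum non-zero singular value (of a non-zero matrix). -/
def sigmaMin {m n : ℕ} (A : Matrix (Fin m) (Fin n) ℝ) : ℝ :=
  sInf {r | ∃ x : EuclideanSpace ℝ (Fin n),
    x ≠ 0 ∧ x ∈ (LinearMap.ker (act A))ᗮ ∧ r = ‖act A x‖ / ‖x‖}

/-- The non-zero condition number (of a non-zero matrix). -/
def condNumber {m n : ℕ} (A : Matrix (Fin m) (Fin n) ℝ) : ℝ :=
  sigmaMax A / sigmaMin A

/-- The orthogonal projection of `c` onto the image of `A`. -/
def proj {m n : ℕ} (A : Matrix (Fin m) (Fin n) ℝ) (c : EuclideanSpace ℝ (Fin m)) :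
    EuclideanSpace ℝ (Fin m) :=
  (LinearMap.range (act A)).starProjection c

/-- `x` solves the linear system approximation instance `(A, c, ε)`. -/
def IsSolution {m n : ℕ} (A : Matrix (Fin m) (Fin n) ℝ) (c : EuclideanSpace ℝ (Fin m)) (ε : ℝ)
    (x : EuclideanSpace ℝ (Fin n)) : Prop :=
  ‖act A x - proj A c‖ ≤ ε * ‖proj A c‖

/-- `(A, c, ε)` is a linear system approximation instance whose sparse parameter complexity is
defined (the right-hand side `c` may be any vector). -/
def IsInstance {m n : ℕ} (A : Matrix (Fin m) (Fin n) ℝ) (_c : EuclideanSpace ℝ (Fin m))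
    (ε : ℝ) : Prop :=
  A ≠ 0 ∧ max m n ≤ nnz A ∧ 0 < ε ∧ ε ≤ 1

/-- The sparse parameter complexity of an instance. -/
def complexity {m n : ℕ} (A : Matrix (Fin m) (Fin n) ℝ) (c : EuclideanSpace ℝ (Fin m)) (ε : ℝ) :
    ℝ × ℝ × ℝ × ℝ :=
  ((nnz A : ℝ),
    max (max (maxAbs fun p : Fin m × Fin n => A p.1 p.2) (maxAbs fun i => c i))
      (max (1 / minNonzeroAbs fun p : Fin m × Fin n => A p.1 p.2)
        (1 / minNonzeroAbs fun i => c i)),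
    condNumber A,
    ε⁻¹)

/-! ### Real random access machines

The machine has index registers and index arrays (holding natural numbers), and number registers
and number arrays (holding real numbers).  A program is finite and therefore refers to finitely
many registers and arrays; the cells of an array are addressed through index registers.  Every
elementary instruction and every test costs one step.  There is no conversion of real numbers
into indices. -/

/-- A memory state. -/
structure Store where
  idx : ℕ → ℕ
  num : ℕ → ℝ
  idxArr : ℕ → ℕ → ℕ
  numArr : ℕ → ℕ → ℝ

/-- Elementary instructions; the first argument names the destination. -/
inductive Instr : Type
  | idxConst (d k : ℕ)
  | idxAdd (d a b : ℕ)
  | idxSub (d a b : ℕ)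
  | idxLoad (d arr i : ℕ)
  | idxStore (arr i a : ℕ)
  | numConst (d : ℕ) (q : ℚ)
  | numOfIdx (d a : ℕ)
  | numAdd (d a b : ℕ)
  | numSub (d a b : ℕ)
  | numMul (d a b : ℕ)
  | numDiv (d a b : ℕ)
  | numSqrt (d a : ℕ)
  | numLoad (d arr i : ℕ)
  | numStore (arr i a : ℕ)

/-- Overwrite an index register. -/
def Store.setIdx (σ : Store) (d v : ℕ) : Store :=
  { σ with idx := Function.update σ.idx d v }

/-- Overwrite a number register. -/
def Store.setNum (σ : Store) (d : ℕ) (v : ℝ) : Store :=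
  { σ with num := Function.update σ.num d v }

/-- Overwrite a cell of an index array. -/
def Store.setIdxArr (σ : Store) (arr i v : ℕ) : Store :=
  { σ with idxArr := Function.update σ.idxArr arr (Function.update (σ.idxArr arr) i v) }

/-- Overwrite a cell of a number array. -/
def Store.setNumArr (σ : Store) (arr i : ℕ) (v : ℝ) : Store :=
  { σ with numArr := Function.update σ.numArr arr (Function.update (σ.numArr arr) i v) }

/-- The effect of an instruction.  Subtraction of indices is truncated at `0`; division by `0` and
the square root of a negative number give `0`. -/
def Instr.apply : Instr → Store → Store
  | .idxConst d k, σ => σ.setIdx d k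
  | .idxAdd d a b, σ => σ.setIdx d (σ.idx a + σ.idx b)
  | .idxSub d a b, σ => σ.setIdx d (σ.idx a - σ.idx b)
  | .idxLoad d arr i, σ => σ.setIdx d (σ.idxArr arr (σ.idx i))
  | .idxStore arr i a, σ => σ.setIdxArr arr (σ.idx i) (σ.idx a)
  | .numConst d q, σ => σ.setNum d (q : ℝ)
  | .numOfIdx d a, σ => σ.setNum d (σ.idx a : ℝ)
  | .numAdd d a b, σ => σ.setNum d (σ.num a + σ.num b)
  | .numSub d a b, σ => σ.setNum d (σ.num a - σ.num b)
  | .numMul d a b, σ => σ.setNum d (σ.num a * σ.num b)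
  | .numDiv d a b, σ => σ.setNum d (σ.num a / σ.num b)
  | .numSqrt d a, σ => σ.setNum d (Real.sqrt (σ.num a))
  | .numLoad d arr i, σ => σ.setNum d (σ.numArr arr (σ.idx i))
  | .numStore arr i a, σ => σ.setNumArr arr (σ.idx i) (σ.num a)

/-- Tests on two registers. -/
inductive Test : Type
  | idxEq (a b : ℕ)
  | idxLt (a b : ℕ)
  | numEq (a b : ℕ)
  | numLt (a b : ℕ)

/-- The truth of a test. -/
def Test.Holds : Test → Store → Prop
  | .idxEq a b, σ => σ.idx a = σ.idx b
  | .idxLt a b, σ => σ.idx a < σ.idx b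
  | .numEq a b, σ => σ.num a = σ.num b
  | .numLt a b, σ => σ.num a < σ.num b

/-- Programs. -/
inductive Prog : Type
  | skip
  | instr (i : Instr)
  | seq (p q : Prog)
  | cond (b : Test) (p q : Prog)
  | loop (b : Test) (p : Prog)

/-- `Exec p σ t τ`: started in `σ`, the program `p` halts after exactly `t` steps in `τ`. -/
inductive Exec : Prog → Store → ℕ → Store → Prop
  | skip (σ : Store) : Exec .skip σ 0 σ
  | instr (i : Instr) (σ : Store) : Exec (.instr i) σ 1 (i.apply σ)
  | seq {p q : Prog} {σ τ υ : Store} {t u : ℕ} (hp : Exec p σ t τ) (hq : Exec q τ u υ) :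
      Exec (.seq p q) σ (t + u) υ
  | condTrue {b : Test} {p q : Prog} {σ τ : Store} {t : ℕ} (hb : b.Holds σ)
      (hp : Exec p σ t τ) : Exec (.cond b p q) σ (t + 1) τ
  | condFalse {b : Test} {p q : Prog} {σ τ : Store} {t : ℕ} (hb : ¬ b.Holds σ)
      (hq : Exec q σ t τ) : Exec (.cond b p q) σ (t + 1) τ
  | loopFalse {b : Test} {p : Prog} {σ : Store} (hb : ¬ b.Holds σ) :
      Exec (.loop b p) σ 1 σ
  | loopTrue {b : Test} {p : Prog} {σ τ υ : Store} {t u : ℕ} (hb : b.Holds σ)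
      (hp : Exec p σ t τ) (hl : Exec (.loop b p) τ u υ) : Exec (.loop b p) σ (t + u + 1) υ

/-- The memory holds the matrix `A` in slot `b` as a sparse matrix: index registers `3b`, `3b+1`,
`3b+2` hold the numbers of rows, columns and non-zero entries; index arrays `2b`, `2b+1` and number
array `b` hold the rows, columns and values of the non-zero entries in row-major order. -/
def Store.HoldsMatrix (σ : Store) (b : ℕ) {m n : ℕ} (A : Matrix (Fin m) (Fin n) ℝ) : Prop :=
  σ.idx (3 * b) = m ∧ σ.idx (3 * b + 1) = n ∧ σ.idx (3 * b + 2) = nnz A ∧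
    ∀ (k : ℕ) (hk : k < (entries A).length),
      σ.idxArr (2 * b) k = ((entries A)[k]).1 ∧
      σ.idxArr (2 * b + 1) k = ((entries A)[k]).2 ∧
      σ.numArr b k = A ((entries A)[k]).1 ((entries A)[k]).2

/-- Number array `a` holds the vector `v`. -/
def Store.HoldsVector (σ : Store) (a : ℕ) {n : ℕ} (v : EuclideanSpace ℝ (Fin n)) : Prop :=
  ∀ i : Fin n, σ.numArr a i = v i

/-- `P`, given `(A, c, ε)` in slot `0`, number array `2` and number register `0` (and anything in
the other cells), halts within `T` steps with `(B, c', ε')` in slot `1`, number array `3` and number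
register `1`. -/
def MapsInstance (P : Prog) (T : ℕ)
    {m n : ℕ} (A : Matrix (Fin m) (Fin n) ℝ) (c : EuclideanSpace ℝ (Fin m)) (ε : ℝ)
    {m' n' : ℕ} (B : Matrix (Fin m') (Fin n') ℝ) (c' : EuclideanSpace ℝ (Fin m')) (ε' : ℝ) : Prop :=
  ∀ σ : Store, σ.HoldsMatrix 0 A → σ.HoldsVector 2 c → σ.num 0 = ε →
    ∃ t τ, t ≤ T ∧ Exec P σ t τ ∧ τ.HoldsMatrix 1 B ∧ τ.HoldsVector 3 c' ∧ τ.num 1 = ε'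

/-- `Q`, given `A`, `B` and `y` in slots `0`, `1` and number array `3` (and anything in the other
cells), halts within `T` steps with `x` in number array `2`. -/
def MapsSolution (Q : Prog) (T : ℕ)
    {m n : ℕ} (A : Matrix (Fin m) (Fin n) ℝ) {m' n' : ℕ} (B : Matrix (Fin m') (Fin n') ℝ)
    (y : EuclideanSpace ℝ (Fin n')) (x : EuclideanSpace ℝ (Fin n)) : Prop :=
  ∀ σ : Store, σ.HoldsMatrix 0 A → σ.HoldsMatrix 1 B → σ.HoldsVector 3 y →
    ∃ t τ, t ≤ T ∧ Exec Q σ t τ ∧ τ.HoldsVector 2 x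

/-! ### Efficient reducibility -/

/-- `M₁` is efficiently `f`-reducible to `M₂`.  All coordinates of a sparse parameter complexity
are at least `1`, so this is the range on which `f` matters. -/
def EfficientlyReducible (M₁ M₂ : MatrixClass) (f : ℝ × ℝ × ℝ × ℝ → ℝ × ℝ × ℝ × ℝ) : Prop :=
  MonotoneOn f (Set.Ici (1, 1, 1, 1)) ∧
  Set.MapsTo f (Set.Ici (1, 1, 1, 1)) (Set.Ici (0, 0, 0, 0)) ∧
  ∃ (P Q : Prog) (T : ℕ),
    ∀ (m n : ℕ) (A : Matrix (Fin m) (Fin n) ℝ) (c : EuclideanSpace ℝ (Fin m)) (ε : ℝ),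
      M₁ A → IsInstance A c ε →
      ∃ (m' n' : ℕ) (B : Matrix (Fin m') (Fin n') ℝ) (c' : EuclideanSpace ℝ (Fin m')) (ε' : ℝ),
        M₂ B ∧ IsInstance B c' ε' ∧
        MapsInstance P (T * nnz A) A c ε B c' ε' ∧
        complexity B c' ε' ≤ f (complexity A c ε) ∧
        ∀ y : EuclideanSpace ℝ (Fin n'), ∃ x : EuclideanSpace ℝ (Fin n),
          MapsSolution Q (T * nnz A) A B y x ∧ (IsSolution B c' ε' y → IsSolution A c ε x)

/-! ### The two matrix classes -/

/-- Integer matrices with a non-zero entry in every row and column, all row sums zero, and in each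
row the sum of the positive entries a power of two. -/
def ZeroSumPowTwo : MatrixClass := fun m n A =>
  ∃ Z : Matrix (Fin m) (Fin n) ℤ,
    A = Z.map (fun z : ℤ => (z : ℝ)) ∧
    (∀ i, ∃ j, Z i j ≠ 0) ∧ (∀ j, ∃ i, Z i j ≠ 0) ∧
    (∀ i, ∑ j, Z i j = 0) ∧
    (∀ i, ∃ k : ℕ, ∑ j, max (Z i j) 0 = 2 ^ k)

/-- 2D truss incidence matrices.  The graph has `N` vertices, which are distinct points `s v` of the
plane, the columns come in `N` pairs, and row `k` belongs to the edge between `i k` and `j k`; it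
is the equation `w k * ⟪s (i k) - s (j k), x (i k) - x (j k)⟫ = 0`.  Distinct rows belong to distinct
edges. -/
def Truss2D : MatrixClass := fun m n B =>
  ∃ (N : ℕ) (hn : N * 2 = n) (s : Fin N → Fin 2 → ℝ) (i j : Fin m → Fin N) (w : Fin m → ℝ),
    Function.Injective s ∧
    (∀ k, i k ≠ j k) ∧ (Function.Injective fun k => s(i k, j k)) ∧
    ∀ (k : Fin m) (v : Fin N) (a : Fin 2),
      B k (Fin.cast hn (finProdFinEquiv (v, a))) =
        (if v = i k then w k * (s (i k) a - s (j k) a) else 0) -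
        (if v = j k then w k * (s (i k) a - s (j k) a) else 0)

/-- The parameter blow-up, with all the constants hidden in the `O`-notation equal to `C`.  The
fourth argument is the reciprocal of the accuracy. -/
def blowup (C : ℝ) : ℝ × ℝ × ℝ × ℝ → ℝ × ℝ × ℝ × ℝ := fun p =>
  let s := p.1
  let U := p.2.1
  let K := p.2.2.1
  let e := p.2.2.2
  (C * (s * Real.log (s * U)),
    C * (s ^ (3 / 2 : ℝ) * U * Real.log (s * U) ^ (1 / 2 : ℝ)),
    C * (K * s ^ 4 * U ^ 2 * Real.log (s * U) ^ 2),
    C * (s * U ^ 2 * e))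

end TrussReduction

end

noncomputable section

namespace TrussReduction

open Finset

/-! ### Singular values -/

/-! A row of the matrix is read as a system of horizontal forces of total zero, the force `val k`
acting on the joint that stands for variable `col k`. These joints lie on the horizontal axis. For
each row a chain of joints is built above the axis, with one foot on the axis and one new head per
entry. The chain carries the horizontal force `load`, which starts at the `mass` of the row (the sum
of its absolute values) and changes by `val k` at entry `k`. A chain joint is placed at height `mass
/ load`. Then load times height is constant along the chain, which is exactly what makes the
required bar forces point along the bars.

Consequently the linear forms of all bars owned by a row add up to that row of `A`, times `scale`,
evaluated at the horizontal displacements of the original joints: vertical displacements and feet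
cancel entry by entry (`sum_form`), the chain telescopes (`rowSum_telescope`), and since the row
sums to zero the final load is again `mass`, so one horizontal closing bar cancels the rest
(`sum_form_row`). There are no further relations among the bars of the truss: once the original
displacements are given, the chain can be solved joint by joint with explicit bounds
(`exists_form_eq`).

The right-hand side `c i` is spread evenly over the bars of row `i`, each share divided by the
square root of their number. This map `J` is an isometry whose adjoint `L` is a left inverse, and
`L` carries the truss system to the original one. As the range of the truss matrix is the full
preimage of the range of `A`, projection commutes with `J`, and the contraction `L` sends residuals
to residuals (`isSolution_of_isSolution`); the accuracy need not change.

For the parameters, a zero-sum row has partial sums of size at most half its mass, so loads stay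
comparable to the mass and heights lie in a fixed interval. Entry bounds follow, and with them the
largest singular value; the bounded solution gives the smallest one (`condNumber_truss_le`). Every
object is produced from the entry list with constant work per row or entry, which gives linear time
(`runs_buildProg`). -/

theorem bddAbove_sigmaMax_set {m n : ℕ} (A : Matrix (Fin m) (Fin n) ℝ) :
    BddAbove {r | ∃ x : EuclideanSpace ℝ (Fin n), x ≠ 0 ∧ r = ‖act A x‖ / ‖x‖} := by
  refine ⟨‖LinearMap.toContinuousLinearMap (act A)‖, ?_⟩
  rintro r ⟨x, -, rfl⟩
  exact ContinuousLinearMap.ratio_le_opNorm (LinearMap.toContinuousLinearMap (act A)) x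

theorem bddBelow_sigmaMin_set {m n : ℕ} (A : Matrix (Fin m) (Fin n) ℝ) :
    BddBelow {r | ∃ x : EuclideanSpace ℝ (Fin n),
      x ≠ 0 ∧ x ∈ (LinearMap.ker (act A))ᗮ ∧ r = ‖act A x‖ / ‖x‖} := by
  refine ⟨0, ?_⟩
  rintro r ⟨x, -, -, rfl⟩
  positivity

theorem le_sigmaMax {m n : ℕ} (A : Matrix (Fin m) (Fin n) ℝ) {x : EuclideanSpace ℝ (Fin n)}
    (hx : x ≠ 0) : ‖act A x‖ / ‖x‖ ≤ sigmaMax A :=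
  le_csSup (bddAbove_sigmaMax_set A) ⟨x, hx, rfl⟩

theorem sigmaMin_mul_le {m n : ℕ} (A : Matrix (Fin m) (Fin n) ℝ) {x : EuclideanSpace ℝ (Fin n)}
    (hx : x ∈ (LinearMap.ker (act A))ᗮ) : sigmaMin A * ‖x‖ ≤ ‖act A x‖ := by
  by_cases h0 : x = 0
  · simp [h0]
  · have h := csInf_le (bddBelow_sigmaMin_set A) ⟨x, h0, hx, rfl⟩
    exact (le_div_iff₀ (norm_pos_iff.2 h0)).1 h

theorem act_ne_zero {m n : ℕ} {A : Matrix (Fin m) (Fin n) ℝ} (hA : A ≠ 0) : act A ≠ 0 := by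
  intro h
  apply hA
  have : Matrix.toEuclideanLin A = Matrix.toEuclideanLin (0 : Matrix (Fin m) (Fin n) ℝ) := by
    rw [map_zero]; exact h
  exact Matrix.toEuclideanLin.injective this

/-- Every value of `act A` is attained on the orthogonal complement of the kernel. -/
theorem exists_mem_ker_orthogonal {m n : ℕ} (A : Matrix (Fin m) (Fin n) ℝ)
    (x : EuclideanSpace ℝ (Fin n)) :
    ∃ u ∈ (LinearMap.ker (act A))ᗮ, act A u = act A x := by
  refine ⟨x - (LinearMap.ker (act A)).starProjection x,
    Submodule.sub_starProjection_mem_orthogonal x, ?_⟩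
  have : (LinearMap.ker (act A)).starProjection x ∈ LinearMap.ker (act A) :=
    Submodule.starProjection_apply_mem _ x
  rw [map_sub, LinearMap.mem_ker.1 this, sub_zero]

theorem exists_ne_zero_mem_ker_orthogonal {m n : ℕ} {A : Matrix (Fin m) (Fin n) ℝ} (hA : A ≠ 0) :
    ∃ u ∈ (LinearMap.ker (act A))ᗮ, u ≠ 0 := by
  obtain ⟨x, hx⟩ : ∃ x, act A x ≠ 0 := by
    by_contra! h
    exact act_ne_zero hA (LinearMap.ext h)
  obtain ⟨u, hu, hux⟩ := exists_mem_ker_orthogonal A x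
  refine ⟨u, hu, ?_⟩
  rintro rfl
  exact hx (by rw [← hux, map_zero])

theorem sigmaMin_set_nonempty {m n : ℕ} {A : Matrix (Fin m) (Fin n) ℝ} (hA : A ≠ 0) :
    {r | ∃ x : EuclideanSpace ℝ (Fin n),
      x ≠ 0 ∧ x ∈ (LinearMap.ker (act A))ᗮ ∧ r = ‖act A x‖ / ‖x‖}.Nonempty := by
  obtain ⟨u, hu, h0⟩ := exists_ne_zero_mem_ker_orthogonal hA
  exact ⟨_, u, h0, hu, rfl⟩

theorem sigmaMin_le_sigmaMax {m n : ℕ} {A : Matrix (Fin m) (Fin n) ℝ} (hA : A ≠ 0) :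
    sigmaMin A ≤ sigmaMax A := by
  obtain ⟨u, hu, h0⟩ := exists_ne_zero_mem_ker_orthogonal hA
  exact (csInf_le (bddBelow_sigmaMin_set A) ⟨u, h0, hu, rfl⟩).trans (le_sigmaMax A h0)

/-- A bounded right inverse on the range bounds the smallest non-zero singular value below. -/
theorem inv_le_sigmaMin {m n : ℕ} {A : Matrix (Fin m) (Fin n) ℝ} (hA : A ≠ 0) {M : ℝ} (hM : 0 < M)
    (h : ∀ x, ∃ y, act A y = act A x ∧ ‖y‖ ≤ M * ‖act A x‖) : M⁻¹ ≤ sigmaMin A := by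
  refine le_csInf (sigmaMin_set_nonempty hA) ?_
  rintro r ⟨x, hx0, hx, rfl⟩
  obtain ⟨y, hyx, hy⟩ := h x
  have hpos : 0 < ‖x‖ := norm_pos_iff.2 hx0
  have hk : x - y ∈ LinearMap.ker (act A) := by
    rw [LinearMap.mem_ker, map_sub, hyx, sub_self]
  -- `x` is orthogonal to the kernel and `x - y` lies in it, so `x` is the shortest preimage of its
  -- image.
  have hxy : ‖x‖ * ‖x‖ = inner ℝ x y := by
    have h0 := Submodule.inner_left_of_mem_orthogonal hk hx
    rw [inner_sub_right, sub_eq_zero, real_inner_self_eq_norm_mul_norm] at h0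
    exact h0
  have hle : ‖x‖ ≤ ‖y‖ := by
    have := real_inner_le_norm x y
    rw [← hxy] at this
    exact le_of_mul_le_mul_left this hpos
  rw [le_div_iff₀ hpos, inv_mul_le_iff₀ hM]
  exact hle.trans hy

/-- On the orthogonal complement of the kernel the map is injective, and an injective linear map in
finite dimension is bounded below. -/
theorem sigmaMin_pos {m n : ℕ} {A : Matrix (Fin m) (Fin n) ℝ} (hA : A ≠ 0) : 0 < sigmaMin A := by
  set V := (LinearMap.ker (act A))ᗮ
  have hker : LinearMap.ker ((act A).domRestrict V) = ⊥ := by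
    rw [LinearMap.ker_eq_bot']
    rintro ⟨x, hx⟩ h
    have h1 : x ∈ LinearMap.ker (act A) := by simpa using h
    have h2 := Submodule.inner_right_of_mem_orthogonal h1 hx
    exact Subtype.ext (inner_self_eq_zero.1 h2)
  obtain ⟨K, hK, hanti⟩ := LinearMap.exists_antilipschitzWith ((act A).domRestrict V) hker
  have hK' : (0 : ℝ) < K := hK
  refine lt_of_lt_of_le (inv_pos.2 hK') (inv_le_sigmaMin hA hK' fun x => ?_)
  obtain ⟨u, hu, hux⟩ := exists_mem_ker_orthogonal A x
  refine ⟨u, hux, ?_⟩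
  have := hanti.le_mul_dist ⟨u, hu⟩ 0
  simpa [dist_zero_right, hux] using this

theorem one_le_condNumber {m n : ℕ} {A : Matrix (Fin m) (Fin n) ℝ} (hA : A ≠ 0) :
    1 ≤ condNumber A := by
  rw [condNumber, le_div_iff₀ (sigmaMin_pos hA), one_mul]
  exact sigmaMin_le_sigmaMax hA

theorem sigmaMax_le {m n : ℕ} {A : Matrix (Fin m) (Fin n) ℝ} {M : ℝ} (hM : 0 ≤ M)
    (h : ∀ x, ‖act A x‖ ≤ M * ‖x‖) : sigmaMax A ≤ M := by
  refine Real.sSup_le ?_ hM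
  rintro r ⟨x, hx, rfl⟩
  rw [div_le_iff₀ (norm_pos_iff.2 hx)]
  exact h x

/-- An entry of absolute value at least one bounds the largest singular value below. -/
theorem one_le_sigmaMax {m n : ℕ} {A : Matrix (Fin m) (Fin n) ℝ} {i : Fin m} {j : Fin n}
    (h : 1 ≤ |A i j|) : 1 ≤ sigmaMax A := by
  have hx : EuclideanSpace.single j (1 : ℝ) ≠ 0 := by
    intro h0
    have := congrArg (fun v : EuclideanSpace ℝ (Fin n) => v j) h0
    simp at this
  refine le_trans ?_ (le_sigmaMax A hx)
  have h1 : act A (EuclideanSpace.single j (1 : ℝ)) i = A i j := by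
    simp [act, Matrix.toLpLin_apply]
  have h2 := PiLp.norm_apply_le (act A (EuclideanSpace.single j (1 : ℝ))) i
  rw [h1] at h2
  simpa using h.trans h2

/-- Because `sigmaMax A` is at least one, the reciprocal of `sigmaMin A` is at most the condition
number; this lets the final estimate be expressed in the condition number alone. -/
theorem exists_preimage_norm_le {m n : ℕ} {A : Matrix (Fin m) (Fin n) ℝ} (hA : A ≠ 0)
    (hmax : 1 ≤ sigmaMax A) (x : EuclideanSpace ℝ (Fin n)) :
    ∃ u, act A u = act A x ∧ ‖u‖ ≤ condNumber A * ‖act A x‖ := by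
  obtain ⟨u, hu, hux⟩ := exists_mem_ker_orthogonal A x
  refine ⟨u, hux, ?_⟩
  have h1 := sigmaMin_mul_le A hu
  have hpos := sigmaMin_pos hA
  rw [hux] at h1
  rw [condNumber, div_mul_eq_mul_div, le_div_iff₀ hpos, mul_comm]
  exact h1.trans (le_mul_of_one_le_left (norm_nonneg _) hmax)

/-! ### Transfer of approximate solutions -/

theorem norm_eq_of_adjoint_leftInverse {E F : Type*} [NormedAddCommGroup E] [InnerProductSpace ℝ E]
    [NormedAddCommGroup F] [InnerProductSpace ℝ F] (J : E →ₗ[ℝ] F) (L : F →ₗ[ℝ] E)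
    (hadj : ∀ d w, inner ℝ (J d) w = inner ℝ d (L w)) (hLJ : ∀ d, L (J d) = d) (d : E) :
    ‖J d‖ = ‖d‖ := by
  have := hadj d (J d)
  rw [hLJ, real_inner_self_eq_norm_sq, real_inner_self_eq_norm_sq] at this
  exact (sq_eq_sq₀ (norm_nonneg _) (norm_nonneg _)).1 this

/-- Cauchy–Schwarz: `‖L w‖ ^ 2` is the inner product of `J (L w)` and `w`, and `J` preserves norms.
-/
theorem norm_le_of_adjoint_leftInverse {E F : Type*} [NormedAddCommGroup E] [InnerProductSpace ℝ E]
    [NormedAddCommGroup F] [InnerProductSpace ℝ F] (J : E →ₗ[ℝ] F) (L : F →ₗ[ℝ] E)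
    (hadj : ∀ d w, inner ℝ (J d) w = inner ℝ d (L w)) (hLJ : ∀ d, L (J d) = d) (w : F) :
    ‖L w‖ ≤ ‖w‖ := by
  have h1 := hadj (L w) w
  rw [real_inner_self_eq_norm_mul_norm] at h1
  have h2 := real_inner_le_norm (J (L w)) w
  rw [h1, norm_eq_of_adjoint_leftInverse J L hadj hLJ] at h2
  by_cases h0 : ‖L w‖ = 0
  · rw [h0]; exact norm_nonneg _
  · exact le_of_mul_le_mul_left h2 (lt_of_le_of_ne (norm_nonneg _) (Ne.symm h0))

/-- If `J` is adjoint to a left inverse `L`, if `L` carries the system `B` to the system `A`, and if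
the range of `B` is the full preimage of the range of `A`, then solutions of `(B, J c, ε)` yield
solutions of `(A, c, ε)`. -/
theorem isSolution_of_isSolution {m n m' n' : ℕ} {A : Matrix (Fin m) (Fin n) ℝ}
    {B : Matrix (Fin m') (Fin n') ℝ}
    (J : EuclideanSpace ℝ (Fin m) →ₗ[ℝ] EuclideanSpace ℝ (Fin m'))
    (L : EuclideanSpace ℝ (Fin m') →ₗ[ℝ] EuclideanSpace ℝ (Fin m))
    (hadj : ∀ d w, inner ℝ (J d) w = inner ℝ d (L w)) (hLJ : ∀ d, L (J d) = d)
    {p : EuclideanSpace ℝ (Fin n') → EuclideanSpace ℝ (Fin n)}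
    (hB : ∀ y, L (act B y) = act A (p y))
    (hrange : ∀ w u, L w = act A u → ∃ y, act B y = w)
    {c : EuclideanSpace ℝ (Fin m)} {ε : ℝ} {y : EuclideanSpace ℝ (Fin n')}
    (hy : IsSolution B (J c) ε y) : IsSolution A c ε (p y) := by
  have hJ := norm_eq_of_adjoint_leftInverse J L hadj hLJ
  have hL := norm_le_of_adjoint_leftInverse J L hadj hLJ
  -- `J (proj A c)` is in the range of `B` by `hrange`. The difference `J c - J (proj A c)` is
  -- orthogonal to that range, since pairing it with `act B z` is pairing `c - proj A c` with `L
  -- (act B z)`, which lies in the range of `A`.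
  have hproj : proj B (J c) = J (proj A c) := by
    refine Submodule.eq_starProjection_of_mem_orthogonal (K := LinearMap.range (act B)) ?_ ?_
    · obtain ⟨u, hu⟩ : proj A c ∈ LinearMap.range (act A) :=
        Submodule.starProjection_apply_mem _ c
      obtain ⟨y, hy⟩ := hrange (J (proj A c)) u (by rw [hLJ, hu])
      exact ⟨y, hy⟩
    · rw [Submodule.mem_orthogonal']
      rintro _ ⟨z, rfl⟩
      rw [← map_sub, hadj, hB]
      exact Submodule.inner_left_of_mem_orthogonal (LinearMap.mem_range_self (act A) (p z))
        (Submodule.sub_starProjection_mem_orthogonal c)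
  rw [IsSolution, hproj, hJ] at hy
  -- The residual for `A` is the image under the contraction `L` of the residual for `B`.
  refine le_trans ?_ hy
  have := hL (act B y - J (proj A c))
  rwa [map_sub, hB, hLJ] at this

/-! ### Sparse systems as lists of entries, and the truss built from them -/

/-- The shape of a sparse matrix: `m` rows, `n` columns and `s` entries, the `k`-th of which is
`val k` at position `(row k, col k)`. -/
structure SparseSystem where
  m : ℕ
  n : ℕ
  s : ℕ
  row : ℕ → ℕ
  col : ℕ → ℕ
  val : ℕ → ℝ

/-- A bar of a truss: its end points, the row of the original matrix it belongs to, and the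
coefficients of its linear form, which are proportional to its direction. -/
structure Bar where
  src : ℕ
  tgt : ℕ
  owner : ℕ
  fx : ℝ
  fy : ℝ

namespace SparseSystem

variable (D : SparseSystem)

/-- The sum of `f` over those of the first `k` entries that lie in row `i`. -/
def rowSum (f : ℕ → ℝ) (k i : ℕ) : ℝ := ∑ l ∈ range k, if D.row l = i then f l else 0

@[simp] theorem rowSum_zero (f : ℕ → ℝ) (i : ℕ) : D.rowSum f 0 i = 0 := by simp [rowSum]

theorem rowSum_succ (f : ℕ → ℝ) (k i : ℕ) :
    D.rowSum f (k + 1) i = D.rowSum f k i + if D.row k = i then f k else 0 := by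
  simp [rowSum, sum_range_succ]

theorem rowSum_succ_self (f : ℕ → ℝ) (k : ℕ) :
    D.rowSum f (k + 1) (D.row k) = D.rowSum f k (D.row k) + f k := by
  simp [rowSum_succ]

theorem rowSum_succ_of_ne (f : ℕ → ℝ) {k i : ℕ} (h : D.row k ≠ i) :
    D.rowSum f (k + 1) i = D.rowSum f k i := by
  simp [rowSum_succ, h]

theorem rowSum_add (f g : ℕ → ℝ) (k i : ℕ) :
    D.rowSum (fun l => f l + g l) k i = D.rowSum f k i + D.rowSum g k i := by
  simp only [rowSum, ← sum_add_distrib]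
  exact sum_congr rfl fun l _ => by split_ifs <;> simp

theorem rowSum_const_mul (a : ℝ) (f : ℕ → ℝ) (k i : ℕ) :
    D.rowSum (fun l => a * f l) k i = a * D.rowSum f k i := by
  simp only [rowSum, mul_sum]
  exact sum_congr rfl fun l _ => by split_ifs <;> simp

theorem rowSum_mono {f g : ℕ → ℝ} {k i : ℕ} (h : ∀ l < k, f l ≤ g l) :
    D.rowSum f k i ≤ D.rowSum g k i := by
  refine sum_le_sum fun l hl => ?_
  split_ifs
  · exact h l (mem_range.1 hl)
  · exact le_rfl

theorem abs_rowSum_le {f g : ℕ → ℝ} {k i : ℕ} (h : ∀ l < k, |f l| ≤ g l) :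
    |D.rowSum f k i| ≤ D.rowSum g k i := by
  refine (abs_sum_le_sum_abs _ _).trans (sum_le_sum fun l hl => ?_)
  split_ifs
  · exact h l (mem_range.1 hl)
  · simp

theorem rowSum_le_rowSum_of_le {f : ℕ → ℝ} (hf : ∀ l, 0 ≤ f l) {k k' i : ℕ} (h : k ≤ k') :
    D.rowSum f k i ≤ D.rowSum f k' i := by
  refine sum_le_sum_of_subset_of_nonneg (range_mono h) fun l _ _ => ?_
  split_ifs
  · exact hf l
  · exact le_rfl

theorem rowSum_nonneg {f : ℕ → ℝ} (hf : ∀ l, 0 ≤ f l) (k i : ℕ) : 0 ≤ D.rowSum f k i := by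
  simpa using D.rowSum_le_rowSum_of_le hf (Nat.zero_le k) (i := i)

theorem rowSum_one_le (k i : ℕ) : D.rowSum (fun _ => 1) k i ≤ k := by
  calc D.rowSum (fun _ => 1) k i ≤ ∑ l ∈ range k, (1 : ℝ) :=
        sum_le_sum fun l _ => by split_ifs <;> norm_num
    _ = k := by simp

/-- The number of entries of row `i` among the first `k` entries. -/
def rank (k i : ℕ) : ℕ := #{l ∈ range k | D.row l = i}

theorem cast_rank (k i : ℕ) : (D.rank k i : ℝ) = D.rowSum (fun _ => 1) k i := by
  rw [rank, card_filter, rowSum]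
  push_cast
  rfl

@[simp] theorem rank_zero (i : ℕ) : D.rank 0 i = 0 := by simp [rank]

theorem rank_succ (k i : ℕ) : D.rank (k + 1) i = D.rank k i + if D.row k = i then 1 else 0 := by
  rw [rank, rank, card_filter, card_filter, sum_range_succ]

theorem rank_le (k i : ℕ) : D.rank k i ≤ k := (card_filter_le _ _).trans (by simp)

theorem rank_mono {k k' : ℕ} (h : k ≤ k') (i : ℕ) : D.rank k i ≤ D.rank k' i :=
  card_le_card (filter_subset_filter _ (range_mono h))

/-- The sum of the absolute values of the entries of row `i`. -/
def mass (i : ℕ) : ℝ := D.rowSum (fun l => |D.val l|) D.s i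

/-- The horizontal force in the chain of row `i` before entry `k`. -/
def load (k i : ℕ) : ℝ := D.mass i + D.rowSum D.val k i

@[simp] theorem load_zero (i : ℕ) : D.load 0 i = D.mass i := by simp [load]

theorem load_succ_self (k : ℕ) :
    D.load (k + 1) (D.row k) = D.load k (D.row k) + D.val k := by
  simp [load, rowSum_succ_self, add_assoc]

theorem load_succ_of_ne {k i : ℕ} (h : D.row k ≠ i) : D.load (k + 1) i = D.load k i := by
  simp [load, rowSum_succ_of_ne _ _ h]

/-- The height of the chain after entry `k`. -/
def height (k : ℕ) : ℝ := D.mass (D.row k) / D.load (k + 1) (D.row k)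

/-- The normalization of row `i`: the square root of the number of its bars. -/
def scale (i : ℕ) : ℝ := Real.sqrt (1 + 4 * D.rowSum (fun _ => 1) D.s i)

/-- The first joint of the chain of row `i`. -/
def anchor (i : ℕ) : ℕ := D.n + i

/-- The joint on the axis that belongs to entry `k`. -/
def foot (k : ℕ) : ℕ := D.n + D.m + 2 * k

/-- The joint of the chain after entry `k`. -/
def head (k : ℕ) : ℕ := D.n + D.m + 2 * k + 1

/-- The number of joints. -/
def joints : ℕ := D.n + D.m + 2 * D.s

/-- The number of bars. -/
def bars : ℕ := 4 * D.s + D.m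

/-- The last joint of the chain of row `i` before entry `k`. -/
def last : ℕ → ℕ → ℕ
  | 0, i => D.anchor i
  | k + 1, i => if D.row k = i then D.head k else last k i

@[simp] theorem last_zero (i : ℕ) : D.last 0 i = D.anchor i := rfl

theorem last_succ (k i : ℕ) :
    D.last (k + 1) i = if D.row k = i then D.head k else D.last k i := rfl

/-- The four bars of entry `k`. -/
def entryBar (k t : ℕ) : Bar :=
  let i := D.row k
  let a := D.scale i * D.val k
  let b := a * D.height k
  match t with
  | 0 => ⟨D.col k, D.foot k, i, a, 0⟩
  | 1 => ⟨D.last k i, D.foot k, i, 0, b⟩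
  | 2 => ⟨D.foot k, D.head k, i, a, b⟩
  | _ => ⟨D.last k i, D.head k, i, D.scale i * D.load k i, -b⟩

/-- The bar that closes the chain of row `i`. -/
def closingBar (i : ℕ) : Bar :=
  ⟨D.anchor i, D.last D.s i, i, -(D.scale i * D.mass i), 0⟩

/-- All bars in order. -/
def bar (e : ℕ) : Bar :=
  if e < 4 * D.s then D.entryBar (e / 4) (e % 4) else D.closingBar (e - 4 * D.s)

theorem bar_entry {k t : ℕ} (hk : k < D.s) (ht : t < 4) : D.bar (4 * k + t) = D.entryBar k t := by
  have h1 : 4 * k + t < 4 * D.s := by omega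
  have h2 : (4 * k + t) / 4 = k := by omega
  have h3 : (4 * k + t) % 4 = t := by omega
  simp [bar, h1, h2, h3]

theorem bar_closing (i : ℕ) : D.bar (4 * D.s + i) = D.closingBar i := by simp [bar]

theorem bar_cases {P : ℕ → Prop} (h1 : ∀ k < D.s, ∀ t < 4, P (4 * k + t))
    (h2 : ∀ i < D.m, P (4 * D.s + i)) {e : ℕ} (he : e < D.bars) : P e := by
  rw [bars] at he
  by_cases h : e < 4 * D.s
  · have := h1 (e / 4) (by omega) (e % 4) (by omega)
    rwa [show 4 * (e / 4) + e % 4 = e by omega] at this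
  · have := h2 (e - 4 * D.s) (by omega)
    rwa [show 4 * D.s + (e - 4 * D.s) = e by omega] at this

theorem sum_bars (f : ℕ → ℝ) :
    ∑ e ∈ range D.bars, f e =
      ∑ k ∈ range D.s, (f (4 * k + 0) + f (4 * k + 1) + f (4 * k + 2) + f (4 * k + 3)) +
        ∑ i ∈ range D.m, f (4 * D.s + i) := by
  rw [bars, sum_range_add]
  congr 1
  generalize D.s = s
  induction s with
  | zero => simp
  | succ s ih =>
    rw [show 4 * (s + 1) = 4 * s + 1 + 1 + 1 + 1 by ring, sum_range_succ, sum_range_succ,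
      sum_range_succ, sum_range_succ, ih, sum_range_succ]
    ring_nf

/-- The linear form of a bar. -/
def coeff (b : Bar) (c : ℕ) : ℝ :=
  (if c / 2 = b.src then (if c % 2 = 0 then b.fx else b.fy) else 0) -
    (if c / 2 = b.tgt then (if c % 2 = 0 then b.fx else b.fy) else 0)

/-- The incidence matrix of the truss. -/
def truss : Matrix (Fin D.bars) (Fin (D.joints * 2)) ℝ := fun e c => coeff (D.bar e) c

/-- The hypotheses on the original system that the construction needs. -/
structure IsBalanced : Prop where
  row_lt : ∀ k < D.s, D.row k < D.m
  col_lt : ∀ k < D.s, D.col k < D.n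
  one_le_abs : ∀ k < D.s, 1 ≤ |D.val k|
  rowSum_val : ∀ i < D.m, D.rowSum D.val D.s i = 0
  exists_row : ∀ i < D.m, ∃ k < D.s, D.row k = i

/-- Define a function on the joints by cases. -/
def onJoints {α : Type*} (f g p h : ℕ → α) (v : ℕ) : α :=
  if v < D.n then f v else if v < D.n + D.m then g (v - D.n)
  else if (v - (D.n + D.m)) % 2 = 0 then p ((v - (D.n + D.m)) / 2)
  else h ((v - (D.n + D.m)) / 2)

section onJoints

variable {α : Type*} (f g p h : ℕ → α)

theorem onJoints_original {j : ℕ} (hj : j < D.n) : D.onJoints f g p h j = f j := by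
  simp [onJoints, hj]

theorem onJoints_anchor {i : ℕ} (hi : i < D.m) : D.onJoints f g p h (D.anchor i) = g i := by
  simp [onJoints, anchor, hi]

theorem onJoints_foot (k : ℕ) : D.onJoints f g p h (D.foot k) = p k := by
  have h1 : ¬ D.foot k < D.n := by simp only [foot]; omega
  have h2 : ¬ D.foot k < D.n + D.m := by simp only [foot]; omega
  have h3 : D.foot k - (D.n + D.m) = 2 * k := by simp only [foot]; omega
  simp [onJoints, h1, h2, h3]

theorem onJoints_head (k : ℕ) : D.onJoints f g p h (D.head k) = h k := by
  have h1 : ¬ D.head k < D.n := by simp only [head]; omega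
  have h2 : ¬ D.head k < D.n + D.m := by simp only [head]; omega
  have h3 : D.head k - (D.n + D.m) = 2 * k + 1 := by simp only [head]; omega
  have h4 : (2 * k + 1) / 2 = k := by omega
  simp [onJoints, h1, h2, h3, Nat.add_mod, h4]

/-- The end of chain `i` moves only when an entry of row `i` is met, so a quantity `G` with the same
update rule gives the value there. This serves displacements and positions alike. -/
theorem onJoints_last {G : ℕ → ℕ → α} {i : ℕ} (hi : i < D.m) (h0 : G 0 i = g i)
    (h1 : ∀ k, D.row k = i → G (k + 1) i = h k)
    (h2 : ∀ k, D.row k ≠ i → G (k + 1) i = G k i) (k : ℕ) :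
    D.onJoints f g p h (D.last k i) = G k i := by
  induction k with
  | zero => rw [last_zero, onJoints_anchor _ _ _ _ _ hi, h0]
  | succ k ih =>
    rw [last_succ]
    split_ifs with hk
    · rw [onJoints_head, h1 k hk]
    · rw [ih, h2 k hk]

end onJoints

theorem joint_cases {P : ℕ → Prop} (h1 : ∀ j < D.n, P j) (h2 : ∀ i < D.m, P (D.anchor i))
    (h3 : ∀ k < D.s, P (D.foot k)) (h4 : ∀ k < D.s, P (D.head k)) {v : ℕ} (hv : v < D.joints) :
    P v := by
  simp only [joints, anchor, foot, head] at *
  by_cases c1 : v < D.n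
  · exact h1 v c1
  by_cases c2 : v < D.n + D.m
  · have := h2 (v - D.n) (by omega)
    rwa [show D.n + (v - D.n) = v by omega] at this
  by_cases c3 : (v - (D.n + D.m)) % 2 = 0
  · have := h3 ((v - (D.n + D.m)) / 2) (by omega)
    rwa [show D.n + D.m + 2 * ((v - (D.n + D.m)) / 2) = v by omega] at this
  · have := h4 ((v - (D.n + D.m)) / 2) (by omega)
    rwa [show D.n + D.m + 2 * ((v - (D.n + D.m)) / 2) + 1 = v by omega] at this

theorem le_last (k i : ℕ) : D.n ≤ D.last k i := by
  induction k with
  | zero => simp [anchor]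
  | succ k ih =>
    rw [last_succ]
    split_ifs
    · simp only [head]; omega
    · exact ih

theorem last_lt_foot {i : ℕ} (hi : i < D.m) (k : ℕ) : D.last k i < D.foot k := by
  induction k with
  | zero => simp [anchor, foot, hi]
  | succ k ih => rw [last_succ]; split_ifs <;> simp only [head, foot] at * <;> omega

theorem anchor_lt_last {i : ℕ} (hi : i < D.m) {k : ℕ} (h : ∃ l < k, D.row l = i) :
    D.anchor i < D.last k i := by
  induction k with
  | zero => obtain ⟨l, hl, -⟩ := h; omega
  | succ k ih =>
    rw [last_succ]
    split_ifs with hk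
    · simp only [head, anchor]; omega
    · obtain ⟨l, hl, hli⟩ := h
      refine ih ⟨l, ?_, hli⟩
      rcases Nat.lt_succ_iff_lt_or_eq.1 hl with h | rfl
      · exact h
      · exact absurd hli hk

/-! ### Loads, heights and the orientation of the bars -/

variable {D}

theorem load_le {k i : ℕ} (hk : k ≤ D.s) : D.load k i ≤ 2 * D.mass i := by
  have h1 : D.rowSum D.val k i ≤ D.rowSum (fun l => |D.val l|) k i :=
    D.rowSum_mono fun l _ => le_abs_self _
  have h2 : D.rowSum (fun l => |D.val l|) k i ≤ D.mass i :=
    D.rowSum_le_rowSum_of_le (fun l => abs_nonneg _) hk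
  simp only [load]
  linarith

theorem tgt_lt {e : ℕ} (he : e < D.bars) : (D.bar e).tgt < D.joints := by
  refine D.bar_cases (P := fun e => (D.bar e).tgt < D.joints) (fun k hk t ht => ?_) (fun i hi => ?_) he
  · rw [D.bar_entry hk ht]
    interval_cases t <;> simp only [entryBar, foot, head, joints] <;> omega
  · rw [bar_closing]
    have := D.last_lt_foot hi D.s
    simpa [closingBar, joints, foot] using this

namespace IsBalanced

variable (hD : D.IsBalanced)
include hD

/-- The numbering of the joints orients every bar upwards. So no bar is a loop, and the coefficients
of a bar can be listed in increasing column order. -/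
theorem src_lt_tgt {e : ℕ} (he : e < D.bars) : (D.bar e).src < (D.bar e).tgt := by
  refine D.bar_cases (P := fun e => (D.bar e).src < (D.bar e).tgt) (fun k hk t ht => ?_) (fun i hi => ?_) he
  · rw [D.bar_entry hk ht]
    have h1 := D.last_lt_foot (hD.row_lt k hk) k
    have h2 := hD.col_lt k hk
    interval_cases t <;> simp only [entryBar, foot, head] at * <;> omega
  · rw [bar_closing]
    exact D.anchor_lt_last hi (hD.exists_row i hi)

theorem owner_lt {e : ℕ} (he : e < D.bars) : (D.bar e).owner < D.m := by
  refine D.bar_cases (P := fun e => (D.bar e).owner < D.m) (fun k hk t ht => ?_) (fun i hi => ?_) he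
  · rw [D.bar_entry hk ht]
    interval_cases t <;> exact hD.row_lt k hk
  · rw [bar_closing]
    exact hi

theorem rank_pos {i : ℕ} (hi : i < D.m) : 0 < D.rank D.s i := by
  obtain ⟨k, hk, hki⟩ := hD.exists_row i hi
  exact card_pos.2 ⟨k, by simp [hk, hki]⟩

/-- A single non-zero entry cannot have sum zero. -/
theorem two_le_rank {i : ℕ} (hi : i < D.m) : 2 ≤ D.rank D.s i := by
  by_contra! h
  have h1 : D.rank D.s i = 1 := le_antisymm (by omega) (hD.rank_pos hi)
  obtain ⟨k, hk⟩ := card_eq_one.1 h1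
  have h2 := hD.rowSum_val i hi
  rw [rowSum, ← sum_filter, hk, sum_singleton] at h2
  have hk' : k ∈ ({l ∈ range D.s | D.row l = i} : Finset ℕ) := by rw [hk]; simp
  have := hD.one_le_abs k (by simpa using (mem_filter.1 hk').1)
  rw [h2] at this
  norm_num at this

/-- Each non-zero entry contributes at least one to the mass. This later absorbs the number of
entries when displacements along a chain are estimated. -/
theorem rank_le_mass (i : ℕ) : (D.rank D.s i : ℝ) ≤ D.mass i := by
  rw [cast_rank, mass]
  exact D.rowSum_mono fun l hl => hD.one_le_abs l hl

theorem two_le_mass {i : ℕ} (hi : i < D.m) : 2 ≤ D.mass i :=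
  le_trans (by exact_mod_cast hD.two_le_rank hi) (hD.rank_le_mass i)

/-- In a zero-sum row the positive and the negative entries each have total size half the mass, so
no partial sum is below minus half the mass. The functions `|val| + val` and `|val| - val` are twice
the positive and negative parts. -/
theorem half_mass_le_load {k i : ℕ} (hk : k ≤ D.s) (hi : i < D.m) : D.mass i / 2 ≤ D.load k i := by
  have h1 : D.rowSum (fun l => |D.val l| + D.val l) k i ≤
      D.rowSum (fun l => |D.val l| + D.val l) D.s i :=
    D.rowSum_le_rowSum_of_le (fun l => by linarith [neg_abs_le (D.val l)]) hk
  have h2 : D.rowSum (fun l => |D.val l| + -1 * D.val l) k i ≤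
      D.rowSum (fun l => |D.val l| + -1 * D.val l) D.s i :=
    D.rowSum_le_rowSum_of_le (fun l => by linarith [le_abs_self (D.val l)]) hk
  have h3 := D.rowSum_nonneg (f := fun l => |D.val l| + D.val l)
    (fun l => by linarith [neg_abs_le (D.val l)]) k i
  rw [rowSum_add, rowSum_add, hD.rowSum_val i hi] at h1
  rw [rowSum_add, rowSum_add, rowSum_const_mul, rowSum_const_mul, hD.rowSum_val i hi] at h2
  rw [rowSum_add] at h3
  simp only [load, mass] at *
  linarith

theorem load_pos {k i : ℕ} (hk : k ≤ D.s) (hi : i < D.m) : 0 < D.load k i := by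
  linarith [hD.half_mass_le_load hk hi, hD.two_le_mass hi]

theorem load_s {i : ℕ} (hi : i < D.m) : D.load D.s i = D.mass i := by
  simp [load, hD.rowSum_val i hi]

theorem height_mem {k : ℕ} (hk : k < D.s) : 1 / 2 ≤ D.height k ∧ D.height k ≤ 2 := by
  have hi := hD.row_lt k hk
  have h1 := hD.load_pos (Nat.succ_le_of_lt hk) hi
  have h2 := load_le (i := D.row k) (Nat.succ_le_of_lt hk)
  have h3 := hD.half_mass_le_load (Nat.succ_le_of_lt hk) hi
  rw [Nat.succ_eq_add_one] at *
  rw [height, le_div_iff₀ h1, div_le_iff₀ h1]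
  constructor <;> linarith

theorem height_pos {k : ℕ} (hk : k < D.s) : 0 < D.height k := by
  linarith [(hD.height_mem hk).1]

theorem val_ne_zero {k : ℕ} (hk : k < D.s) : D.val k ≠ 0 := by
  intro h
  have := hD.one_le_abs k hk
  rw [h] at this
  norm_num at this

end IsBalanced

theorem one_le_scale (i : ℕ) : 1 ≤ D.scale i := by
  rw [scale, Real.one_le_sqrt]
  linarith [D.rowSum_nonneg (f := fun _ => 1) (fun _ => zero_le_one) D.s i]

theorem scale_pos (i : ℕ) : 0 < D.scale i := zero_lt_one.trans_le (one_le_scale i)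

theorem scale_sq (i : ℕ) : D.scale i ^ 2 = 1 + 4 * D.rowSum (fun _ => 1) D.s i := by
  rw [scale, Real.sq_sqrt]
  linarith [D.rowSum_nonneg (f := fun _ => 1) (fun _ => zero_le_one) D.s i]

end SparseSystem

/-- The coordinates of a vector, extended by zero. -/
def coord {n : ℕ} (y : EuclideanSpace ℝ (Fin n)) (c : ℕ) : ℝ :=
  if h : c < n then y ⟨c, h⟩ else 0

theorem coord_of_lt {n : ℕ} (y : EuclideanSpace ℝ (Fin n)) {c : ℕ} (h : c < n) :
    coord y c = y ⟨c, h⟩ := dif_pos h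

@[simp] theorem coord_val {n : ℕ} (y : EuclideanSpace ℝ (Fin n)) (c : Fin n) :
    coord y c = y c := dif_pos c.2

theorem abs_coord_le {n : ℕ} (y : EuclideanSpace ℝ (Fin n)) (c : ℕ) : |coord y c| ≤ ‖y‖ := by
  unfold coord
  split_ifs with h
  · simpa using PiLp.norm_apply_le y ⟨c, h⟩
  · simp

/-- A vector with entries bounded by `M` has norm at most `√n * M`. -/
theorem norm_le_sqrt_mul {n : ℕ} (y : EuclideanSpace ℝ (Fin n)) {M : ℝ} (hM : 0 ≤ M)
    (h : ∀ i, |y i| ≤ M) : ‖y‖ ≤ Real.sqrt n * M := by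
  rw [EuclideanSpace.norm_eq]
  refine Real.sqrt_le_iff.2 ⟨by positivity, ?_⟩
  rw [mul_pow, Real.sq_sqrt (Nat.cast_nonneg n)]
  calc ∑ i, ‖y i‖ ^ 2 ≤ ∑ _i : Fin n, M ^ 2 :=
        sum_le_sum fun i _ => by
          rw [Real.norm_eq_abs]
          exact pow_le_pow_left₀ (abs_nonneg _) (h i) 2
    _ = n * M ^ 2 := by simp

theorem act_apply {m n : ℕ} (A : Matrix (Fin m) (Fin n) ℝ) (x : EuclideanSpace ℝ (Fin n))
    (i : Fin m) : act A x i = ∑ j, A i j * x j := by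
  simp [act, Matrix.toLpLin_apply, Matrix.mulVec, dotProduct]

theorem inner_act {m n : ℕ} (M : Matrix (Fin m) (Fin n) ℝ) (d : EuclideanSpace ℝ (Fin n))
    (w : EuclideanSpace ℝ (Fin m)) : inner ℝ (act M d) w = inner ℝ d (act M.transpose w) := by
  simp only [PiLp.inner_apply, act_apply, RCLike.inner_apply, conj_trivial, mul_sum, sum_mul,
    Matrix.transpose_apply]
  rw [sum_comm]
  exact sum_congr rfl fun j _ => sum_congr rfl fun i _ => by ring

/-- The value of the linear form of a bar at the displacements `X`, `Y` of the joints. -/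
def Bar.form (b : Bar) (X Y : ℕ → ℝ) : ℝ :=
  b.fx * (X b.src - X b.tgt) + b.fy * (Y b.src - Y b.tgt)

/-! ### Balance of forces and solvability of the truss equations -/

namespace SparseSystem

variable (D : SparseSystem)

theorem rowSum_congr {f g : ℕ → ℝ} {k i : ℕ} (h : ∀ l < k, D.row l = i → f l = g l) :
    D.rowSum f k i = D.rowSum g k i := by
  refine sum_congr rfl fun l hl => ?_
  split_ifs with hi
  · exact h l (mem_range.1 hl) hi
  · rfl

/-- The embedding of right-hand sides as a matrix. -/
def spread : Matrix (Fin D.bars) (Fin D.m) ℝ :=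
  fun e i => if (D.bar e).owner = i then (D.scale i)⁻¹ else 0

/-- `A` is the matrix with the entries listed by `D`. -/
def Represents (A : Matrix (Fin D.m) (Fin D.n) ℝ) : Prop :=
  ∀ (u : EuclideanSpace ℝ (Fin D.n)) (i : Fin D.m),
    act A u i = D.rowSum (fun l => D.val l * coord u (D.col l)) D.s i

theorem sum_owner (f : ℕ → ℝ) {i : ℕ} (hi : i < D.m) :
    (∑ e ∈ range D.bars, if (D.bar e).owner = i then f e else 0) =
      D.rowSum (fun k => f (4 * k + 0) + f (4 * k + 1) + f (4 * k + 2) + f (4 * k + 3)) D.s i +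
        f (4 * D.s + i) := by
  rw [sum_bars]
  congr 1
  · refine sum_congr rfl fun k hk => ?_
    have hk' := mem_range.1 hk
    simp only [D.bar_entry hk' (show 0 < 4 by norm_num), D.bar_entry hk' (show 1 < 4 by norm_num),
      D.bar_entry hk' (show 2 < 4 by norm_num), D.bar_entry hk' (show 3 < 4 by norm_num), entryBar]
    split_ifs <;> simp
  · simp only [bar_closing, closingBar, sum_ite_eq', mem_range, hi, if_true]

/-- The forms of the bars of a row add up to the row. -/
theorem sum_form (X Y : ℕ → ℝ) {k : ℕ} (hk : k < D.s) :
    (D.bar (4 * k + 0)).form X Y + (D.bar (4 * k + 1)).form X Y + (D.bar (4 * k + 2)).form X Y +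
      (D.bar (4 * k + 3)).form X Y =
    D.scale (D.row k) * (D.val k * X (D.col k) +
      (D.load k (D.row k) * X (D.last k (D.row k)) -
        D.load (k + 1) (D.row k) * X (D.head k))) := by
  simp only [D.bar_entry hk (show 0 < 4 by norm_num), D.bar_entry hk (show 1 < 4 by norm_num),
    D.bar_entry hk (show 2 < 4 by norm_num), D.bar_entry hk (show 3 < 4 by norm_num), entryBar,
    Bar.form]
  rw [load_succ_self]
  ring

/-- An entry of row `i` updates the load and the end of the chain together, so each term replaces
the contribution of the old end by that of the new one. Entries of other rows change neither. -/
theorem rowSum_telescope (X : ℕ → ℝ) (k i : ℕ) :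
    D.rowSum (fun l => D.load l (D.row l) * X (D.last l (D.row l)) -
      D.load (l + 1) (D.row l) * X (D.head l)) k i =
    D.mass i * X (D.anchor i) - D.load k i * X (D.last k i) := by
  induction k with
  | zero => simp
  | succ k ih =>
    rw [rowSum_succ, ih, last_succ]
    split_ifs with h
    · subst h; ring
    · rw [load_succ_of_ne _ h]; ring

variable {D}

namespace IsBalanced

variable (hD : D.IsBalanced)
include hD

/-- Since the load returns to `mass` at the end of a zero-sum row, what telescoping leaves is `mass`
times the displacement of the anchor relative to the last joint, and the closing bar has the
opposite form. -/
theorem sum_form_row (X Y : ℕ → ℝ) {i : ℕ} (hi : i < D.m) :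
    (∑ e ∈ range D.bars, if (D.bar e).owner = i then (D.bar e).form X Y else 0) =
      D.scale i * D.rowSum (fun l => D.val l * X (D.col l)) D.s i := by
  rw [D.sum_owner (fun e => (D.bar e).form X Y) hi]
  have h1 : D.rowSum (fun k => (D.bar (4 * k + 0)).form X Y + (D.bar (4 * k + 1)).form X Y +
        (D.bar (4 * k + 2)).form X Y + (D.bar (4 * k + 3)).form X Y) D.s i =
      D.rowSum (fun k => D.scale i * (D.val k * X (D.col k) +
        (D.load k (D.row k) * X (D.last k (D.row k)) -
          D.load (k + 1) (D.row k) * X (D.head k)))) D.s i := by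
    refine D.rowSum_congr fun l hl hli => ?_
    rw [D.sum_form X Y hl, hli]
  rw [h1, rowSum_const_mul, rowSum_add, rowSum_telescope, bar_closing, hD.load_s hi]
  simp only [Bar.form, closingBar]
  ring

end IsBalanced

theorem coeff_two_mul (b : Bar) (v : ℕ) :
    coeff b (2 * v) = (if v = b.src then b.fx else 0) - (if v = b.tgt then b.fx else 0) := by
  have h1 : 2 * v / 2 = v := by omega
  have h2 : 2 * v % 2 = 0 := by omega
  simp [coeff, h1, h2]

theorem coeff_two_mul_add_one (b : Bar) (v : ℕ) :
    coeff b (2 * v + 1) = (if v = b.src then b.fy else 0) - (if v = b.tgt then b.fy else 0) := by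
  have h1 : (2 * v + 1) / 2 = v := by omega
  have h2 : (2 * v + 1) % 2 = 1 := by omega
  simp [coeff, h1, h2]

theorem sum_range_mul_two (f : ℕ → ℝ) (N : ℕ) :
    ∑ c ∈ range (N * 2), f c = ∑ v ∈ range N, (f (2 * v) + f (2 * v + 1)) := by
  induction N with
  | zero => simp
  | succ N ih =>
    rw [sum_range_succ, ← ih, show (N + 1) * 2 = N * 2 + 1 + 1 by ring, sum_range_succ,
      sum_range_succ, mul_comm N 2]
    ring

/-- The displacement of joint `v` in direction `a`. -/
def displacement {D : SparseSystem} (y : EuclideanSpace ℝ (Fin (D.joints * 2))) (a v : ℕ) : ℝ :=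
  coord y (2 * v + a)

theorem act_truss (hD : D.IsBalanced) (y : EuclideanSpace ℝ (Fin (D.joints * 2)))
    (e : Fin D.bars) :
    act D.truss y e = (D.bar e).form (displacement y 0) (displacement y 1) := by
  have h1 := hD.src_lt_tgt e.2
  have h2 := tgt_lt e.2
  have h3 := h1.trans h2
  calc act D.truss y e = ∑ c : Fin (D.joints * 2), coeff (D.bar e) c * coord y c := by
        simp [act_apply, truss]
    _ = ∑ c ∈ range (D.joints * 2), coeff (D.bar e) c * coord y c :=
        Fin.sum_univ_eq_sum_range (fun c => coeff (D.bar e) c * coord y c) _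
    _ = _ := by
        rw [sum_range_mul_two]
        simp only [coeff_two_mul, coeff_two_mul_add_one, sub_mul, ite_mul, zero_mul,
          sum_add_distrib, sum_sub_distrib, sum_ite_eq', mem_range, h2, h3, if_true]
        simp only [Bar.form, displacement, add_zero]
        ring

theorem act_spread (hD : D.IsBalanced) (c : EuclideanSpace ℝ (Fin D.m)) (e : Fin D.bars) :
    act D.spread c e = coord c (D.bar e).owner / D.scale (D.bar e).owner := by
  have h := hD.owner_lt e.2
  calc act D.spread c e =
        ∑ i : Fin D.m, if (D.bar e).owner = i then (D.scale i)⁻¹ * coord c i else 0 := by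
        simp only [act_apply, spread, ite_mul, zero_mul, coord_val]
    _ = ∑ i ∈ range D.m, if (D.bar e).owner = i then (D.scale i)⁻¹ * coord c i else 0 :=
        Fin.sum_univ_eq_sum_range
          (fun i => if (D.bar e).owner = i then (D.scale i)⁻¹ * coord c i else 0) _
    _ = _ := by simp [h, div_eq_inv_mul]

theorem act_spread_transpose (w : EuclideanSpace ℝ (Fin D.bars)) (i : Fin D.m) :
    act D.spread.transpose w i =
      (∑ e ∈ range D.bars, if (D.bar e).owner = i then coord w e else 0) / D.scale i := by
  rw [← Fin.sum_univ_eq_sum_range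
    (fun e => if (D.bar e).owner = i then coord w e else 0), sum_div, act_apply]
  refine sum_congr rfl fun e _ => ?_
  simp only [Matrix.transpose_apply, spread, coord_val]
  split_ifs
  · rw [div_eq_inv_mul]
  · simp

/-- A row with `r` entries owns `4 * r + 1` bars, each with share `c i / scale i`; summing and
dividing by `scale i` once more is the identity because `scale i ^ 2` is that number. -/
theorem act_spread_transpose_spread (hD : D.IsBalanced) (c : EuclideanSpace ℝ (Fin D.m)) :
    act D.spread.transpose (act D.spread c) = c := by
  ext i
  have h0 := (scale_pos (D := D) i).ne'
  rw [act_spread_transpose]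
  have h1 : (∑ e ∈ range D.bars, if (D.bar e).owner = i then coord (act D.spread c) e else 0) =
      ∑ e ∈ range D.bars, if (D.bar e).owner = i then c i / D.scale i else 0 := by
    refine sum_congr rfl fun e he => ?_
    split_ifs with hi
    · rw [coord_of_lt _ (mem_range.1 he), act_spread hD]
      simp [hi]
    · rfl
  rw [h1, D.sum_owner (fun _ => c i / D.scale i) i.2]
  have h2 := scale_sq (D := D) i
  have h3 : D.rowSum (fun _ => c i / D.scale i + c i / D.scale i + c i / D.scale i +
      c i / D.scale i) D.s i = (4 * (c i / D.scale i)) * D.rowSum (fun _ => 1) D.s i := by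
    rw [← rowSum_const_mul]
    congr 1
    ext
    ring
  rw [h3, div_eq_iff h0]
  field_simp
  rw [h2]
  ring

/-- The horizontal displacements of the original joints. -/
def recover {D : SparseSystem} (y : EuclideanSpace ℝ (Fin (D.joints * 2))) :
    EuclideanSpace ℝ (Fin D.n) :=
  WithLp.toLp 2 fun j => displacement y 0 j

theorem coord_recover (y : EuclideanSpace ℝ (Fin (D.joints * 2))) {j : ℕ} (hj : j < D.n) :
    coord (recover y) j = displacement y 0 j := by
  rw [coord_of_lt _ hj]
  rfl

/-- This is the force balance `sum_form_row` divided by `scale`. -/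
theorem act_spread_transpose_truss (hD : D.IsBalanced) {A : Matrix (Fin D.m) (Fin D.n) ℝ}
    (hA : D.Represents A) (y : EuclideanSpace ℝ (Fin (D.joints * 2))) :
    act D.spread.transpose (act D.truss y) = act A (recover y) := by
  ext i
  rw [act_spread_transpose, hA]
  have h1 : (∑ e ∈ range D.bars, if (D.bar e).owner = i then coord (act D.truss y) e else 0) =
      ∑ e ∈ range D.bars, if (D.bar e).owner = i then
        (D.bar e).form (displacement y 0) (displacement y 1) else 0 := by
    refine sum_congr rfl fun e he => ?_
    rw [coord_of_lt _ (mem_range.1 he), act_truss hD]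
  rw [h1, hD.sum_form_row _ _ i.2, mul_div_assoc, mul_comm, div_mul_cancel₀]
  · refine D.rowSum_congr fun l hl _ => ?_
    rw [coord_recover _ (hD.col_lt l hl)]
  · exact (scale_pos _).ne'

/-- The equations of the truss are solvable, with bounds, as soon as the right-hand side satisfies
the relations imposed by the original system. -/
theorem exists_form_eq (hD : D.IsBalanced) (hs : 1 ≤ D.s) {W V : ℕ → ℝ} {β η U : ℝ} (hη : 0 ≤ η)
    (hU : 1 ≤ U) (hW : ∀ e, |W e| ≤ β) (hV : ∀ j, |V j| ≤ η) (hval : ∀ k < D.s, |D.val k| ≤ U)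
    (hrel : ∀ i < D.m, (∑ e ∈ range D.bars, if (D.bar e).owner = i then W e else 0) =
      D.scale i * D.rowSum (fun l => D.val l * V (D.col l)) D.s i) :
    ∃ X Y : ℕ → ℝ, (∀ e < D.bars, (D.bar e).form X Y = W e) ∧
      ∀ v < D.joints, |X v| ≤ 10 * D.s * (4 * β + U * η) ∧ |Y v| ≤ 10 * D.s * (4 * β + U * η) := by
  -- `M` bounds the net term `b k`, which consists of four right-hand sides and one product `val k *
  -- V (col k)`.
  set M := 4 * β + U * η with hM
  have hβ : 0 ≤ β := (abs_nonneg _).trans (hW 0)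
  have hUη : η ≤ U * η := le_mul_of_one_le_left hη hU
  have hβM : 4 * β ≤ M := by rw [hM]; nlinarith
  have hηM : η ≤ M := by rw [hM]; linarith
  have hM0 : 0 ≤ M := hη.trans hηM
  have hs' : (1 : ℝ) ≤ D.s := by exact_mod_cast hs
  have hMs : M ≤ D.s * M := le_mul_of_one_le_left hM0 hs'
  set g : ℕ → ℕ → ℝ := fun k t => W (4 * k + t) / D.scale (D.row k) with hg
  set b : ℕ → ℝ := fun k => g k 0 + g k 1 + g k 2 + g k 3 - D.val k * V (D.col k) with hb
  -- Adding the four equations of entry `k` eliminates the foot and all vertical displacements and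
  -- leaves `load (k + 1) * x (k + 1) = load k * x k - b k`. With the anchors held at zero this
  -- determines the horizontal displacements of the chain.
  set x : ℕ → ℕ → ℝ := fun k i => -D.rowSum b k i / D.load k i with hx
  -- The vertical step from the old end of the chain to the new head, as forced by the bar joining
  -- them.
  set d : ℕ → ℝ := fun k =>
    (g k 3 - D.load k (D.row k) * (x k (D.row k) - x (k + 1) (D.row k))) /
      (D.val k * D.height k) with hd
  have hgb : ∀ k t, |g k t| ≤ β := fun k t => by
    rw [hg]
    simp only [abs_div, abs_of_pos (scale_pos (D := D) (D.row k))]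
    exact (div_le_self (abs_nonneg _) (one_le_scale _)).trans (hW _)
  have hbM : ∀ k < D.s, |b k| ≤ M := fun k hk => by
    have h1 : |D.val k * V (D.col k)| ≤ U * η := by
      rw [abs_mul]
      exact mul_le_mul (hval k hk) (hV _) (abs_nonneg _) (by linarith)
    have h2 := abs_le.1 h1
    have h3 := abs_le.1 (hgb k 0)
    have h4 := abs_le.1 (hgb k 1)
    have h5 := abs_le.1 (hgb k 2)
    have h6 := abs_le.1 (hgb k 3)
    rw [hb, abs_le]
    constructor <;> simp only <;> linarith
  -- The sum has at most `rank` terms of size `M`, and `rank ≤ mass ≤ 2 * load`, so the bound does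
  -- not grow with the length of the chain.
  have hxM : ∀ k ≤ D.s, ∀ i < D.m, |x k i| ≤ 2 * M := fun k hk i hi => by
    have h1 : |D.rowSum b k i| ≤ M * D.mass i := by
      calc |D.rowSum b k i| ≤ D.rowSum (fun _ => M * 1) k i :=
            D.abs_rowSum_le fun l hl => by rw [mul_one]; exact hbM l (hl.trans_le hk)
        _ ≤ D.rowSum (fun _ => M * 1) D.s i :=
            D.rowSum_le_rowSum_of_le (fun _ => by linarith) hk
        _ = M * D.rank D.s i := by rw [rowSum_const_mul, cast_rank]
        _ ≤ M * D.mass i := mul_le_mul_of_nonneg_left (hD.rank_le_mass i) hM0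
    have h2 := hD.load_pos hk hi
    have h3 := hD.half_mass_le_load hk hi
    rw [hx]
    simp only [abs_div, abs_neg, abs_of_pos h2]
    rw [div_le_iff₀ h2]
    nlinarith
  have hload : ∀ k ≤ D.s, ∀ i < D.m, D.load k i * x k i = -D.rowSum b k i := fun k hk i hi => by
    have := (hD.load_pos hk hi).ne'
    rw [hx]
    field_simp
  -- The load may be of order `s * U`. In this form the load is traded for `val k`, which cancels
  -- against the denominator of `d k`.
  have hstep : ∀ k < D.s, D.load k (D.row k) * (x k (D.row k) - x (k + 1) (D.row k)) =
      b k + D.val k * x (k + 1) (D.row k) := fun k hk => by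
    have h1 := hload k hk.le _ (hD.row_lt k hk)
    have h2 := hload (k + 1) hk _ (hD.row_lt k hk)
    rw [load_succ_self, rowSum_succ_self] at h2
    linarith
  have hah : ∀ k < D.s, ∀ z, |z / (D.val k * D.height k)| ≤ 2 * (|z| / |D.val k|) := fun k hk z => by
    have h1 := (hD.height_mem hk).1
    have h2 := hD.one_le_abs k hk
    rw [abs_div, abs_mul, abs_of_pos (hD.height_pos hk), ← div_div,
      div_le_iff₀ (hD.height_pos hk)]
    have : 0 ≤ |z| / |D.val k| := by positivity
    nlinarith
  have hah' : ∀ k < D.s, ∀ z, |z / (D.val k * D.height k)| ≤ 2 * |z| := fun k hk z => by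
    have := div_le_self (abs_nonneg z) (hD.one_le_abs k hk)
    linarith [hah k hk z]
  have hdM : ∀ k < D.s, |d k| ≤ 8 * M := fun k hk => by
    have hv := hD.val_ne_zero hk
    have hh := (hD.height_pos hk).ne'
    have h1 : d k = (g k 3 - b k) / (D.val k * D.height k) -
        (D.val k * x (k + 1) (D.row k)) / (D.val k * D.height k) := by
      rw [hd]
      simp only
      rw [hstep k hk]
      ring
    have h2 := hah' k hk (g k 3 - b k)
    have h3 := hah k hk (D.val k * x (k + 1) (D.row k))
    rw [abs_mul (D.val k), mul_div_cancel_left₀ _ (abs_ne_zero.2 hv)] at h3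
    have h4 := hxM (k + 1) hk _ (hD.row_lt k hk)
    have h5 := abs_sub (g k 3) (b k)
    have h6 := hgb k 3
    have h7 := hbM k hk
    rw [h1]
    refine (abs_sub _ _).trans ?_
    linarith
  -- Vertical steps accumulate along the chain; this is the source of the factor `D.s` in the final
  -- bound.
  have hdsum : ∀ k ≤ D.s, ∀ i, |D.rowSum d k i| ≤ 8 * (D.s * M) := fun k hk i => by
    calc |D.rowSum d k i| ≤ D.rowSum (fun _ => 8 * M * 1) k i :=
          D.abs_rowSum_le fun l hl => by rw [mul_one]; exact hdM l (hl.trans_le hk)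
      _ = 8 * M * D.rowSum (fun _ => 1) k i := by rw [rowSum_const_mul]
      _ ≤ 8 * M * D.s := by
          refine mul_le_mul_of_nonneg_left ((D.rowSum_one_le k i).trans ?_) (by linarith)
          exact_mod_cast hk
      _ = 8 * (D.s * M) := by ring
  -- The displacement of a foot solves the bar to the original joint (horizontally) and the bar to
  -- the chain (vertically).
  set X := D.onJoints V (fun _ => 0) (fun k => V (D.col k) - g k 0 / D.val k)
    (fun k => x (k + 1) (D.row k)) with hX
  set Y := D.onJoints (fun _ => 0) (fun _ => 0)
    (fun k => D.rowSum d k (D.row k) - g k 1 / (D.val k * D.height k))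
    (fun k => D.rowSum d (k + 1) (D.row k)) with hY
  have hXlast : ∀ k, ∀ i < D.m, X (D.last k i) = x k i := fun k i hi => by
    refine D.onJoints_last _ _ _ _ hi ?_ ?_ ?_ k
    · simp [hx]
    · rintro k rfl; rfl
    · intro k hk
      simp only [hx, rowSum_succ_of_ne _ _ hk, load_succ_of_ne _ hk]
  have hYlast : ∀ k, ∀ i < D.m, Y (D.last k i) = D.rowSum d k i := fun k i hi => by
    refine D.onJoints_last _ _ _ _ (G := fun k i => D.rowSum d k i) hi ?_ ?_ ?_ k
    · simp
    · rintro k rfl; rfl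
    · intro k hk
      simp only [rowSum_succ_of_ne _ _ hk]
  refine ⟨X, Y, fun e he => ?_, fun v hv => ?_⟩
  · refine D.bar_cases (P := fun e => (D.bar e).form X Y = W e) (fun k hk t ht => ?_)
      (fun i hi => ?_) he
    · rw [D.bar_entry hk ht]
      have hi := hD.row_lt k hk
      have hq := (scale_pos (D := D) (D.row k)).ne'
      have hv := hD.val_ne_zero hk
      have hh := (hD.height_pos hk).ne'
      have hw : ∀ t, W (4 * k + t) = D.scale (D.row k) * g k t := fun t => by
        rw [hg]; field_simp
      have hdk : D.val k * D.height k * d k = g k 3 - (b k + D.val k * x (k + 1) (D.row k)) := by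
        rw [← hstep k hk, hd]; field_simp
      have e1 : X (D.col k) = V (D.col k) := D.onJoints_original _ _ _ _ (hD.col_lt k hk)
      have e2 : X (D.foot k) = V (D.col k) - g k 0 / D.val k := D.onJoints_foot _ _ _ _ k
      have e3 : X (D.head k) = x (k + 1) (D.row k) := D.onJoints_head _ _ _ _ k
      have e4 := hXlast k _ hi
      have e5 : Y (D.foot k) = D.rowSum d k (D.row k) - g k 1 / (D.val k * D.height k) :=
        D.onJoints_foot _ _ _ _ k
      have e6 : Y (D.head k) = D.rowSum d k (D.row k) + d k := by
        rw [← rowSum_succ_self]; exact D.onJoints_head _ _ _ _ k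
      have e7 := hYlast k _ hi
      have hbk : b k = g k 0 + g k 1 + g k 2 + g k 3 - D.val k * V (D.col k) := rfl
      have e8 : D.val k * (g k 0 / D.val k) = g k 0 := mul_div_cancel₀ _ hv
      have e9 : D.val k * D.height k * (g k 1 / (D.val k * D.height k)) = g k 1 :=
        mul_div_cancel₀ _ (mul_ne_zero hv hh)
      have h10 := hstep k hk
      rw [hw]
      interval_cases t <;>
        simp only [entryBar, Bar.form, e1, e2, e3, e4, e5, e6, e7]
      · linear_combination D.scale (D.row k) * e8
      · linear_combination D.scale (D.row k) * e9
      -- The bar from foot to head determines no unknown: its equation is the summed equation of the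
      -- entry minus those of the other three bars.
      · linear_combination D.scale (D.row k) * (-e8 - e9 - hdk + hbk)
      · linear_combination D.scale (D.row k) * (h10 + hdk)
    · rw [bar_closing]
      have hq := (scale_pos (D := D) i).ne'
      -- No unknown is left for the closing bar; its equation is the relation imposed by row `i`.
      have h1 := hrel i hi
      rw [D.sum_owner W hi] at h1
      have h2 : D.rowSum (fun k => W (4 * k + 0) + W (4 * k + 1) + W (4 * k + 2) +
          W (4 * k + 3)) D.s i =
          D.scale i * (D.rowSum b D.s i + D.rowSum (fun l => D.val l * V (D.col l)) D.s i) := by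
        rw [← rowSum_add, ← rowSum_const_mul]
        refine D.rowSum_congr fun l hl hli => ?_
        simp only [hb, hg, hli]
        field_simp
        ring
      have h3 := hload D.s le_rfl i hi
      rw [hD.load_s hi] at h3
      have h4 : X (D.anchor i) = 0 := D.onJoints_anchor _ _ _ _ hi
      simp only [closingBar, Bar.form, h4, hXlast D.s i hi]
      linear_combination D.scale i * h3 + h2 - h1
  · refine D.joint_cases (P := fun v => |X v| ≤ 10 * D.s * M ∧ |Y v| ≤ 10 * D.s * M)
      (fun j hj => ?_) (fun i hi => ?_) (fun k hk => ?_) (fun k hk => ?_) hv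
    · rw [hX, hY, D.onJoints_original _ _ _ _ hj, D.onJoints_original _ _ _ _ hj, abs_zero]
      exact ⟨by linarith [hV j], by linarith⟩
    · rw [hX, hY, D.onJoints_anchor _ _ _ _ hi, D.onJoints_anchor _ _ _ _ hi, abs_zero]
      exact ⟨by linarith, by linarith⟩
    · rw [hX, hY, D.onJoints_foot, D.onJoints_foot]
      refine ⟨(abs_sub _ _).trans ?_, (abs_sub _ _).trans ?_⟩
      · have h1 := hV (D.col k)
        have h2 : |g k 0 / D.val k| ≤ β := by
          rw [abs_div]
          exact (div_le_self (abs_nonneg _) (hD.one_le_abs k hk)).trans (hgb k 0)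
        linarith
      · have h1 := hdsum k hk.le (D.row k)
        have h2 := hah' k hk (g k 1)
        have h3 := hgb k 1
        linarith
    · rw [hX, hY, D.onJoints_head, D.onJoints_head]
      have h1 := hxM (k + 1) hk _ (hD.row_lt k hk)
      have h2 := hdsum (k + 1) hk (D.row k)
      exact ⟨by linarith, by linarith⟩

end SparseSystem

/-! ### The truss in the plane -/

namespace SparseSystem

variable (D : SparseSystem)

/-- The horizontal positions of the joints. -/
def posX : ℕ → ℝ :=
  D.onJoints (fun j => -((j : ℝ) + 1)) (fun i => ((i * (D.s + 1) : ℕ) : ℝ))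
    (fun k => ((D.row k * (D.s + 1) + D.rank k (D.row k) : ℕ) : ℝ))
    (fun k => ((D.row k * (D.s + 1) + D.rank (k + 1) (D.row k) : ℕ) : ℝ))

/-- The vertical positions of the joints. -/
def posY : ℕ → ℝ :=
  D.onJoints (fun _ => 0) (fun _ => 1) (fun _ => 0) D.height

theorem posX_last {i : ℕ} (hi : i < D.m) (k : ℕ) :
    D.posX (D.last k i) = ((i * (D.s + 1) + D.rank k i : ℕ) : ℝ) := by
  refine D.onJoints_last _ _ _ _ (G := fun k i => ((i * (D.s + 1) + D.rank k i : ℕ) : ℝ))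
    hi ?_ ?_ ?_ k
  · simp
  · rintro k rfl; rfl
  · intro k hk
    simp only [rank_succ, hk, if_false, add_zero]

theorem rank_succ_self (k : ℕ) : D.rank (k + 1) (D.row k) = D.rank k (D.row k) + 1 := by
  simp [rank_succ]

/-- The rank increases by one at each entry of its row, so within a row it identifies the entry. -/
theorem eq_of_rank_eq {k k' : ℕ} (h : D.row k = D.row k')
    (hr : D.rank k (D.row k) = D.rank k' (D.row k')) : k = k' := by
  rcases lt_trichotomy k k' with hlt | rfl | hlt
  · have h1 := D.rank_mono (Nat.succ_le_of_lt hlt) (D.row k)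
    rw [Nat.succ_eq_add_one, rank_succ_self] at h1
    rw [h] at *
    omega
  · rfl
  · have h1 := D.rank_mono (Nat.succ_le_of_lt hlt) (D.row k')
    rw [Nat.succ_eq_add_one, rank_succ_self] at h1
    rw [h] at *
    omega

/-- Each row is given its own stretch of `s + 1` consecutive integer abscissas; ranks are at most
`s`, so the stretches of different rows are disjoint. -/
theorem eq_and_eq_of_mul_add_eq {N a b a' b' : ℕ} (hb : b ≤ N) (hb' : b' ≤ N)
    (h : a * (N + 1) + b = a' * (N + 1) + b') : a = a' ∧ b = b' := by
  have h1 : (a * (N + 1) + b) / (N + 1) = a := by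
    rw [add_comm, Nat.add_mul_div_right _ _ (Nat.succ_pos N), Nat.div_eq_of_lt (by omega), zero_add]
  have h2 : (a' * (N + 1) + b') / (N + 1) = a' := by
    rw [add_comm, Nat.add_mul_div_right _ _ (Nat.succ_pos N), Nat.div_eq_of_lt (by omega), zero_add]
  have h3 : a = a' := by rw [← h1, h, h2]
  subst h3
  exact ⟨rfl, by omega⟩

variable {D}

namespace IsBalanced

variable (hD : D.IsBalanced)
include hD

/-- Height times load equals the mass all along the chain. The anchor has height one because the
initial load is the mass. -/
theorem posY_last {i : ℕ} (hi : i < D.m) (k : ℕ) :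
    D.posY (D.last k i) = D.mass i / D.load k i := by
  refine D.onJoints_last _ _ _ _ (G := fun k i => D.mass i / D.load k i) hi ?_ ?_ ?_ k
  · have := hD.two_le_mass hi
    simp only [load_zero]
    exact div_self (by linarith)
  · rintro k rfl; rfl
  · intro k hk
    simp only [load_succ_of_ne _ hk]

/-- The four kinds of joints are told apart by their positions. -/
theorem eq_of_pos_eq {v v' : ℕ} (hv : v < D.joints) (hv' : v' < D.joints)
    (hx : D.posX v = D.posX v') (hy : D.posY v = D.posY v') : v = v' := by
  -- Original joints have negative abscissa and all others non-negative; feet lie on the axis, while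
  -- anchors and heads lie strictly above it. Anchors have rank offset zero and heads at least one.
  have horig : ∀ j < D.n, D.posX j < 0 := fun j hj => by
    rw [posX, D.onJoints_original _ _ _ _ hj]
    linarith [Nat.cast_nonneg (α := ℝ) j]
  have hfoot : ∀ k, D.posX (D.foot k) = ((D.row k * (D.s + 1) + D.rank k (D.row k) : ℕ) : ℝ) :=
    fun k => D.onJoints_foot _ _ _ _ k
  have hhead : ∀ k, D.posX (D.head k) =
      ((D.row k * (D.s + 1) + D.rank (k + 1) (D.row k) : ℕ) : ℝ) :=
    fun k => D.onJoints_head _ _ _ _ k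
  have hanch : ∀ i < D.m, D.posX (D.anchor i) = ((i * (D.s + 1) : ℕ) : ℝ) :=
    fun i hi => D.onJoints_anchor _ _ _ _ hi
  have hfootY : ∀ k, D.posY (D.foot k) = 0 := fun k => D.onJoints_foot _ _ _ _ k
  have hheadY : ∀ k < D.s, 0 < D.posY (D.head k) := fun k hk => by
    rw [posY, D.onJoints_head]; exact hD.height_pos hk
  have hanchY : ∀ i < D.m, 0 < D.posY (D.anchor i) := fun i hi => by
    rw [posY, D.onJoints_anchor _ _ _ _ hi]; exact one_pos
  have hnn : ∀ k : ℕ, (0 : ℝ) ≤ (k : ℝ) := fun k => Nat.cast_nonneg k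
  have hrank : ∀ k ≤ D.s, ∀ i, D.rank k i ≤ D.s := fun k hk i => (D.rank_le k i).trans hk
  have hah : ∀ i < D.m, ∀ k < D.s, D.posX (D.anchor i) ≠ D.posX (D.head k) := by
    intro i hi k hk h
    rw [hhead, hanch i hi, Nat.cast_inj, rank_succ_self] at h
    have := hrank (k + 1) hk (D.row k)
    rw [rank_succ_self] at this
    have := (eq_and_eq_of_mul_add_eq (b := 0) (Nat.zero_le _) this (by rw [add_zero]; exact h)).2
    omega
  have key : ∀ v < D.joints, D.posX v = D.posX v' → D.posY v = D.posY v' → v = v' := by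
    intro v hv
    refine D.joint_cases (P := fun v' => D.posX v = D.posX v' → D.posY v = D.posY v' → v = v')
      (fun j' hj' => ?_) (fun i' hi' => ?_) (fun k' hk' => ?_) (fun k' hk' => ?_) hv'
    · refine D.joint_cases (P := fun v => D.posX v = D.posX j' → D.posY v = D.posY j' → v = j')
        (fun j hj hx _ => ?_) (fun i hi hx _ => ?_) (fun k hk hx _ => ?_) (fun k hk hx _ => ?_) hv
      · rw [posX, D.onJoints_original _ _ _ _ hj, D.onJoints_original _ _ _ _ hj'] at hx
        have : (j : ℝ) = j' := by linarith
        exact_mod_cast this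
      · have := horig j' hj'; rw [← hx, hanch i hi] at this; exact absurd this (hnn _).not_gt
      · have := horig j' hj'; rw [← hx, hfoot] at this; exact absurd this (hnn _).not_gt
      · have := horig j' hj'; rw [← hx, hhead] at this; exact absurd this (hnn _).not_gt
    · refine D.joint_cases (P := fun v => D.posX v = D.posX (D.anchor i') →
        D.posY v = D.posY (D.anchor i') → v = D.anchor i')
        (fun j hj hx _ => ?_) (fun i hi hx _ => ?_) (fun k hk _ hy => ?_) (fun k hk hx _ => ?_) hv
      · have := horig j hj; rw [hx, hanch i' hi'] at this; exact absurd this (hnn _).not_gt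
      · rw [hanch i hi, hanch i' hi', Nat.cast_inj] at hx
        rw [Nat.eq_of_mul_eq_mul_right (Nat.succ_pos _) hx]
      · have := hanchY i' hi'; rw [← hy, hfootY] at this; exact absurd this (lt_irrefl _)
      · exact absurd hx.symm (hah i' hi' k hk)
    · refine D.joint_cases (P := fun v => D.posX v = D.posX (D.foot k') →
        D.posY v = D.posY (D.foot k') → v = D.foot k')
        (fun j hj hx _ => ?_) (fun i hi _ hy => ?_) (fun k hk hx _ => ?_) (fun k hk _ hy => ?_) hv
      · have := horig j hj; rw [hx, hfoot] at this; exact absurd this (hnn _).not_gt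
      · have := hanchY i hi; rw [hy, hfootY] at this; exact absurd this (lt_irrefl _)
      · rw [hfoot, hfoot, Nat.cast_inj] at hx
        have := eq_and_eq_of_mul_add_eq (hrank k hk.le _) (hrank k' hk'.le _) hx
        rw [D.eq_of_rank_eq this.1 this.2]
      · have := hheadY k hk; rw [hy, hfootY] at this; exact absurd this (lt_irrefl _)
    · refine D.joint_cases (P := fun v => D.posX v = D.posX (D.head k') →
        D.posY v = D.posY (D.head k') → v = D.head k')
        (fun j hj hx _ => ?_) (fun i hi hx _ => ?_) (fun k hk _ hy => ?_) (fun k hk hx _ => ?_) hv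
      · have := horig j hj; rw [hx, hhead] at this; exact absurd this (hnn _).not_gt
      · exact absurd hx (hah i hi k' hk')
      · have := hheadY k' hk'; rw [← hy, hfootY] at this; exact absurd this (lt_irrefl _)
      · rw [hhead, hhead, Nat.cast_inj] at hx
        have := eq_and_eq_of_mul_add_eq (hrank (k + 1) hk _) (hrank (k' + 1) hk' _) hx
        rw [rank_succ_self, rank_succ_self] at this
        rw [D.eq_of_rank_eq this.1 (by omega)]
  exact key v hv hx hy

/-- The linear form of a bar is a multiple of the form of its direction. -/
theorem exists_weight {e : ℕ} (he : e < D.bars) :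
    ∃ w : ℝ, (D.bar e).fx = w * (D.posX (D.bar e).src - D.posX (D.bar e).tgt) ∧
      (D.bar e).fy = w * (D.posY (D.bar e).src - D.posY (D.bar e).tgt) := by
  refine D.bar_cases (P := fun e => ∃ w : ℝ,
    (D.bar e).fx = w * (D.posX (D.bar e).src - D.posX (D.bar e).tgt) ∧
      (D.bar e).fy = w * (D.posY (D.bar e).src - D.posY (D.bar e).tgt))
    (fun k hk t ht => ?_) (fun i hi => ?_) he
  · rw [D.bar_entry hk ht]
    have hi := hD.row_lt k hk
    have hl := (hD.load_pos hk.le hi).ne'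
    have hl' := (hD.load_pos (Nat.succ_le_of_lt hk) hi).ne'
    have hm : D.mass (D.row k) ≠ 0 := by linarith [hD.two_le_mass hi]
    have x1 : D.posX (D.col k) = -((D.col k : ℝ) + 1) :=
      D.onJoints_original _ _ _ _ (hD.col_lt k hk)
    have x2 : D.posX (D.foot k) = ((D.row k * (D.s + 1) + D.rank k (D.row k) : ℕ) : ℝ) :=
      D.onJoints_foot _ _ _ _ k
    have x3 : D.posX (D.head k) =
        ((D.row k * (D.s + 1) + D.rank k (D.row k) : ℕ) : ℝ) + 1 := by
      rw [← Nat.cast_add_one, add_assoc, ← rank_succ_self]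
      exact D.onJoints_head _ _ _ _ k
    have x4 := D.posX_last hi k
    have y1 : D.posY (D.col k) = 0 := D.onJoints_original _ _ _ _ (hD.col_lt k hk)
    have y2 : D.posY (D.foot k) = 0 := D.onJoints_foot _ _ _ _ k
    have y3 : D.posY (D.head k) = D.height k := D.onJoints_head _ _ _ _ k
    have y4 := hD.posY_last hi k
    have hx : (0 : ℝ) ≤ ((D.row k * (D.s + 1) + D.rank k (D.row k) : ℕ) : ℝ) := Nat.cast_nonneg _
    generalize ((D.row k * (D.s + 1) + D.rank k (D.row k) : ℕ) : ℝ) = x at *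
    interval_cases t <;> simp only [entryBar, x1, x2, x3, x4, y1, y2, y3, y4]
    · have : -((D.col k : ℝ) + 1) - x ≠ 0 := by
        have := Nat.cast_nonneg (α := ℝ) (D.col k)
        linarith
      exact ⟨D.scale (D.row k) * D.val k / (-((D.col k : ℝ) + 1) - x),
        (div_mul_cancel₀ _ this).symm, by simp⟩
    · exact ⟨D.scale (D.row k) * D.val k * D.height k / (D.mass (D.row k) / D.load k (D.row k)),
        by simp, by field_simp; simp⟩
    · exact ⟨-(D.scale (D.row k) * D.val k), by ring, by ring⟩
    · refine ⟨-(D.scale (D.row k) * D.load k (D.row k)), by ring, ?_⟩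
      -- Both ends of the chain bar have load times height equal to the mass. Subtracting, `load k`
      -- times the drop in height is `val k * height k`, so the prescribed coefficients follow the
      -- direction of the bar.
      have h1 : D.height k * D.load (k + 1) (D.row k) = D.mass (D.row k) := div_mul_cancel₀ _ hl'
      rw [load_succ_self] at h1
      have h2 : D.load k (D.row k) * (D.mass (D.row k) / D.load k (D.row k)) = D.mass (D.row k) :=
        mul_div_cancel₀ _ hl
      linear_combination D.scale (D.row k) * (h2 - h1)
  · rw [bar_closing]
    have x1 : D.posX (D.anchor i) = ((i * (D.s + 1) : ℕ) : ℝ) := D.onJoints_anchor _ _ _ _ hi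
    have y1 : D.posY (D.anchor i) = 1 := D.onJoints_anchor _ _ _ _ hi
    have hm : D.mass i ≠ 0 := by linarith [hD.two_le_mass hi]
    have hr : (D.rank D.s i : ℝ) ≠ 0 := by exact_mod_cast (hD.rank_pos hi).ne'
    refine ⟨D.scale i * D.mass i / D.rank D.s i, ?_, ?_⟩
    · simp only [closingBar, x1, D.posX_last hi]
      push_cast
      field_simp
      ring
    -- The load is back at the mass, so both ends have height one and the closing bar is horizontal.
    · simp only [closingBar, y1, hD.posY_last hi, hD.load_s hi]
      rw [div_self hm, sub_self, mul_zero]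

/-- Distinct bars join distinct pairs of joints. -/
theorem eq_of_ends_eq {e e' : ℕ} (he : e < D.bars) (he' : e' < D.bars)
    (h1 : (D.bar e).src = (D.bar e').src) (h2 : (D.bar e).tgt = (D.bar e').tgt) : e = e' := by
  have hmix : ∀ k < D.s, ∀ t < 4, ∀ i < D.m, (D.entryBar k t).src = (D.closingBar i).src →
      (D.entryBar k t).tgt ≠ (D.closingBar i).tgt := by
    intro k hk t ht i hi h1 h2
    have hr := hD.row_lt k hk
    interval_cases t <;> simp only [entryBar, closingBar] at h1 h2
    · have := hD.col_lt k hk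
      simp only [anchor] at h1
      omega
    · have h3 : D.posY (D.foot k) = 0 := D.onJoints_foot _ _ _ _ k
      have hm := hD.two_le_mass hi
      rw [h2, hD.posY_last hi, hD.load_s hi, div_self (by linarith)] at h3
      exact one_ne_zero h3
    · simp only [anchor, foot] at h1
      omega
    -- A chain bar could coincide with the closing bar only in a row with one entry: starting at the
    -- anchor forces its head to have rank one, whereas the last joint has rank at least two.
    · have h3 := D.posX_last hr k
      rw [h1, ← last_zero, D.posX_last hi 0, Nat.cast_inj] at h3
      have h4 := eq_and_eq_of_mul_add_eq (by simp) ((D.rank_le k _).trans hk.le) h3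
      have h5 : D.posX (D.head k) = ((D.row k * (D.s + 1) + D.rank (k + 1) (D.row k) : ℕ) : ℝ) :=
        D.onJoints_head _ _ _ _ k
      rw [h2, D.posX_last hi, Nat.cast_inj] at h5
      have h6 := eq_and_eq_of_mul_add_eq (D.rank_le D.s _) ((D.rank_le (k + 1) _).trans hk) h5
      have h7 := hD.two_le_rank hi
      have h8 := D.rank_succ_self k
      have h9 := D.rank_zero i
      omega
  refine D.bar_cases (P := fun e => (D.bar e).src = (D.bar e').src →
    (D.bar e).tgt = (D.bar e').tgt → e = e') (fun k hk t ht => ?_) (fun i hi => ?_) he h1 h2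
  · refine D.bar_cases (P := fun e' => (D.bar (4 * k + t)).src = (D.bar e').src →
      (D.bar (4 * k + t)).tgt = (D.bar e').tgt → 4 * k + t = e')
      (fun k' hk' t' ht' h1 h2 => ?_) (fun i' hi' h1 h2 => ?_) he'
    · rw [D.bar_entry hk ht, D.bar_entry hk' ht'] at h1 h2
      have a1 := D.last_lt_foot (hD.row_lt k hk) k
      have a2 := D.last_lt_foot (hD.row_lt k' hk') k'
      have a3 := hD.col_lt k hk
      have a4 := hD.col_lt k' hk'
      have a5 := D.le_last k (D.row k)
      have a6 := D.le_last k' (D.row k')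
      -- The target reveals `k` and whether it is a foot or a head. Two bars with the same target
      -- have sources separated by `col < n ≤ last < foot`.
      interval_cases t <;> interval_cases t' <;> simp only [entryBar, foot, head] at * <;> omega
    · rw [D.bar_entry hk ht, bar_closing] at h1 h2
      exact absurd h2 (hmix k hk t ht i' hi' h1)
  · refine D.bar_cases (P := fun e' => (D.bar (4 * D.s + i)).src = (D.bar e').src →
      (D.bar (4 * D.s + i)).tgt = (D.bar e').tgt → 4 * D.s + i = e')
      (fun k' hk' t' ht' h1 h2 => ?_) (fun i' hi' h1 h2 => ?_) he'
    · rw [D.bar_entry hk' ht', bar_closing] at h1 h2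
      exact absurd h2.symm (hmix k' hk' t' ht' i hi h1.symm)
    · rw [bar_closing, bar_closing] at h1
      simp only [closingBar, anchor] at h1
      omega

theorem truss2D : Truss2D D.truss := by
  choose! w hwx hwy using fun e (he : e < D.bars) => hD.exists_weight he
  refine ⟨D.joints, rfl, fun v => ![D.posX v, D.posY v],
    fun e => ⟨(D.bar e).src, (hD.src_lt_tgt e.2).trans (tgt_lt e.2)⟩,
    fun e => ⟨(D.bar e).tgt, tgt_lt e.2⟩, fun e => w e, ?_, ?_, ?_, ?_⟩
  · intro v v' h
    exact Fin.ext (hD.eq_of_pos_eq v.2 v'.2 (congrFun h 0) (congrFun h 1))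
  · intro e h
    exact (hD.src_lt_tgt e.2).ne (congrArg Fin.val h)
  · intro e e' h
    have h1 := hD.src_lt_tgt e.2
    have h2 := hD.src_lt_tgt e'.2
    simp only [Sym2.eq_iff, Fin.mk.injEq] at h
    rcases h with h | h
    · exact Fin.ext (hD.eq_of_ends_eq e.2 e'.2 h.1 h.2)
    · omega
  · intro e v a
    have h0 : ((Fin.cast rfl (finProdFinEquiv (v, a)) : Fin (D.joints * 2)) : ℕ) =
        2 * v + a := by simp [finProdFinEquiv, add_comm]
    simp only [truss, h0, Fin.ext_iff]
    fin_cases a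
    · simp [coeff_two_mul, hwx e e.2]
    · simp [coeff_two_mul_add_one, hwy e e.2]

end IsBalanced

end SparseSystem

/-! ### Size and conditioning of the truss -/

open Classical in
/-- The non-zero entries of the row `e` of a bar, in order. -/
def Bar.output (b : Bar) (e : ℕ) : List (ℕ × ℕ × ℝ) :=
  [(e, 2 * b.src, b.fx), (e, 2 * b.src + 1, b.fy), (e, 2 * b.tgt, -b.fx),
    (e, 2 * b.tgt + 1, -b.fy)].filter fun p => decide (p.2.2 ≠ 0)

namespace SparseSystem

theorem coeff_src {b : Bar} (h : b.src < b.tgt) : coeff b (2 * b.src) = b.fx := by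
  simp [coeff_two_mul, h.ne]

theorem coeff_src_add_one {b : Bar} (h : b.src < b.tgt) : coeff b (2 * b.src + 1) = b.fy := by
  simp [coeff_two_mul_add_one, h.ne]

theorem coeff_tgt {b : Bar} (h : b.src < b.tgt) : coeff b (2 * b.tgt) = -b.fx := by
  simp [coeff_two_mul, h.ne']

theorem coeff_tgt_add_one {b : Bar} (h : b.src < b.tgt) : coeff b (2 * b.tgt + 1) = -b.fy := by
  simp [coeff_two_mul_add_one, h.ne']

theorem mem_of_coeff_ne_zero {b : Bar} {c : ℕ} (h : coeff b c ≠ 0) :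
    c ∈ [2 * b.src, 2 * b.src + 1, 2 * b.tgt, 2 * b.tgt + 1] := by
  have : c / 2 = b.src ∨ c / 2 = b.tgt := by
    by_contra! hc
    simp [coeff, hc.1, hc.2] at h
  simp only [List.mem_cons, List.not_mem_nil, or_false]
  omega

-- Both lists are strictly increasing and have the same members; `src < tgt` is what sorts the
-- second one.
open Classical in
theorem filter_coeff {b : Bar} {N : ℕ} (h : b.src < b.tgt) (hN : b.tgt < N) :
    (List.range (N * 2)).filter (fun c => decide (coeff b c ≠ 0)) =
      [2 * b.src, 2 * b.src + 1, 2 * b.tgt, 2 * b.tgt + 1].filter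
        (fun c => decide (coeff b c ≠ 0)) := by
  have hs1 : ((List.range (N * 2)).filter (fun c => decide (coeff b c ≠ 0))).Pairwise (· < ·) :=
    List.pairwise_lt_range.filter _
  have hs2 : ([2 * b.src, 2 * b.src + 1, 2 * b.tgt, 2 * b.tgt + 1].filter
      (fun c => decide (coeff b c ≠ 0))).Pairwise (· < ·) := by
    refine List.Pairwise.filter _ ?_
    simp only [List.pairwise_cons, List.mem_cons, List.not_mem_nil, or_false, forall_eq_or_imp,
      forall_eq, false_implies, implies_true, List.Pairwise.nil, and_true]
    omega
  refine List.Perm.eq_of_pairwise (le := (· < ·)) (fun a c _ _ h1 h2 => by omega) hs1 hs2 ?_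
  refine (List.perm_ext_iff_of_nodup (hs1.imp fun h => h.ne) (hs2.imp fun h => h.ne)).2
    fun c => ?_
  simp only [List.mem_filter, List.mem_range, decide_eq_true_eq]
  constructor
  · exact fun hc => ⟨mem_of_coeff_ne_zero hc.2, hc.2⟩
  · refine fun hc => ⟨?_, hc.2⟩
    have := hc.1
    simp only [List.mem_cons, List.not_mem_nil, or_false] at this
    omega

variable (D : SparseSystem)

/-- The entries of the first `N` rows of the truss incidence matrix. -/
def output (N : ℕ) : List (ℕ × ℕ × ℝ) := (List.range N).flatMap fun e => (D.bar e).output e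

theorem output_succ (N : ℕ) : D.output (N + 1) = D.output N ++ (D.bar N).output N := by
  simp [output, List.range_succ]

theorem length_output (N : ℕ) :
    (D.output N).length = ∑ e ∈ range N, ((D.bar e).output e).length := by
  induction N with
  | zero => simp [output]
  | succ N ih => rw [output_succ, List.length_append, ih, sum_range_succ]

variable {D}

/-- This identifies the order in which bars are written with the row-major order demanded of stored
matrices; within a row it is `filter_coeff`. -/
theorem map_entries_truss (hD : D.IsBalanced) :
    (entries D.truss).map (fun p => ((p.1 : ℕ), (p.2 : ℕ), D.truss p.1 p.2)) =
      D.output D.bars := by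
  classical
  have hrow : ∀ e : Fin D.bars,
      ((List.finRange (D.joints * 2)).filter (fun c => decide (D.truss e c ≠ 0))).map
        (fun c : Fin (D.joints * 2) => ((e : ℕ), (c : ℕ), D.truss e c)) = (D.bar e).output e := by
    intro e
    have h1 := hD.src_lt_tgt e.2
    have h2 : ((List.finRange (D.joints * 2)).filter (fun c => decide (D.truss e c ≠ 0))).map
        (fun c : Fin (D.joints * 2) => ((e : ℕ), (c : ℕ), D.truss e c)) =
        ((List.range (D.joints * 2)).filter (fun c => decide (coeff (D.bar e) c ≠ 0))).map
          (fun c => ((e : ℕ), c, coeff (D.bar e) c)) := by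
      rw [← List.map_coe_finRange_eq_range, List.filter_map, List.map_map]
      rfl
    rw [h2, filter_coeff h1 (tgt_lt e.2), Bar.output]
    simp only [List.filter_cons, coeff_src h1, coeff_src_add_one h1, coeff_tgt h1,
      coeff_tgt_add_one h1, List.filter_nil]
    split_ifs <;>
      simp only [List.map_cons, List.map_nil, coeff_src h1, coeff_src_add_one h1, coeff_tgt h1,
        coeff_tgt_add_one h1]
  rw [output, ← List.map_coe_finRange_eq_range, List.flatMap_map]
  simp only [← hrow]
  have hprod : List.finRange D.bars ×ˢ List.finRange (D.joints * 2) =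
      (List.finRange D.bars).flatMap fun e => (List.finRange (D.joints * 2)).map (Prod.mk e) := rfl
  rw [entries, hprod, List.filter_flatMap, List.map_flatMap]
  simp only [List.filter_map, List.map_map]
  rfl

theorem nnz_truss (hD : D.IsBalanced) : nnz D.truss = (D.output D.bars).length := by
  rw [← map_entries_truss hD, List.length_map, length_entries]

/-- The four bars of an entry have 2, 2, 4 and 4 non-zero coefficients, and a closing bar has 2. -/
theorem cast_nnz_truss (hD : D.IsBalanced) : (nnz D.truss : ℝ) = 12 * D.s + 2 * D.m := by
  rw [nnz_truss hD, length_output]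
  push_cast
  rw [sum_bars]
  have h1 : ∀ k ∈ range D.s, ((((D.bar (4 * k + 0)).output (4 * k + 0)).length : ℝ) +
      (((D.bar (4 * k + 1)).output (4 * k + 1)).length : ℝ) +
      (((D.bar (4 * k + 2)).output (4 * k + 2)).length : ℝ) +
      (((D.bar (4 * k + 3)).output (4 * k + 3)).length : ℝ)) = 12 := by
    intro k hk
    have hk' := mem_range.1 hk
    have a1 := hD.val_ne_zero hk'
    have a2 := (hD.height_pos hk').ne'
    have a3 := (scale_pos (D := D) (D.row k)).ne'
    have a4 := (hD.load_pos hk'.le (hD.row_lt k hk')).ne'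
    simp only [D.bar_entry hk' (show 0 < 4 by norm_num), D.bar_entry hk' (show 1 < 4 by norm_num),
      D.bar_entry hk' (show 2 < 4 by norm_num), D.bar_entry hk' (show 3 < 4 by norm_num), entryBar]
    simp [Bar.output, a1, a2, a3, a4]
    norm_num
  have h2 : ∀ i ∈ range D.m, (((D.bar (4 * D.s + i)).output (4 * D.s + i)).length : ℝ) = 2 := by
    intro i hi
    have a1 : D.mass i ≠ 0 := by linarith [hD.two_le_mass (mem_range.1 hi)]
    have a3 := (scale_pos (D := D) i).ne'
    simp [bar_closing, closingBar, Bar.output, a1, a3]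
  rw [sum_congr rfl h1, sum_congr rfl h2]
  simp
  ring

theorem scale_le (hs : 1 ≤ D.s) (i : ℕ) : D.scale i ≤ 5 / 2 * Real.sqrt D.s := by
  have h1 : (1 : ℝ) ≤ D.s := by exact_mod_cast hs
  have h2 := D.rowSum_one_le D.s i
  have h3 := Real.sq_sqrt (Nat.cast_nonneg (α := ℝ) D.s)
  refine Real.sqrt_le_iff.2 ⟨by positivity, ?_⟩
  nlinarith

theorem mass_le {U : ℝ} (hU : ∀ k < D.s, |D.val k| ≤ U) (hU0 : 0 ≤ U) (i : ℕ) :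
    D.mass i ≤ D.s * U := by
  calc D.mass i ≤ D.rowSum (fun _ => U * 1) D.s i :=
        D.rowSum_mono fun l hl => by rw [mul_one]; exact hU l hl
    _ = U * D.rowSum (fun _ => 1) D.s i := by rw [rowSum_const_mul]
    _ ≤ U * D.s := mul_le_mul_of_nonneg_left (D.rowSum_one_le D.s i) hU0
    _ = D.s * U := mul_comm _ _

/-! ### Entries, singular values and condition number of the truss matrix -/

section bounds

variable (hD : D.IsBalanced) (hs : 1 ≤ D.s) {U : ℝ} (hU : 1 ≤ U) (hval : ∀ k < D.s, |D.val k| ≤ U)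
include hD hs hU hval

/-- Up to sign a non-zero coefficient is `scale`, which lies between `1` and `5 / 2 * √s`, times one
of `val`, `val * height`, `load`, `mass`, each of absolute value between `1 / 2` and `2 * s * U`. -/
theorem bar_bounds {e : ℕ} (he : e < D.bars) :
    (|(D.bar e).fx| ≤ 5 * (D.s * Real.sqrt D.s) * U ∧ ((D.bar e).fx ≠ 0 → 1 / 2 ≤ |(D.bar e).fx|)) ∧
    (|(D.bar e).fy| ≤ 5 * (D.s * Real.sqrt D.s) * U ∧
      ((D.bar e).fy ≠ 0 → 1 / 2 ≤ |(D.bar e).fy|)) := by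
  have hs1 : (1 : ℝ) ≤ D.s := by exact_mod_cast hs
  have hU0 : 0 ≤ U := zero_le_one.trans hU
  have hq0 : 0 ≤ Real.sqrt D.s := Real.sqrt_nonneg _
  have hpos : 0 ≤ 5 * (D.s * Real.sqrt D.s) * U := by positivity
  have hzero : |(0 : ℝ)| ≤ 5 * (D.s * Real.sqrt D.s) * U ∧ ((0 : ℝ) ≠ 0 → 1 / 2 ≤ |(0 : ℝ)|) := by
    simp only [abs_zero]
    exact ⟨hpos, fun h => absurd rfl h⟩
  have hscale : ∀ i z, 1 / 2 ≤ |z| → |z| ≤ 2 * (D.s * U) →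
      |D.scale i * z| ≤ 5 * (D.s * Real.sqrt D.s) * U ∧
        (D.scale i * z ≠ 0 → 1 / 2 ≤ |D.scale i * z|) := by
    intro i z h1 h2
    rw [abs_mul, abs_of_pos (scale_pos i)]
    constructor
    · calc D.scale i * |z| ≤ 5 / 2 * Real.sqrt D.s * (2 * (D.s * U)) :=
            mul_le_mul (scale_le hs i) h2 (abs_nonneg _) (by positivity)
        _ = _ := by ring
    · intro _
      nlinarith [one_le_scale (D := D) i]
  refine D.bar_cases (P := fun e =>
    (|(D.bar e).fx| ≤ 5 * (D.s * Real.sqrt D.s) * U ∧ ((D.bar e).fx ≠ 0 → 1 / 2 ≤ |(D.bar e).fx|)) ∧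
    (|(D.bar e).fy| ≤ 5 * (D.s * Real.sqrt D.s) * U ∧
      ((D.bar e).fy ≠ 0 → 1 / 2 ≤ |(D.bar e).fy|))) (fun k hk t ht => ?_) (fun i hi => ?_) he
  · rw [D.bar_entry hk ht]
    have hv1 := hD.one_le_abs k hk
    have hv2 := hval k hk
    have hh := hD.height_mem hk
    have hi := hD.row_lt k hk
    have hsU : U ≤ D.s * U := le_mul_of_one_le_left hU0 hs1
    have ha := hscale (D.row k) (D.val k) (by linarith) (by linarith)
    have hbabs : |D.val k * D.height k| = |D.val k| * D.height k := by
      rw [abs_mul, abs_of_pos (hD.height_pos hk)]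
    have hb := hscale (D.row k) (D.val k * D.height k) (by rw [hbabs]; nlinarith)
      (by rw [hbabs]; nlinarith)
    rw [← mul_assoc] at hb
    have hl1 := hD.half_mass_le_load hk.le hi
    have hl2 := load_le (i := D.row k) hk.le
    have hm1 := hD.two_le_mass hi
    have hm2 := mass_le hval hU0 (D.row k)
    have hl := hscale (D.row k) (D.load k (D.row k))
      (by rw [abs_of_pos (by linarith)]; linarith) (by rw [abs_of_pos (by linarith)]; linarith)
    interval_cases t
    · exact ⟨ha, hzero⟩
    · exact ⟨hzero, hb⟩
    · exact ⟨ha, hb⟩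
    · refine ⟨hl, ?_⟩
      simp only [entryBar, abs_neg, neg_ne_zero]
      exact hb
  · rw [bar_closing]
    have hm1 := hD.two_le_mass hi
    have hm2 := mass_le hval hU0 i
    have hl := hscale i (D.mass i)
      (by rw [abs_of_pos (by linarith)]; linarith) (by rw [abs_of_pos (by linarith)]; linarith)
    refine ⟨?_, hzero⟩
    simp only [closingBar, abs_neg, neg_ne_zero]
    exact hl

theorem truss_entry_bounds (e : Fin D.bars) (c : Fin (D.joints * 2)) :
    |D.truss e c| ≤ 5 * (D.s * Real.sqrt D.s) * U ∧
      (D.truss e c ≠ 0 → 1 / 2 ≤ |D.truss e c|) := by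
  have hU0 : 0 ≤ U := zero_le_one.trans hU
  have hpos : 0 ≤ 5 * (D.s * Real.sqrt D.s) * U := by positivity
  obtain ⟨hx, hy⟩ := bar_bounds hD hs hU hval e.2
  have hne := hD.src_lt_tgt e.2
  by_cases h0 : D.truss e c = 0
  · rw [h0, abs_zero]
    exact ⟨hpos, fun h => absurd rfl h⟩
  · have hmem := mem_of_coeff_ne_zero h0
    simp only [List.mem_cons, List.not_mem_nil, or_false] at hmem
    have hdef : D.truss e c = coeff (D.bar e) c := rfl
    rcases hmem with h | h | h | h <;> rw [hdef, h]
    · rw [coeff_src hne]; exact hx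
    · rw [coeff_src_add_one hne]; exact hy
    · rw [coeff_tgt hne, abs_neg, neg_ne_zero]; exact hx
    · rw [coeff_tgt_add_one hne, abs_neg, neg_ne_zero]; exact hy

theorem sigmaMax_truss_le (hm : D.m ≤ D.s) :
    sigmaMax D.truss ≤ 50 * (D.s : ℝ) ^ 2 * U := by
  have hU0 : 0 ≤ U := zero_le_one.trans hU
  refine sigmaMax_le (by positivity) fun y => ?_
  have h1 : ∀ e, |act D.truss y e| ≤ 20 * (D.s * Real.sqrt D.s) * U * ‖y‖ := by
    intro e
    obtain ⟨hx, hy⟩ := bar_bounds hD hs hU hval e.2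
    rw [act_truss hD, Bar.form]
    have hd : ∀ a v v', |displacement y a v - displacement y a v'| ≤ 2 * ‖y‖ := fun a v v' => by
      have a1 := abs_coord_le y (2 * v + a)
      have a2 := abs_coord_le y (2 * v' + a)
      refine (abs_sub _ _).trans ?_
      simp only [displacement]
      linarith
    refine (abs_add_le _ _).trans ?_
    rw [abs_mul, abs_mul]
    have b1 := mul_le_mul hx.1 (hd 0 (D.bar e).src (D.bar e).tgt) (abs_nonneg _) (by positivity)
    have b2 := mul_le_mul hy.1 (hd 1 (D.bar e).src (D.bar e).tgt) (abs_nonneg _) (by positivity)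
    linarith
  refine (norm_le_sqrt_mul _ (by positivity) h1).trans ?_
  -- There are `4 * s + m ≤ 5 * s` bars, and `5 ≤ (5 / 2) ^ 2`.
  have h2 : Real.sqrt D.bars ≤ 5 / 2 * Real.sqrt D.s := by
    refine Real.sqrt_le_iff.2 ⟨by positivity, ?_⟩
    rw [mul_pow, Real.sq_sqrt (Nat.cast_nonneg _), bars]
    push_cast
    have : (D.m : ℝ) ≤ D.s := by exact_mod_cast hm
    nlinarith [Nat.cast_nonneg (α := ℝ) D.s]
  calc Real.sqrt D.bars * (20 * (D.s * Real.sqrt D.s) * U * ‖y‖)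
      ≤ 5 / 2 * Real.sqrt D.s * (20 * (D.s * Real.sqrt D.s) * U * ‖y‖) :=
        mul_le_mul_of_nonneg_right h2 (by positivity)
    _ = 50 * D.s * (Real.sqrt D.s * Real.sqrt D.s) * U * ‖y‖ := by ring
    _ = 50 * (D.s : ℝ) ^ 2 * U * ‖y‖ := by
        rw [Real.mul_self_sqrt (Nat.cast_nonneg _)]; ring

/-- The entries of `u` are prescribed as horizontal displacements of the original joints. The factor
`3 * √s` passes from the entrywise to the Euclidean bound: there are `2 * (n + m + 2 * s) ≤ 8 * s`
coordinates. -/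
theorem exists_act_truss_eq (hm : D.m ≤ D.s) (hn : D.n ≤ D.s) {A : Matrix (Fin D.m) (Fin D.n) ℝ}
    (hA : D.Represents A) {w : EuclideanSpace ℝ (Fin D.bars)} {u : EuclideanSpace ℝ (Fin D.n)}
    (h : act D.spread.transpose w = act A u) :
    ∃ y, act D.truss y = w ∧
      ‖y‖ ≤ 3 * Real.sqrt D.s * (10 * D.s * (4 * ‖w‖ + U * ‖u‖)) := by
  have hU0 : 0 ≤ U := zero_le_one.trans hU
  obtain ⟨X, Y, hXY, hb⟩ := exists_form_eq hD hs (W := coord w) (V := coord u)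
    (norm_nonneg u) hU (abs_coord_le w) (abs_coord_le u) hval (by
      intro i hi
      have h1 := congrArg (fun v : EuclideanSpace ℝ (Fin D.m) => v ⟨i, hi⟩) h
      simp only [act_spread_transpose, hA u ⟨i, hi⟩] at h1
      rw [div_eq_iff (scale_pos _).ne'] at h1
      rw [h1, mul_comm])
  set y : EuclideanSpace ℝ (Fin (D.joints * 2)) :=
    WithLp.toLp 2 fun c => if (c : ℕ) % 2 = 0 then X (c / 2) else Y (c / 2) with hy
  have hy0 : ∀ v < D.joints, displacement y 0 v = X v := fun v hv => by
    rw [displacement, coord_of_lt _ (by omega)]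
    simp [hy]
  have hy1 : ∀ v < D.joints, displacement y 1 v = Y v := fun v hv => by
    rw [displacement, coord_of_lt _ (by omega)]
    have : (2 * v + 1) / 2 = v := by omega
    simp [hy, Nat.add_mod, this]
  refine ⟨y, ?_, ?_⟩
  · ext e
    have h1 := hD.src_lt_tgt e.2
    have h2 := tgt_lt e.2
    rw [act_truss hD, ← coord_val w e, ← hXY e e.2]
    simp only [Bar.form, hy0 _ h2, hy0 _ (h1.trans h2), hy1 _ h2, hy1 _ (h1.trans h2)]
  · have h1 : ∀ c, |y c| ≤ 10 * D.s * (4 * ‖w‖ + U * ‖u‖) := by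
      intro c
      have := hb (c / 2) (by have := c.2; omega)
      simp only [hy]
      split_ifs
      · exact this.1
      · exact this.2
    refine (norm_le_sqrt_mul _ (by positivity) h1).trans
      (mul_le_mul_of_nonneg_right ?_ (by positivity))
    refine Real.sqrt_le_iff.2 ⟨by positivity, ?_⟩
    rw [mul_pow, Real.sq_sqrt (Nat.cast_nonneg _), joints]
    push_cast
    have a1 : (D.m : ℝ) ≤ D.s := by exact_mod_cast hm
    have a2 : (D.n : ℝ) ≤ D.s := by exact_mod_cast hn
    nlinarith [Nat.cast_nonneg (α := ℝ) D.s]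

/-- For the smallest singular value, a short preimage `u` under `A` of the contracted right-hand
side is extended to a displacement of the whole truss. The constant is the product of `50` from
`sigmaMax_truss_le` and `150` from `M`. -/
theorem condNumber_truss_le (hm : D.m ≤ D.s) (hn : D.n ≤ D.s)
    {A : Matrix (Fin D.m) (Fin D.n) ℝ} (hA : D.Represents A) (hA0 : A ≠ 0) (hB0 : D.truss ≠ 0)
    (hmax : 1 ≤ sigmaMax A) :
    condNumber D.truss ≤ 7500 * (condNumber A * (D.s : ℝ) ^ 4 * U ^ 2) := by
  have hU0 : 0 ≤ U := zero_le_one.trans hU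
  have hs1 : (1 : ℝ) ≤ D.s := by exact_mod_cast hs
  have hK := one_le_condNumber hA0
  set K := condNumber A with hKdef
  -- The product of `3 * s` (from `3 * √s`), `10 * s`, and `5 * U * K` from `h3`.
  set M : ℝ := 150 * ((D.s : ℝ) ^ 2 * U * K) with hM
  have hM0 : 0 < M := by positivity
  have hmin : M⁻¹ ≤ sigmaMin D.truss := by
    refine inv_le_sigmaMin hB0 hM0 fun x => ?_
    obtain ⟨u, hu, hun⟩ := exists_preimage_norm_le hA0 hmax (recover x)
    rw [← act_spread_transpose_truss hD hA] at hun
    rw [← act_spread_transpose_truss hD hA] at hu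
    obtain ⟨y, hy, hyn⟩ := exists_act_truss_eq hD hs hU hval hm hn hA hu.symm
    refine ⟨y, hy, hyn.trans ?_⟩
    have h1 := norm_le_of_adjoint_leftInverse (act D.spread) (act D.spread.transpose)
      (inner_act _) (act_spread_transpose_spread hD) (act D.truss x)
    set w := ‖act D.truss x‖
    have hw : 0 ≤ w := norm_nonneg _
    have h2 : ‖u‖ ≤ K * w := hun.trans (mul_le_mul_of_nonneg_left h1 (by linarith))
    have h3 : 4 * w + U * ‖u‖ ≤ 5 * (U * K * w) := by
      have a1 : U * ‖u‖ ≤ U * (K * w) := mul_le_mul_of_nonneg_left h2 hU0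
      have a2 : 1 * w ≤ (U * K) * w :=
        mul_le_mul_of_nonneg_right (by nlinarith) hw
      linarith
    have h4 : Real.sqrt D.s ≤ D.s := Real.sqrt_le_self_iff.2 (Or.inr hs1)
    calc 3 * Real.sqrt D.s * (10 * D.s * (4 * w + U * ‖u‖))
        ≤ 3 * D.s * (10 * D.s * (5 * (U * K * w))) := by gcongr
      _ = M * w := by rw [hM]; ring
  rw [condNumber, div_le_iff₀ (lt_of_lt_of_le (inv_pos.2 hM0) hmin)]
  calc sigmaMax D.truss ≤ 50 * (D.s : ℝ) ^ 2 * U := sigmaMax_truss_le hD hs hU hval hm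
    _ = 7500 * (K * (D.s : ℝ) ^ 4 * U ^ 2) * M⁻¹ := by
        rw [hM]
        have : (D.s : ℝ) ≠ 0 := by positivity
        have : U ≠ 0 := by positivity
        have : K ≠ 0 := by positivity
        field_simp
        ring
    _ ≤ _ := mul_le_mul_of_nonneg_left hmin (by positivity)

end bounds

end SparseSystem

/-! ### Reasoning about programs -/

/-- Started in `σ`, the program halts within `T` steps in a state with property `Q`. -/
def Runs (p : Prog) (σ : Store) (T : ℕ) (Q : Store → Prop) : Prop :=
  ∃ t τ, t ≤ T ∧ Exec p σ t τ ∧ Q τ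

theorem Runs.mono {p : Prog} {σ : Store} {T T' : ℕ} {Q Q' : Store → Prop} (h : Runs p σ T Q)
    (hT : T ≤ T') (hQ : ∀ τ, Q τ → Q' τ) : Runs p σ T' Q' := by
  obtain ⟨t, τ, ht, he, hq⟩ := h
  exact ⟨t, τ, ht.trans hT, he, hQ τ hq⟩

theorem Runs.seq {p q : Prog} {σ : Store} {T T' : ℕ} {Q Q' : Store → Prop} (h : Runs p σ T Q)
    (h' : ∀ τ, Q τ → Runs q τ T' Q') : Runs (.seq p q) σ (T + T') Q' := by
  obtain ⟨t, τ, ht, he, hq⟩ := h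
  obtain ⟨t', τ', ht', he', hq'⟩ := h' τ hq
  exact ⟨t + t', τ', add_le_add ht ht', .seq he he', hq'⟩

theorem Runs.cond {b : Test} {p q : Prog} {σ : Store} {T : ℕ} {Q : Store → Prop}
    (h1 : b.Holds σ → Runs p σ T Q) (h2 : ¬ b.Holds σ → Runs q σ T Q) :
    Runs (.cond b p q) σ (T + 1) Q := by
  by_cases hb : b.Holds σ
  · obtain ⟨t, τ, ht, he, hq⟩ := h1 hb
    exact ⟨t + 1, τ, by omega, .condTrue hb he, hq⟩
  · obtain ⟨t, τ, ht, he, hq⟩ := h2 hb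
    exact ⟨t + 1, τ, by omega, .condFalse hb he, hq⟩

theorem Runs.skip {σ : Store} {T : ℕ} {Q : Store → Prop} (h : Q σ) : Runs .skip σ T Q :=
  ⟨0, σ, Nat.zero_le _, .skip σ, h⟩

/-- A loop that is controlled by a counter. -/
theorem Runs.loop {b : Test} {p : Prog} {N T : ℕ} (I : ℕ → Store → Prop)
    (hb : ∀ k τ, I k τ → (b.Holds τ ↔ k < N))
    (hp : ∀ k < N, ∀ τ, I k τ → Runs p τ T (I (k + 1))) {σ : Store} (h : I 0 σ) :
    Runs (.loop b p) σ (N * (T + 1) + 1) (I N) := by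
  have key : ∀ j k τ, k + j = N → I k τ → Runs (.loop b p) τ (j * (T + 1) + 1) (I N) := by
    intro j
    induction j with
    | zero =>
      intro k τ hk hI
      obtain rfl : k = N := by omega
      refine ⟨1, τ, by omega, .loopFalse ?_, hI⟩
      rw [hb k τ hI]
      exact lt_irrefl k
    | succ j ih =>
      intro k τ hk hI
      obtain ⟨t, υ, ht, he, hI'⟩ := hp k (by omega) τ hI
      obtain ⟨t', υ', ht', he', hq⟩ := ih (k + 1) υ (by omega) hI'
      refine ⟨t + t' + 1, υ', ?_, .loopTrue ((hb k τ hI).2 (by omega)) he he', hq⟩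
      rw [Nat.succ_mul]
      omega
  exact key N 0 σ (by omega) h

/-- A straight-line program. -/
def block : List Instr → Prog
  | [] => .skip
  | i :: l => .seq (.instr i) (block l)

/-- The effect of a straight-line program. -/
def runBlock : List Instr → Store → Store
  | [], σ => σ
  | i :: l, σ => runBlock l (i.apply σ)

theorem Runs.block {l : List Instr} {σ : Store} {Q : Store → Prop} (h : Q (runBlock l σ)) :
    Runs (block l) σ l.length Q := by
  induction l generalizing σ with
  | nil => exact Runs.skip h
  | cons i l ih =>
    rw [List.length_cons, add_comm]
    exact Runs.seq (Q := fun τ => τ = i.apply σ) ⟨1, _, le_rfl, .instr i σ, rfl⟩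
      fun τ hτ => ih (by subst hτ; exact h)

theorem runBlock_nil (σ : Store) : runBlock [] σ = σ := rfl

theorem runBlock_cons (i : Instr) (l : List Instr) (σ : Store) :
    runBlock (i :: l) σ = runBlock l (i.apply σ) := rfl

section fields

variable (σ : Store) (d i : ℕ)

theorem idx_setIdx (v r : ℕ) : (σ.setIdx d v).idx r = if r = d then v else σ.idx r :=
  Function.update_apply ..
theorem num_setIdx (v : ℕ) : (σ.setIdx d v).num = σ.num := rfl
theorem idxArr_setIdx (v : ℕ) : (σ.setIdx d v).idxArr = σ.idxArr := rfl
theorem numArr_setIdx (v : ℕ) : (σ.setIdx d v).numArr = σ.numArr := rfl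
theorem idx_setNum (v : ℝ) : (σ.setNum d v).idx = σ.idx := rfl
theorem num_setNum (v : ℝ) (r : ℕ) : (σ.setNum d v).num r = if r = d then v else σ.num r :=
  Function.update_apply ..
theorem idxArr_setNum (v : ℝ) : (σ.setNum d v).idxArr = σ.idxArr := rfl
theorem numArr_setNum (v : ℝ) : (σ.setNum d v).numArr = σ.numArr := rfl
theorem idx_setIdxArr (v : ℕ) : (σ.setIdxArr d i v).idx = σ.idx := rfl
theorem num_setIdxArr (v : ℕ) : (σ.setIdxArr d i v).num = σ.num := rfl
theorem numArr_setIdxArr (v : ℕ) : (σ.setIdxArr d i v).numArr = σ.numArr := rfl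
theorem idxArr_setIdxArr (v a : ℕ) : (σ.setIdxArr d i v).idxArr a =
    if a = d then Function.update (σ.idxArr d) i v else σ.idxArr a :=
  Function.update_apply ..
theorem idx_setNumArr (v : ℝ) : (σ.setNumArr d i v).idx = σ.idx := rfl
theorem num_setNumArr (v : ℝ) : (σ.setNumArr d i v).num = σ.num := rfl
theorem idxArr_setNumArr (v : ℝ) : (σ.setNumArr d i v).idxArr = σ.idxArr := rfl
theorem numArr_setNumArr (v : ℝ) (a : ℕ) : (σ.setNumArr d i v).numArr a =
    if a = d then Function.update (σ.numArr d) i v else σ.numArr a :=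
  Function.update_apply ..

end fields

attribute [local simp] runBlock_nil runBlock_cons Instr.apply idx_setIdx num_setIdx idxArr_setIdx
  numArr_setIdx idx_setNum num_setNum idxArr_setNum numArr_setNum idx_setIdxArr num_setIdxArr
  numArr_setIdxArr idxArr_setIdxArr idx_setNumArr num_setNumArr idxArr_setNumArr numArr_setNumArr

/-! ### Writing the truss incidence matrix -/

/-- The output cells hold the list `l` of matrix entries. -/
def Tape (σ : Store) (l : List (ℕ × ℕ × ℝ)) : Prop :=
  σ.idx 9 = l.length ∧ ∀ (k : ℕ) (hk : k < l.length),
    σ.idxArr 2 k = l[k].1 ∧ σ.idxArr 3 k = l[k].2.1 ∧ σ.numArr 1 k = l[k].2.2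

/-- The parts of the memory that writing a bar leaves alone. -/
structure Frame (σ τ : Store) : Prop where
  idx : ∀ r, r ≠ 8 → r ≠ 9 → r ≠ 10 → r ≠ 11 → r ≠ 16 → τ.idx r = σ.idx r
  num : ∀ r, r ≠ 3 → r ≠ 4 → r ≠ 6 → τ.num r = σ.num r
  idxArr : ∀ a, a ≠ 2 → a ≠ 3 → τ.idxArr a = σ.idxArr a
  numArr : ∀ a, a ≠ 1 → a ≠ 3 → τ.numArr a = σ.numArr a

/-- Write the entry with the value in number register `v` and the column in index register `16`,
unless the value is zero. -/
def emitEntry (v : ℕ) : Prog :=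
  .cond (.numEq v 2) .skip
    (block [.idxStore 2 9 8, .idxStore 3 9 16, .numStore 1 9 v, .idxAdd 9 9 6])

/-- The parts of the memory that writing an entry leaves alone. -/
structure EntryFrame (σ τ : Store) : Prop where
  idx : ∀ r, r ≠ 9 → τ.idx r = σ.idx r
  num : τ.num = σ.num
  idxArr : ∀ a, a ≠ 2 → a ≠ 3 → τ.idxArr a = σ.idxArr a
  numArr : ∀ a, a ≠ 1 → τ.numArr a = σ.numArr a

open Classical in
theorem runs_emitEntry {σ : Store} {l : List (ℕ × ℕ × ℝ)} (v : ℕ) (h : Tape σ l)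
    (h6 : σ.idx 6 = 1) (h2 : σ.num 2 = 0) :
    Runs (emitEntry v) σ 5 fun τ =>
      Tape τ (l ++ [(σ.idx 8, σ.idx 16, σ.num v)].filter fun p => decide (p.2.2 ≠ 0)) ∧
        EntryFrame σ τ := by
  refine Runs.cond (T := 4) (fun hb => Runs.skip ?_) fun hb => Runs.block ?_
  · have hv : σ.num v = 0 := by rw [← h2]; exact hb
    simp only [hv, ne_eq, not_true_eq_false, decide_false, List.filter_cons, List.filter_nil,
      Bool.false_eq_true, if_false, List.append_nil]
    exact ⟨h, fun _ _ => rfl, rfl, fun _ _ _ => rfl, fun _ _ => rfl⟩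
  · have hv : σ.num v ≠ 0 := by rw [← h2]; exact hb
    obtain ⟨h9, hl⟩ := h
    refine ⟨⟨?_, ?_⟩, ⟨?_, ?_, ?_, ?_⟩⟩
    · simp [hv, h9, h6]
    · intro k hk
      simp only [ne_eq, hv, not_false_eq_true, decide_true, List.filter_cons_of_pos,
        List.filter_nil] at hk ⊢
      rw [List.length_append, List.length_singleton] at hk
      simp only [runBlock_cons, runBlock_nil, Instr.apply, idx_setIdxArr, idx_setNumArr,
        idxArr_setIdx, idxArr_setNumArr, idxArr_setIdxArr, numArr_setIdx, numArr_setNumArr,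
        num_setIdxArr, numArr_setIdxArr]
      simp only [Nat.reduceEqDiff, if_true, if_false, h9]
      by_cases hkl : k < l.length
      · have hne : k ≠ l.length := hkl.ne
        simp only [Function.update_of_ne hne, List.getElem_append_left hkl]
        exact hl k hkl
      · obtain rfl : k = l.length := by omega
        simp
    · intro r hr
      simp [hr]
    · simp
    · intro a ha ha'
      simp [ha, ha']
    · intro a ha
      simp [ha]

/-- Write an entry after some preparation. -/
def emitAfter (b : List Instr) (v : ℕ) : Prog := .seq (block b) (emitEntry v)

/-- Write the bar with end points in index registers `10`, `11` and coefficients in number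
registers `3`, `4`, and its right-hand side in number register `5`. -/
def emitBar : Prog :=
  .seq (emitAfter [.idxAdd 16 10 10] 3) <| .seq (emitAfter [.idxAdd 16 16 6] 4) <|
  .seq (emitAfter [.idxAdd 16 11 11, .numSub 6 2 3] 6) <|
  .seq (emitAfter [.idxAdd 16 16 6, .numSub 6 2 4] 6) <|
  block [.numStore 3 8 5, .idxAdd 8 8 6]

/-- The first `N` rows of the truss incidence matrix and of the right-hand side `r` are written. -/
structure Emitted (D : SparseSystem) (r : ℕ → ℝ) (N : ℕ) (σ : Store) : Prop where
  count : σ.idx 8 = N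
  tape : Tape σ (D.output N)
  rhs : ∀ l < N, σ.numArr 3 l = r l

theorem Tape.congr {σ τ : Store} {l : List (ℕ × ℕ × ℝ)} (h : Tape σ l) (h9 : τ.idx 9 = σ.idx 9)
    (h2 : τ.idxArr 2 = σ.idxArr 2) (h3 : τ.idxArr 3 = σ.idxArr 3) (h1 : τ.numArr 1 = σ.numArr 1) :
    Tape τ l := by
  simpa only [Tape, h9, h2, h3, h1] using h

open Classical in
theorem Bar.output_eq (b : Bar) (e : ℕ) : b.output e =
    [(e, 2 * b.src, b.fx)].filter (fun p : ℕ × ℕ × ℝ => decide (p.2.2 ≠ 0)) ++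
    [(e, 2 * b.src + 1, b.fy)].filter (fun p : ℕ × ℕ × ℝ => decide (p.2.2 ≠ 0)) ++
    [(e, 2 * b.tgt, -b.fx)].filter (fun p : ℕ × ℕ × ℝ => decide (p.2.2 ≠ 0)) ++
    [(e, 2 * b.tgt + 1, -b.fy)].filter (fun p : ℕ × ℕ × ℝ => decide (p.2.2 ≠ 0)) := by
  rw [← List.filter_append, ← List.filter_append, ← List.filter_append]
  rfl

/-- The state while the entries of a bar are written: `l` is written, the last column is `c`, and
nothing but the output cells and two auxiliary registers differs from `σ`. -/
structure Emitting (σ : Store) (l : List (ℕ × ℕ × ℝ)) (c : ℕ) (τ : Store) : Prop where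
  tape : Tape τ l
  col : τ.idx 16 = c
  idx : ∀ r, r ≠ 9 → r ≠ 16 → τ.idx r = σ.idx r
  num : ∀ r, r ≠ 6 → τ.num r = σ.num r
  idxArr : ∀ a, a ≠ 2 → a ≠ 3 → τ.idxArr a = σ.idxArr a
  numArr : ∀ a, a ≠ 1 → τ.numArr a = σ.numArr a

-- The preparation may change only the column register and number register `6`, which holds negated
-- coefficients; `Emitting` records this relative to the state `σ` at the start of the bar.
open Classical in
theorem Emitting.runs_emitAfter {σ τ : Store} {l : List (ℕ × ℕ × ℝ)} {c : ℕ} {b : List Instr}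
    {v : ℕ} {x : ℝ} (h : Emitting σ l c (runBlock b τ)) (h6 : σ.idx 6 = 1) (h2 : σ.num 2 = 0)
    (hx : (runBlock b τ).num v = x) :
    Runs (emitAfter b v) τ (b.length + 5)
      (Emitting σ (l ++ [(σ.idx 8, c, x)].filter fun p => decide (p.2.2 ≠ 0)) c) := by
  refine Runs.seq (Q := fun υ => υ = runBlock b τ) (Runs.block rfl) ?_
  rintro _ rfl
  have h6' : (runBlock b τ).idx 6 = 1 := by rw [h.idx 6 (by norm_num) (by norm_num), h6]
  have h2' : (runBlock b τ).num 2 = 0 := by rw [h.num 2 (by norm_num), h2]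
  have h8' : (runBlock b τ).idx 8 = σ.idx 8 := h.idx 8 (by norm_num) (by norm_num)
  refine (runs_emitEntry v h.tape h6' h2').mono le_rfl fun υ hυ => ?_
  obtain ⟨ht, a1, a2, a3, a4⟩ := hυ
  rw [h8', h.col, hx] at ht
  exact ⟨ht, by rw [a1 16 (by norm_num), h.col], fun r h9 h16 => by rw [a1 r h9, h.idx r h9 h16],
    fun r h6 => by rw [a2, h.num r h6], fun a h2 h3 => by rw [a3 a h2 h3, h.idxArr a h2 h3],
    fun a h1 => by rw [a4 a h1, h.numArr a h1]⟩

theorem Emitting.next {σ τ υ : Store} {l : List (ℕ × ℕ × ℝ)} {c c' : ℕ} (h : Emitting σ l c τ)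
    (hc : υ.idx 16 = c') (hidx : ∀ r, r ≠ 16 → υ.idx r = τ.idx r)
    (hnum : ∀ r, r ≠ 6 → υ.num r = τ.num r) (hidxArr : υ.idxArr = τ.idxArr)
    (hnumArr : υ.numArr = τ.numArr) : Emitting σ l c' υ :=
  ⟨h.tape.congr (hidx 9 (by norm_num)) (by rw [hidxArr]) (by rw [hidxArr]) (by rw [hnumArr]), hc,
    fun r h9 h16 => by rw [hidx r h16, h.idx r h9 h16], fun r h6 => by rw [hnum r h6, h.num r h6],
    fun a h2 h3 => by rw [hidxArr, h.idxArr a h2 h3], fun a h1 => by rw [hnumArr, h.numArr a h1]⟩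

theorem runs_emitBar {D : SparseSystem} {r : ℕ → ℝ} {N : ℕ} {σ : Store} (h : Emitted D r N σ)
    (h6 : σ.idx 6 = 1) (h2 : σ.num 2 = 0) (hsrc : σ.idx 10 = (D.bar N).src)
    (htgt : σ.idx 11 = (D.bar N).tgt) (hfx : σ.num 3 = (D.bar N).fx)
    (hfy : σ.num 4 = (D.bar N).fy) (hr : σ.num 5 = r N) :
    Runs emitBar σ 28 fun τ => Emitted D r (N + 1) τ ∧ Frame σ τ := by
  classical
  obtain ⟨hc, ht, hrhs⟩ := h
  have h0 : Emitting σ (D.output N) (σ.idx 16) σ :=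
    ⟨ht, rfl, fun _ _ _ => rfl, fun _ _ => rfl, fun _ _ _ => rfl, fun _ _ => rfl⟩
  have e6 : ∀ {l c τ}, Emitting σ l c τ → τ.idx 6 = 1 := fun h => by
    rw [h.idx 6 (by norm_num) (by norm_num), h6]
  have e2 : ∀ {l c τ}, Emitting σ l c τ → τ.num 2 = 0 := fun h => by
    rw [h.num 2 (by norm_num), h2]
  -- Each entry costs five steps after one or two steps of preparation; storing the right-hand side
  -- and counting the bar cost two.
  refine Runs.mono (T := 6 + (6 + (7 + (7 + 2)))) ?_ (by norm_num) fun τ hτ => hτ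
  refine Runs.seq (Emitting.runs_emitAfter (h0.next (c' := 2 * (D.bar N).src) ?_ ?_ ?_ ?_ ?_)
    h6 h2 (x := (D.bar N).fx) ?_) fun σ₁ h₁ => ?_
  · simp [hsrc, two_mul]
  · intro r hr; simp [hr]
  · intro r hr; simp
  · simp
  · simp
  · simp [hfx]
  refine Runs.seq (Emitting.runs_emitAfter (h₁.next (c' := 2 * (D.bar N).src + 1) ?_ ?_ ?_ ?_ ?_)
    h6 h2 (x := (D.bar N).fy) ?_) fun σ₂ h₂ => ?_
  · simp [h₁.col, e6 h₁]
  · intro r hr; simp [hr]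
  · intro r hr; simp
  · simp
  · simp
  · simp [h₁.num, hfy]
  refine Runs.seq (Emitting.runs_emitAfter (h₂.next (c' := 2 * (D.bar N).tgt) ?_ ?_ ?_ ?_ ?_)
    h6 h2 (x := -(D.bar N).fx) ?_) fun σ₃ h₃ => ?_
  · simp [h₂.idx, htgt, two_mul]
  · intro r hr; simp [hr]
  · intro r hr; simp [hr]
  · simp
  · simp
  · simp [h₂.num, hfx, h2]
  refine Runs.seq (Emitting.runs_emitAfter (h₃.next (c' := 2 * (D.bar N).tgt + 1) ?_ ?_ ?_ ?_ ?_)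
    h6 h2 (x := -(D.bar N).fy) ?_) fun σ₄ h₄ => ?_
  · simp [h₃.col, e6 h₃]
  · intro r hr; simp [hr]
  · intro r hr; simp [hr]
  · simp
  · simp
  · simp [h₃.num, hfy, h2]
  have hN : σ₄.idx 8 = N := by rw [h₄.idx 8 (by norm_num) (by norm_num), hc]
  have h5 : σ₄.num 5 = r N := by rw [h₄.num 5 (by norm_num), hr]
  refine Runs.block ⟨⟨?_, ?_, ?_⟩, ⟨?_, ?_, ?_, ?_⟩⟩
  · simp [hN, e6 h₄]
  · rw [SparseSystem.output_succ, Bar.output_eq, ← List.append_assoc, ← List.append_assoc,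
      ← List.append_assoc]
    have ht₄ := h₄.tape
    rw [hc] at ht₄
    refine ht₄.congr ?_ ?_ ?_ ?_ <;> simp
  · intro l hl
    simp only [runBlock_cons, runBlock_nil, Instr.apply, numArr_setIdx, numArr_setNumArr, if_true,
      hN, h5]
    by_cases hlN : l = N
    · rw [hlN, Function.update_self]
    · rw [Function.update_of_ne hlN, h₄.numArr 3 (by norm_num)]
      exact hrhs l (by omega)
  · intro r h8 h9 h10 h11 h16
    simp [h8, h₄.idx r h9 h16]
  · intro r h3 h4 h6
    simp [h₄.num r h6]
  · intro a ha ha'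
    simp [h₄.idxArr a ha ha']
  · intro a ha ha'
    simp [ha', h₄.numArr a ha]

/-! ### The program that builds the truss -/

/-- The input and the constants are in place. -/
structure Ready (D : SparseSystem) (c : ℕ → ℝ) (ε : ℝ) (σ : Store) : Prop where
  rows : σ.idx 0 = D.m
  cols : σ.idx 1 = D.n
  size : σ.idx 2 = D.s
  one : σ.idx 6 = 1
  zero : σ.idx 17 = 0
  eps : σ.num 0 = ε
  numZero : σ.num 2 = 0
  numOne : σ.num 8 = 1
  numFour : σ.num 9 = 4
  row : ∀ k < D.s, σ.idxArr 0 k = D.row k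
  col : ∀ k < D.s, σ.idxArr 1 k = D.col k
  val : ∀ k < D.s, σ.numArr 0 k = D.val k
  rhs : ∀ i < D.m, σ.numArr 2 i = c i

theorem Ready.congr {D : SparseSystem} {c : ℕ → ℝ} {ε : ℝ} {σ τ : Store} (h : Ready D c ε σ)
    (hi : ∀ r ∈ [0, 1, 2, 6, 17], τ.idx r = σ.idx r) (hn : ∀ r ∈ [0, 2, 8, 9], τ.num r = σ.num r)
    (hia : ∀ a ∈ [0, 1], τ.idxArr a = σ.idxArr a) (hna : ∀ a ∈ [0, 2], τ.numArr a = σ.numArr a) :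
    Ready D c ε τ := by
  simp only [List.mem_cons, List.not_mem_nil, or_false, forall_eq_or_imp, forall_eq] at hi hn hia hna
  obtain ⟨i0, i1, i2, i6, i17⟩ := hi
  obtain ⟨n0, n2, n8, n9⟩ := hn
  constructor <;> simp only [i0, i1, i2, i6, i17, n0, n2, n8, n9, hia.1, hia.2, hna.1, hna.2]
  exacts [h.rows, h.cols, h.size, h.one, h.zero, h.eps, h.numZero, h.numOne, h.numFour, h.row,
    h.col, h.val, h.rhs]

theorem Ready.frame {D : SparseSystem} {c : ℕ → ℝ} {ε : ℝ} {σ τ : Store} (h : Ready D c ε σ)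
    (hf : Frame σ τ) : Ready D c ε τ := by
  refine h.congr (fun r hr => hf.idx r ?_ ?_ ?_ ?_ ?_) (fun r hr => hf.num r ?_ ?_ ?_)
    (fun a ha => hf.idxArr a ?_ ?_) (fun a ha => hf.numArr a ?_ ?_) <;>
  · rintro rfl
    revert ‹_ ∈ _›
    decide

/-- Set the constants and counters. -/
def initBlock : List Instr :=
  [.idxConst 6 1, .idxConst 17 0, .numConst 2 0, .numConst 8 1, .numConst 9 4, .idxConst 7 0,
    .idxConst 8 0, .idxConst 9 0]

/-- Initialize the data of a row. -/
def rowInitBlock : List Instr :=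
  [.numStore 4 7 8, .numStore 5 7 2, .idxAdd 12 1 7, .idxStore 4 7 12, .idxAdd 7 7 6]

/-- Add the contribution of an entry to the number of bars and the mass of its row. -/
def sumBlock : List Instr :=
  [.idxLoad 12 0 7, .numLoad 7 0 7, .numMul 7 7 7, .numSqrt 7 7, .numLoad 10 5 12, .numAdd 10 10 7,
    .numStore 5 12 10, .numLoad 10 4 12, .numAdd 10 10 9, .numStore 4 12 10, .idxAdd 7 7 6]

/-- Compute scale, initial load and scaled right-hand side of a row. -/
def scaleBlock : List Instr :=
  [.numLoad 10 4 7, .numSqrt 10 10, .numStore 4 7 10, .numLoad 11 5 7, .numStore 6 7 11,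
    .numLoad 12 2 7, .numDiv 12 12 10, .numStore 7 7 12, .idxAdd 7 7 6]

/-- Load and update the data needed for an entry. -/
def entryBlock : List Instr :=
  [.idxLoad 12 0 7, .idxLoad 18 1 7, .idxAdd 14 13 6, .idxLoad 15 4 12, .idxStore 4 12 14,
    .numLoad 7 0 7, .numLoad 10 4 12, .numLoad 11 5 12, .numLoad 12 6 12, .numLoad 5 7 12,
    .numAdd 13 12 7, .numStore 6 12 13, .numMul 7 10 7, .numDiv 13 11 13, .numMul 13 7 13,
    .numMul 12 10 12]

/-- The state before any row of the truss has been written. -/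
structure Before (D : SparseSystem) (c : ℕ → ℝ) (ε : ℝ) (k : ℕ) (σ : Store) : Prop where
  ready : Ready D c ε σ
  counter : σ.idx 7 = k
  count : σ.idx 8 = 0
  pos : σ.idx 9 = 0

/-- The state after `k` rows have been initialized. -/
structure RowInit (D : SparseSystem) (c : ℕ → ℝ) (ε : ℝ) (k : ℕ) (σ : Store) : Prop
    extends Before D c ε k σ where
  num_bars : ∀ i < k, σ.numArr 4 i = 1
  mass : ∀ i < k, σ.numArr 5 i = 0
  last : ∀ i < k, σ.idxArr 4 i = D.anchor i

/-- The state after the first `k` entries have been counted. -/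
structure Summed (D : SparseSystem) (c : ℕ → ℝ) (ε : ℝ) (k : ℕ) (σ : Store) : Prop
    extends Before D c ε k σ where
  num_bars : ∀ i < D.m, σ.numArr 4 i = 1 + 4 * D.rowSum (fun _ => 1) k i
  mass : ∀ i < D.m, σ.numArr 5 i = D.rowSum (fun l => |D.val l|) k i
  last : ∀ i < D.m, σ.idxArr 4 i = D.anchor i

/-- The state after the first `k` rows have been scaled. -/
structure Scaled (D : SparseSystem) (c : ℕ → ℝ) (ε : ℝ) (k : ℕ) (σ : Store) : Prop
    extends Before D c ε k σ where
  num_bars : ∀ i < D.m, k ≤ i → σ.numArr 4 i = 1 + 4 * D.rowSum (fun _ => 1) D.s i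
  scale : ∀ i < k, σ.numArr 4 i = D.scale i
  mass : ∀ i < D.m, σ.numArr 5 i = D.mass i
  load : ∀ i < k, σ.numArr 6 i = D.mass i
  rhs : ∀ i < k, σ.numArr 7 i = c i / D.scale i
  last : ∀ i < D.m, σ.idxArr 4 i = D.anchor i

/-- The row data before entry `k` is processed. -/
structure RowData (D : SparseSystem) (c : ℕ → ℝ) (k : ℕ) (σ : Store) : Prop where
  scale : ∀ i < D.m, σ.numArr 4 i = D.scale i
  mass : ∀ i < D.m, σ.numArr 5 i = D.mass i
  load : ∀ i < D.m, σ.numArr 6 i = D.load k i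
  rhs : ∀ i < D.m, σ.numArr 7 i = c i / D.scale i
  last : ∀ i < D.m, σ.idxArr 4 i = D.last k i

theorem runs_rowInit {D : SparseSystem} {c : ℕ → ℝ} {ε : ℝ} {k : ℕ} {σ : Store}
    (h : RowInit D c ε k σ) : Runs (block rowInitBlock) σ 5 (RowInit D c ε (k + 1)) := by
  have h7 := h.counter
  refine Runs.block ⟨⟨h.ready.congr ?_ ?_ ?_ ?_, ?_, ?_, ?_⟩, ?_, ?_, ?_⟩
  · simp [rowInitBlock]
  · simp [rowInitBlock]
  · simp [rowInitBlock]
  · simp [rowInitBlock]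
  · simp [rowInitBlock, h7, h.ready.one]
  · simp [rowInitBlock, h.count]
  · simp [rowInitBlock, h.pos]
  · intro i hi
    by_cases hik : i = k
    · simp [rowInitBlock, h7, hik, h.ready.numOne]
    · simp [rowInitBlock, h7, hik, h.num_bars i (by omega)]
  · intro i hi
    by_cases hik : i = k
    · simp [rowInitBlock, h7, hik, h.ready.numZero]
    · simp [rowInitBlock, h7, hik, h.mass i (by omega)]
  · intro i hi
    by_cases hik : i = k
    · simp [rowInitBlock, h7, hik, h.ready.cols, SparseSystem.anchor]
    · simp [rowInitBlock, h7, hik, h.last i (by omega)]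

theorem runs_sum {D : SparseSystem} {c : ℕ → ℝ} {ε : ℝ} {k : ℕ} {σ : Store} (hk : k < D.s)
    (h : Summed D c ε k σ) :
    Runs (block sumBlock) σ 11 (Summed D c ε (k + 1)) := by
  have h7 := h.counter
  have hr := h.ready.row k hk
  have hv := h.ready.val k hk
  refine Runs.block ⟨⟨h.ready.congr ?_ ?_ ?_ ?_, ?_, ?_, ?_⟩, ?_, ?_, ?_⟩
  · simp [sumBlock]
  · simp [sumBlock]
  · simp [sumBlock]
  · simp [sumBlock]
  · simp [sumBlock, h7, h.ready.one]
  · simp [sumBlock, h.count]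
  · simp [sumBlock, h.pos]
  · intro i hi
    by_cases hik : i = D.row k
    · subst hik
      rw [SparseSystem.rowSum_succ_self]
      simp [sumBlock, h7, hr, h.num_bars _ hi, h.ready.numFour]
      ring
    · rw [SparseSystem.rowSum_succ_of_ne _ _ (Ne.symm hik)]
      simp [sumBlock, h7, hr, hik, h.num_bars _ hi]
  · intro i hi
    by_cases hik : i = D.row k
    · subst hik
      rw [SparseSystem.rowSum_succ_self]
      -- The machine computes absolute values as square roots of squares.
      simp [sumBlock, h7, hr, hv, h.mass _ hi, Real.sqrt_mul_self_eq_abs]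
    · rw [SparseSystem.rowSum_succ_of_ne _ _ (Ne.symm hik)]
      simp [sumBlock, h7, hr, hik, h.mass _ hi]
  · intro i hi
    simp [sumBlock, h.last i hi]

theorem runs_scale {D : SparseSystem} {c : ℕ → ℝ} {ε : ℝ} {k : ℕ} {σ : Store} (hk : k < D.m)
    (h : Scaled D c ε k σ) : Runs (block scaleBlock) σ 9 (Scaled D c ε (k + 1)) := by
  have h7 := h.counter
  have hb := h.num_bars k hk le_rfl
  refine Runs.block ⟨⟨h.ready.congr ?_ ?_ ?_ ?_, ?_, ?_, ?_⟩, ?_, ?_, ?_, ?_, ?_, ?_⟩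
  · simp [scaleBlock]
  · simp [scaleBlock]
  · simp [scaleBlock]
  · simp [scaleBlock]
  · simp [scaleBlock, h7, h.ready.one]
  · simp [scaleBlock, h.count]
  · simp [scaleBlock, h.pos]
  · intro i hi hki
    have hik : i ≠ k := by omega
    simp [scaleBlock, h7, hik, h.num_bars i hi (by omega)]
  · intro i hi
    by_cases hik : i = k
    · simp [scaleBlock, h7, hik, hb, SparseSystem.scale]
    · simp [scaleBlock, h7, hik, h.scale i (by omega)]
  · intro i hi
    simp [scaleBlock, h.mass i hi]
  · intro i hi
    by_cases hik : i = k
    · simp [scaleBlock, h7, hik, h.mass k hk]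
    · simp [scaleBlock, h7, hik, h.load i (by omega)]
  · intro i hi
    by_cases hik : i = k
    · simp [scaleBlock, h7, hik, hb, h.ready.rhs k hk, SparseSystem.scale]
    · simp [scaleBlock, h7, hik, h.rhs i (by omega)]
  · intro i hi
    simp [scaleBlock, h.last i hi]

/-- The state between the bars of entry `k`. -/
structure EntryState (D : SparseSystem) (c : ℕ → ℝ) (ε : ℝ) (k : ℕ) (σ : Store) : Prop where
  ready : Ready D c ε σ
  data : RowData D c (k + 1) σ
  counter : σ.idx 7 = k
  foot : σ.idx 13 = D.foot k
  head : σ.idx 14 = D.head k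
  last : σ.idx 15 = D.last k (D.row k)
  col : σ.idx 18 = D.col k
  coeffA : σ.num 7 = D.scale (D.row k) * D.val k
  coeffB : σ.num 13 = D.scale (D.row k) * D.val k * D.height k
  coeffL : σ.num 12 = D.scale (D.row k) * D.load k (D.row k)
  rhs : σ.num 5 = c (D.row k) / D.scale (D.row k)

theorem RowData.congr {D : SparseSystem} {c : ℕ → ℝ} {k : ℕ} {σ τ : Store} (h : RowData D c k σ)
    (h4 : τ.numArr 4 = σ.numArr 4) (h5 : τ.numArr 5 = σ.numArr 5) (h6 : τ.numArr 6 = σ.numArr 6)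
    (h7 : τ.numArr 7 = σ.numArr 7) (hl : τ.idxArr 4 = σ.idxArr 4) : RowData D c k τ := by
  constructor
  · rw [h4]; exact h.scale
  · rw [h5]; exact h.mass
  · rw [h6]; exact h.load
  · rw [h7]; exact h.rhs
  · rw [hl]; exact h.last

theorem RowData.frame {D : SparseSystem} {c : ℕ → ℝ} {k : ℕ} {σ τ : Store} (h : RowData D c k σ)
    (hf : Frame σ τ) : RowData D c k τ :=
  h.congr (hf.numArr 4 (by norm_num) (by norm_num)) (hf.numArr 5 (by norm_num) (by norm_num))
    (hf.numArr 6 (by norm_num) (by norm_num)) (hf.numArr 7 (by norm_num) (by norm_num))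
    (hf.idxArr 4 (by norm_num) (by norm_num))

theorem EntryState.frame {D : SparseSystem} {c : ℕ → ℝ} {ε : ℝ} {k : ℕ} {σ τ : Store}
    (h : EntryState D c ε k σ) (hf : Frame σ τ) : EntryState D c ε k τ := by
  obtain ⟨h1, h2, h3, h4, h5, h6, h7, h8, h9, h10, h11⟩ := h
  refine ⟨h1.frame hf, h2.frame hf, ?_, ?_, ?_, ?_, ?_, ?_, ?_, ?_, ?_⟩
  · rwa [hf.idx] <;> norm_num
  · rwa [hf.idx] <;> norm_num
  · rwa [hf.idx] <;> norm_num
  · rwa [hf.idx] <;> norm_num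
  · rwa [hf.idx] <;> norm_num
  · rwa [hf.num] <;> norm_num
  · rwa [hf.num] <;> norm_num
  · rwa [hf.num] <;> norm_num
  · rwa [hf.num] <;> norm_num

/-- The row data are advanced to `k + 1` before the bars are written. The old end of the chain and
the old scaled load survive in registers, and the head is known in advance as the foot plus one. -/
theorem runs_entryBlock {D : SparseSystem} {c : ℕ → ℝ} {ε : ℝ} {k : ℕ} {σ : Store} {r : ℕ → ℝ}
    {N : ℕ} (hk : k < D.s) (hrow : D.row k < D.m) (h : Ready D c ε σ) (hd : RowData D c k σ)
    (h7 : σ.idx 7 = k) (h13 : σ.idx 13 = D.foot k) (he : Emitted D r N σ) :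
    Runs (block entryBlock) σ 16 fun τ => EntryState D c ε k τ ∧ Emitted D r N τ := by
  have hr := h.row k hk
  have hv := h.val k hk
  have hc := h.col k hk
  have hh : D.head k = D.foot k + 1 := rfl
  refine Runs.block ⟨⟨h.congr ?_ ?_ ?_ ?_, ⟨?_, ?_, ?_, ?_, ?_⟩, ?_, ?_, ?_, ?_, ?_, ?_, ?_, ?_, ?_⟩,
    ⟨?_, he.tape.congr ?_ ?_ ?_ ?_, ?_⟩⟩
  · simp [entryBlock]
  · simp [entryBlock]
  · simp [entryBlock]
  · simp [entryBlock]
  · intro i hi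
    simp [entryBlock, hd.scale i hi]
  · intro i hi
    simp [entryBlock, hd.mass i hi]
  · intro i hi
    by_cases hik : i = D.row k
    · subst hik
      rw [SparseSystem.load_succ_self]
      simp [entryBlock, h7, hr, hv, hd.load _ hi]
    · rw [SparseSystem.load_succ_of_ne _ (Ne.symm hik)]
      simp [entryBlock, h7, hr, hik, hd.load _ hi]
  · intro i hi
    simp [entryBlock, hd.rhs i hi]
  · intro i hi
    rw [SparseSystem.last_succ]
    by_cases hik : i = D.row k
    · simp [entryBlock, h7, hr, hik, h13, h.one, hh]
    · simp [entryBlock, h7, hr, hik, hd.last i hi, Ne.symm hik]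
  · simp [entryBlock, h7]
  · simp [entryBlock, h13]
  · simp [entryBlock, h13, hh, h.one]
  · simp [entryBlock, h7, hr, hd.last _ hrow]
  · simp [entryBlock, h7, hc]
  · simp [entryBlock, h7, hr, hv, hd.scale _ hrow]
  · simp [entryBlock, h7, hr, hv, hd.scale _ hrow, hd.mass _ hrow, hd.load _ hrow,
      SparseSystem.height, SparseSystem.load_succ_self]
  · simp [entryBlock, h7, hr, hd.scale _ hrow, hd.load _ hrow]
  · simp [entryBlock, h7, hr, hd.rhs _ hrow]
  · simp [entryBlock, he.count]
  · simp [entryBlock]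
  · simp [entryBlock]
  · simp [entryBlock]
  · simp [entryBlock]
  · intro l hl
    simp [entryBlock, he.rhs l hl]

/-- Load the data of a bar into the registers and write it. -/
def emitWith (b : List Instr) : Prog := .seq (block b) emitBar

theorem runs_emitWith {D : SparseSystem} {r : ℕ → ℝ} {N : ℕ} {σ : Store} {b : List Instr}
    (h : Emitted D r N σ) (h6 : σ.idx 6 = 1) (h2 : σ.num 2 = 0) (hr : σ.num 5 = r N)
    (hidx : ∀ r, r ≠ 10 → r ≠ 11 → (runBlock b σ).idx r = σ.idx r)
    (hnum : ∀ r, r ≠ 3 → r ≠ 4 → (runBlock b σ).num r = σ.num r)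
    (hidxArr : (runBlock b σ).idxArr = σ.idxArr) (hnumArr : (runBlock b σ).numArr = σ.numArr)
    (hsrc : (runBlock b σ).idx 10 = (D.bar N).src) (htgt : (runBlock b σ).idx 11 = (D.bar N).tgt)
    (hfx : (runBlock b σ).num 3 = (D.bar N).fx) (hfy : (runBlock b σ).num 4 = (D.bar N).fy) :
    Runs (emitWith b) σ (b.length + 28) fun τ => Emitted D r (N + 1) τ ∧ Frame σ τ := by
  refine Runs.seq (Q := fun τ => τ = runBlock b σ) (Runs.block rfl) ?_
  rintro _ rfl
  refine (runs_emitBar (r := r) ⟨?_, h.tape.congr ?_ ?_ ?_ ?_, ?_⟩ ?_ ?_ hsrc htgt hfx hfy ?_).mono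
    le_rfl ?_
  · rw [hidx 8 (by norm_num) (by norm_num), h.count]
  · rw [hidx 9 (by norm_num) (by norm_num)]
  · rw [hidxArr]
  · rw [hidxArr]
  · rw [hnumArr]
  · rw [hnumArr]; exact h.rhs
  · rw [hidx 6 (by norm_num) (by norm_num), h6]
  · rw [hnum 2 (by norm_num) (by norm_num), h2]
  · rw [hnum 5 (by norm_num) (by norm_num), hr]
  · rintro τ ⟨h1, h2, h3, h4, h5⟩
    exact ⟨h1, fun r a8 a9 a10 a11 a16 => by rw [h2 r a8 a9 a10 a11 a16, hidx r a10 a11],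
      fun r a3 a4 a6 => by rw [h3 r a3 a4 a6, hnum r a3 a4],
      fun a b2 b3 => by rw [h4 a b2 b3, hidxArr], fun a b1 b3 => by rw [h5 a b1 b3, hnumArr]⟩

/-- Process an entry. -/
def entryBody : Prog :=
  .seq (block entryBlock) <|
  -- Registers are copied by adding zero, which is kept in index register `17` and number register
  -- `2`.
  .seq (emitWith [.idxAdd 10 18 17, .idxAdd 11 13 17, .numAdd 3 7 2, .numAdd 4 2 2]) <|
  .seq (emitWith [.idxAdd 10 15 17, .idxAdd 11 13 17, .numAdd 3 2 2, .numAdd 4 13 2]) <|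
  .seq (emitWith [.idxAdd 10 13 17, .idxAdd 11 14 17, .numAdd 3 7 2, .numAdd 4 13 2]) <|
  .seq (emitWith [.idxAdd 10 15 17, .idxAdd 11 14 17, .numAdd 3 12 2, .numSub 4 2 13]) <|
  block [.idxAdd 13 14 6, .idxAdd 7 7 6]

/-- The right-hand side of the truss system. -/
def SparseSystem.trussRhs (D : SparseSystem) (c : ℕ → ℝ) (e : ℕ) : ℝ :=
  c (D.bar e).owner / D.scale (D.bar e).owner

/-- The state after the bars of the first `k` entries have been written. -/
structure EntriesDone (D : SparseSystem) (c : ℕ → ℝ) (ε : ℝ) (k : ℕ) (σ : Store) : Prop where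
  ready : Ready D c ε σ
  data : RowData D c k σ
  counter : σ.idx 7 = k
  foot : σ.idx 13 = D.foot k
  emitted : Emitted D (D.trussRhs c) (4 * k) σ

theorem runs_entryBody {D : SparseSystem} {c : ℕ → ℝ} {ε : ℝ} {k : ℕ} {σ : Store} (hk : k < D.s)
    (hrow : D.row k < D.m) (h : EntriesDone D c ε k σ) :
    Runs entryBody σ 146 (EntriesDone D c ε (k + 1)) := by
  have hb0 : D.bar (4 * k) = D.entryBar k 0 := D.bar_entry hk (show 0 < 4 by norm_num)
  have hb1 : D.bar (4 * k + 1) = D.entryBar k 1 := D.bar_entry hk (by norm_num)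
  have hb2 : D.bar (4 * k + 1 + 1) = D.entryBar k 2 := D.bar_entry hk (by norm_num)
  have hb3 : D.bar (4 * k + 1 + 1 + 1) = D.entryBar k 3 := D.bar_entry hk (by norm_num)
  refine Runs.mono (T := 16 + ((4 + 28) + ((4 + 28) + ((4 + 28) + ((4 + 28) + 2))))) ?_
    (by norm_num) fun τ hτ => hτ
  refine Runs.seq (runs_entryBlock hk hrow h.ready h.data h.counter h.foot h.emitted) ?_
  rintro σ₁ ⟨s₁, e₁⟩
  refine Runs.seq (runs_emitWith e₁ s₁.ready.one s₁.ready.numZero ?_ ?_ ?_ ?_ ?_ ?_ ?_ ?_ ?_) ?_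
  · rw [s₁.rhs, SparseSystem.trussRhs, hb0]; rfl
  · intro r h1 h2; simp [h1, h2]
  · intro r h1 h2; simp [h1, h2]
  · simp
  · simp
  · simp [hb0, SparseSystem.entryBar, s₁.col, s₁.ready.zero]
  · simp [hb0, SparseSystem.entryBar, s₁.foot, s₁.ready.zero]
  · simp [hb0, SparseSystem.entryBar, s₁.coeffA, s₁.ready.numZero]
  · simp [hb0, SparseSystem.entryBar, s₁.ready.numZero]
  rintro σ₂ ⟨e₂, f₂⟩
  have s₂ := s₁.frame f₂
  refine Runs.seq (runs_emitWith e₂ s₂.ready.one s₂.ready.numZero ?_ ?_ ?_ ?_ ?_ ?_ ?_ ?_ ?_) ?_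
  · rw [s₂.rhs, SparseSystem.trussRhs, hb1]; rfl
  · intro r h1 h2; simp [h1, h2]
  · intro r h1 h2; simp [h1, h2]
  · simp
  · simp
  · simp [hb1, SparseSystem.entryBar, s₂.last, s₂.ready.zero]
  · simp [hb1, SparseSystem.entryBar, s₂.foot, s₂.ready.zero]
  · simp [hb1, SparseSystem.entryBar, s₂.ready.numZero]
  · simp [hb1, SparseSystem.entryBar, s₂.coeffB, s₂.ready.numZero]
  rintro σ₃ ⟨e₃, f₃⟩
  have s₃ := s₂.frame f₃
  refine Runs.seq (runs_emitWith e₃ s₃.ready.one s₃.ready.numZero ?_ ?_ ?_ ?_ ?_ ?_ ?_ ?_ ?_) ?_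
  · rw [s₃.rhs, SparseSystem.trussRhs, hb2]; rfl
  · intro r h1 h2; simp [h1, h2]
  · intro r h1 h2; simp [h1, h2]
  · simp
  · simp
  · simp [hb2, SparseSystem.entryBar, s₃.foot, s₃.ready.zero]
  · simp [hb2, SparseSystem.entryBar, s₃.head, s₃.ready.zero]
  · simp [hb2, SparseSystem.entryBar, s₃.coeffA, s₃.ready.numZero]
  · simp [hb2, SparseSystem.entryBar, s₃.coeffB, s₃.ready.numZero]
  rintro σ₄ ⟨e₄, f₄⟩
  have s₄ := s₃.frame f₄
  refine Runs.seq (runs_emitWith e₄ s₄.ready.one s₄.ready.numZero ?_ ?_ ?_ ?_ ?_ ?_ ?_ ?_ ?_) ?_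
  · rw [s₄.rhs, SparseSystem.trussRhs, hb3]; rfl
  · intro r h1 h2; simp [h1, h2]
  · intro r h1 h2; simp [h1, h2]
  · simp
  · simp
  · simp [hb3, SparseSystem.entryBar, s₄.last, s₄.ready.zero]
  · simp [hb3, SparseSystem.entryBar, s₄.head, s₄.ready.zero]
  · simp [hb3, SparseSystem.entryBar, s₄.coeffL, s₄.ready.numZero]
  · simp [hb3, SparseSystem.entryBar, s₄.coeffB, s₄.ready.numZero]
  rintro σ₅ ⟨e₅, f₅⟩
  have s₅ := s₄.frame f₅
  -- Consecutive entries own consecutive pairs of joints, so a running counter supplies their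
  -- numbers.
  have hfoot : D.foot (k + 1) = D.head k + 1 := by
    simp only [SparseSystem.foot, SparseSystem.head]; ring
  refine Runs.block ⟨s₅.ready.congr ?_ ?_ ?_ ?_, s₅.data.congr ?_ ?_ ?_ ?_ ?_, ?_, ?_,
    ⟨?_, e₅.tape.congr ?_ ?_ ?_ ?_, ?_⟩⟩
  · simp
  · simp
  · simp
  · simp
  · simp
  · simp
  · simp
  · simp
  · simp
  · simp [s₅.counter, s₅.ready.one]
  · simp [hfoot, s₅.head, s₅.ready.one]
  · simp [e₅.count]; ring
  · simp
  · simp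
  · simp
  · simp
  · intro l hl
    simp [e₅.rhs l (by omega)]

/-- Write the bar that closes the chain of a row. -/
def closeBody : Prog :=
  .seq (block [.numLoad 10 4 7, .numLoad 11 5 7, .numMul 10 10 11, .numLoad 5 7 7]) <|
  .seq (emitWith [.idxAdd 10 1 7, .idxLoad 11 4 7, .numSub 3 2 10, .numAdd 4 2 2]) <|
  block [.idxAdd 7 7 6]

/-- The state after the first `k` chains have been closed. -/
structure Closed (D : SparseSystem) (c : ℕ → ℝ) (ε : ℝ) (k : ℕ) (σ : Store) : Prop where
  ready : Ready D c ε σ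
  data : RowData D c D.s σ
  counter : σ.idx 7 = k
  foot : σ.idx 13 = D.joints
  emitted : Emitted D (D.trussRhs c) (4 * D.s + k) σ

theorem runs_closeBody {D : SparseSystem} {c : ℕ → ℝ} {ε : ℝ} {k : ℕ} {σ : Store} (hk : k < D.m)
    (h : Closed D c ε k σ) : Runs closeBody σ 37 (Closed D c ε (k + 1)) := by
  have h7 := h.counter
  refine Runs.mono (T := 4 + ((4 + 28) + 1)) ?_ (by norm_num) fun τ hτ => hτ
  refine Runs.seq (Q := fun τ => Closed D c ε k τ ∧ τ.num 10 = D.scale k * D.mass k ∧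
    τ.num 5 = c k / D.scale k) (Runs.block ⟨⟨h.ready.congr ?_ ?_ ?_ ?_, h.data.congr ?_ ?_ ?_ ?_ ?_,
      ?_, ?_, ⟨?_, h.emitted.tape.congr ?_ ?_ ?_ ?_, ?_⟩⟩, ?_, ?_⟩) ?_
  · simp
  · simp
  · simp
  · simp
  · simp
  · simp
  · simp
  · simp
  · simp
  · simp [h7]
  · simp [h.foot]
  · simp [h.emitted.count]
  · simp
  · simp
  · simp
  · simp
  · intro l hl
    simp [h.emitted.rhs l hl]
  · simp [h7, h.data.scale k hk, h.data.mass k hk]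
  · simp [h7, h.data.rhs k hk]
  rintro σ₁ ⟨s₁, h10, h5⟩
  have hb := D.bar_closing k
  refine Runs.seq (runs_emitWith s₁.emitted s₁.ready.one s₁.ready.numZero ?_ ?_ ?_ ?_ ?_ ?_ ?_
    ?_ ?_) ?_
  · rw [h5, SparseSystem.trussRhs, hb]; rfl
  · intro r h1 h2; simp [h1, h2]
  · intro r h1 h2; simp [h1, h2]
  · simp
  · simp
  · simp [hb, SparseSystem.closingBar, SparseSystem.anchor, s₁.ready.cols, s₁.counter]
  · simp [hb, SparseSystem.closingBar, s₁.counter, s₁.data.last k hk]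
  · simp [hb, SparseSystem.closingBar, h10, s₁.ready.numZero]
  · simp [hb, SparseSystem.closingBar, s₁.ready.numZero]
  rintro σ₂ ⟨e₂, f₂⟩
  have r₂ := s₁.ready.frame f₂
  have i7 : σ₂.idx 7 = k := by
    rw [f₂.idx 7 (by norm_num) (by norm_num) (by norm_num) (by norm_num) (by norm_num), s₁.counter]
  have i13 : σ₂.idx 13 = D.joints := by
    rw [f₂.idx 13 (by norm_num) (by norm_num) (by norm_num) (by norm_num) (by norm_num), s₁.foot]
  refine Runs.block ⟨r₂.congr ?_ ?_ ?_ ?_, (s₁.data.frame f₂).congr ?_ ?_ ?_ ?_ ?_, ?_, ?_,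
    ⟨?_, e₂.tape.congr ?_ ?_ ?_ ?_, ?_⟩⟩
  · simp
  · simp
  · simp
  · simp
  · simp
  · simp
  · simp
  · simp
  · simp
  · simp [i7, r₂.one]
  · simp [i13]
  · simp [e₂.count]; ring
  · simp
  · simp
  · simp
  · simp
  · intro l hl
    simp [e₂.rhs l (by omega)]

/-- The program that maps instances. -/
def buildProg : Prog :=
  .seq (block initBlock) <|
  .seq (.loop (.idxLt 7 0) (block rowInitBlock)) <|
  .seq (block [.idxConst 7 0]) <|
  .seq (.loop (.idxLt 7 2) (block sumBlock)) <|
  .seq (block [.idxConst 7 0]) <|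
  .seq (.loop (.idxLt 7 0) (block scaleBlock)) <|
  -- Index register `13` starts at `n + m`, the number of the first foot.
  .seq (block [.idxConst 7 0, .idxAdd 13 1 0]) <|
  .seq (.loop (.idxLt 7 2) entryBody) <|
  .seq (block [.idxConst 7 0]) <|
  .seq (.loop (.idxLt 7 0) closeBody) <|
  block [.idxAdd 3 8 17, .idxAdd 4 13 13, .idxAdd 5 9 17, .numAdd 1 0 2]

/-- The truss system has been written, with its dimensions. -/
structure Written (D : SparseSystem) (c : ℕ → ℝ) (ε : ℝ) (σ : Store) : Prop where
  rows : σ.idx 3 = D.bars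
  cols : σ.idx 4 = D.joints * 2
  size : σ.idx 5 = (D.output D.bars).length
  tape : Tape σ (D.output D.bars)
  rhs : ∀ e < D.bars, σ.numArr 3 e = D.trussRhs c e
  eps : σ.num 1 = ε

/-- All five loops are driven by a counter and have bodies of constant cost, three running over rows
and two over entries. -/
theorem runs_buildProg {D : SparseSystem} (hD : D.IsBalanced) {c : ℕ → ℝ} {ε : ℝ} {σ : Store}
    (hm : σ.idx 0 = D.m) (hn : σ.idx 1 = D.n) (hs : σ.idx 2 = D.s) (hε : σ.num 0 = ε)
    (hrow : ∀ k < D.s, σ.idxArr 0 k = D.row k) (hcol : ∀ k < D.s, σ.idxArr 1 k = D.col k)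
    (hval : ∀ k < D.s, σ.numArr 0 k = D.val k) (hc : ∀ i < D.m, σ.numArr 2 i = c i) :
    Runs buildProg σ (22 + 54 * D.m + 159 * D.s) (Written D c ε) := by
  refine Runs.mono (T := 8 + ((D.m * (5 + 1) + 1) + (1 + ((D.s * (11 + 1) + 1) + (1 +
    ((D.m * (9 + 1) + 1) + (2 + ((D.s * (146 + 1) + 1) + (1 + ((D.m * (37 + 1) + 1) + 4))))))))))
    ?_ (by omega) fun τ hτ => hτ
  refine Runs.seq (Q := RowInit D c ε 0) (Runs.block ?_) fun σ₁ h₁ => ?_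
  · refine ⟨⟨⟨?_, ?_, ?_, ?_, ?_, ?_, ?_, ?_, ?_, ?_, ?_, ?_, ?_⟩, ?_, ?_, ?_⟩, ?_, ?_, ?_⟩ <;>
      simp [initBlock, *] <;> assumption
  refine Runs.seq (Runs.loop (N := D.m) (RowInit D c ε) ?_ (fun k _ τ => runs_rowInit) h₁)
    fun σ₂ h₂ => ?_
  · intro k τ h
    simp only [Test.Holds, h.counter, h.ready.rows]
  refine Runs.seq (Q := Summed D c ε 0) (Runs.block ?_) fun σ₃ h₃ => ?_
  · refine ⟨⟨h₂.ready.congr ?_ ?_ ?_ ?_, ?_, ?_, ?_⟩, ?_, ?_, ?_⟩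
    · simp
    · simp
    · simp
    · simp
    · simp
    · simp [h₂.count]
    · simp [h₂.pos]
    · intro i hi; simp [h₂.num_bars i hi]
    · intro i hi; simp [h₂.mass i hi]
    · intro i hi; simp [h₂.last i hi]
  refine Runs.seq (Runs.loop (N := D.s) (Summed D c ε) ?_ (fun k hk τ => runs_sum hk) h₃)
    fun σ₄ h₄ => ?_
  · intro k τ h
    simp only [Test.Holds, h.counter, h.ready.size]
  refine Runs.seq (Q := Scaled D c ε 0) (Runs.block ?_) fun σ₅ h₅ => ?_
  · refine ⟨⟨h₄.ready.congr ?_ ?_ ?_ ?_, ?_, ?_, ?_⟩, ?_, ?_, ?_, ?_, ?_, ?_⟩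
    · simp
    · simp
    · simp
    · simp
    · simp
    · simp [h₄.count]
    · simp [h₄.pos]
    · intro i hi _; simp [h₄.num_bars i hi]
    · intro i hi; omega
    · intro i hi; simp [h₄.mass i hi, SparseSystem.mass]
    · intro i hi; omega
    · intro i hi; omega
    · intro i hi; simp [h₄.last i hi]
  refine Runs.seq (Runs.loop (N := D.m) (Scaled D c ε) ?_ (fun k hk τ => runs_scale hk) h₅)
    fun σ₆ h₆ => ?_
  · intro k τ h
    simp only [Test.Holds, h.counter, h.ready.rows]
  refine Runs.seq (Q := EntriesDone D c ε 0) (Runs.block ?_) fun σ₇ h₇ => ?_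
  · refine ⟨h₆.ready.congr ?_ ?_ ?_ ?_, ⟨?_, ?_, ?_, ?_, ?_⟩, ?_, ?_, ⟨?_, ⟨?_, ?_⟩, ?_⟩⟩
    · simp
    · simp
    · simp
    · simp
    · intro i hi; simp [h₆.scale i hi]
    · intro i hi; simp [h₆.mass i hi]
    · intro i hi; simp [h₆.load i hi]
    · intro i hi; simp [h₆.rhs i hi]
    · intro i hi; simp [h₆.last i hi]
    · simp
    · simp [h₆.ready.cols, h₆.ready.rows, SparseSystem.foot]
    · simp [h₆.count]
    · simp [h₆.pos, SparseSystem.output]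
    · intro k hk; simp [SparseSystem.output] at hk
    · intro l hl; omega
  refine Runs.seq (Runs.loop (N := D.s) (EntriesDone D c ε) ?_
    (fun k hk τ => runs_entryBody hk (hD.row_lt k hk)) h₇) fun σ₈ h₈ => ?_
  · intro k τ h
    simp only [Test.Holds, h.counter, h.ready.size]
  refine Runs.seq (Q := Closed D c ε 0) (Runs.block ?_) fun σ₉ h₉ => ?_
  · refine ⟨h₈.ready.congr ?_ ?_ ?_ ?_, h₈.data.congr ?_ ?_ ?_ ?_ ?_, ?_, ?_,
      ⟨?_, h₈.emitted.tape.congr ?_ ?_ ?_ ?_, ?_⟩⟩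
    · simp
    · simp
    · simp
    · simp
    · simp
    · simp
    · simp
    · simp
    · simp
    · simp
    -- Past the last entry, the running number of the next foot is the number of joints, from which
    -- the number of columns is obtained.
    · simp [h₈.foot, SparseSystem.foot, SparseSystem.joints]
    · simp [h₈.emitted.count]
    · simp
    · simp
    · simp
    · simp
    · intro l hl
      simp [h₈.emitted.rhs l (by omega)]
  refine Runs.seq (Runs.loop (N := D.m) (Closed D c ε) ?_ (fun k hk τ => runs_closeBody hk) h₉)
    fun τ h => ?_
  · intro k τ h
    simp only [Test.Holds, h.counter, h.ready.rows]
  have hbars : 4 * D.s + D.m = D.bars := rfl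
  have he := h.emitted
  rw [hbars] at he
  refine Runs.block ⟨?_, ?_, ?_, he.tape.congr ?_ ?_ ?_ ?_, ?_, ?_⟩
  · simp [he.count, h.ready.zero]
  · simp [h.foot]; ring
  · simp [he.tape.1, h.ready.zero]
  · simp
  · simp
  · simp
  · simp
  · intro e h'
    simp [he.rhs e h']
  · simp [h.ready.eps, h.ready.numZero]

/-! ### The program that maps solutions -/

/-- Copy every second coordinate. -/
def recoverProg : Prog :=
  .seq (block [.idxConst 6 1, .idxConst 7 0, .idxConst 8 0])
    (.loop (.idxLt 7 1) (block [.numLoad 2 3 8, .numStore 2 7 2, .idxAdd 8 8 6, .idxAdd 8 8 6,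
      .idxAdd 7 7 6]))

/-- Original joint `j` has number `j`, so its horizontal displacement is coordinate `2 * j`. -/
theorem runs_recoverProg {n : ℕ} {y : ℕ → ℝ} {σ : Store} (hn : σ.idx 1 = n)
    (hy : ∀ j < n, σ.numArr 3 (2 * j) = y (2 * j)) :
    Runs recoverProg σ (4 + 6 * n) fun τ => ∀ j < n, τ.numArr 2 j = y (2 * j) := by
  refine Runs.mono (T := 3 + (n * (5 + 1) + 1)) ?_ (by omega) fun τ hτ => hτ
  let I : ℕ → Store → Prop := fun k τ => τ.idx 1 = n ∧ τ.idx 6 = 1 ∧ τ.idx 7 = k ∧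
    τ.idx 8 = 2 * k ∧ (∀ j < n, τ.numArr 3 (2 * j) = y (2 * j)) ∧
      ∀ j < k, τ.numArr 2 j = y (2 * j)
  refine Runs.seq (Q := I 0) (Runs.block ⟨?_, ?_, ?_, ?_, ?_, ?_⟩) fun τ h => ?_
  · simp [hn]
  · simp
  · simp
  · simp
  · simpa using hy
  · intro j hj; omega
  refine (Runs.loop (N := n) I ?_ ?_ h).mono le_rfl fun τ hτ => hτ.2.2.2.2.2
  · intro k τ h
    simp only [Test.Holds, h.1, h.2.2.1]
  · rintro k hk τ ⟨h1, h6, h7, h8, h3, h2⟩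
    refine Runs.block ⟨?_, ?_, ?_, ?_, ?_, ?_⟩
    · simp [h1]
    · simp [h6]
    · simp [h7, h6]
    · simp [h8, h6]; ring
    · intro j hj
      simp [h3 j hj]
    · intro j hj
      by_cases hjk : j = k
      · simp [h7, h8, hjk, h3 k hk]
      · simp [h7, hjk, h2 j (by omega)]

/-! ### The reduction -/

/-- The list of entries of a matrix. -/
def SparseSystem.ofMatrix {m n : ℕ} (A : Matrix (Fin m) (Fin n) ℝ) : SparseSystem where
  m := m
  n := n
  s := (entries A).length
  row k := if h : k < (entries A).length then (entries A)[k].1 else 0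
  col k := if h : k < (entries A).length then (entries A)[k].2 else 0
  val k := if h : k < (entries A).length then A (entries A)[k].1 (entries A)[k].2 else 0

theorem mem_entries {m n : ℕ} {A : Matrix (Fin m) (Fin n) ℝ} {p : Fin m × Fin n} :
    p ∈ entries A ↔ A p.1 p.2 ≠ 0 := by
  obtain ⟨a, b⟩ := p
  simp [entries, List.mem_product]

theorem nodup_entries {m n : ℕ} (A : Matrix (Fin m) (Fin n) ℝ) : (entries A).Nodup :=
  ((List.nodup_finRange m).product (List.nodup_finRange n)).filter _

theorem sum_entries {m n : ℕ} (A : Matrix (Fin m) (Fin n) ℝ) {f : Fin m × Fin n → ℝ}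
    (hf : ∀ p, A p.1 p.2 = 0 → f p = 0) :
    ∑ k : Fin (entries A).length, f (entries A)[k.1] = ∑ i, ∑ j, f (i, j) := by
  classical
  rw [Fin.sum_univ_fun_getElem, ← List.sum_toFinset _ (nodup_entries A), ← Fintype.sum_prod_type]
  refine sum_subset (subset_univ _) fun p _ hp => hf p ?_
  by_contra h
  exact hp (List.mem_toFinset.2 (mem_entries.2 h))

namespace SparseSystem

variable {m n : ℕ} (A : Matrix (Fin m) (Fin n) ℝ)

theorem ofMatrix_row {k : ℕ} (hk : k < (entries A).length) :
    (ofMatrix A).row k = (entries A)[k].1 := dif_pos hk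

theorem ofMatrix_col {k : ℕ} (hk : k < (entries A).length) :
    (ofMatrix A).col k = (entries A)[k].2 := dif_pos hk

theorem ofMatrix_val {k : ℕ} (hk : k < (entries A).length) :
    (ofMatrix A).val k = A (entries A)[k].1 (entries A)[k].2 := dif_pos hk

theorem rowSum_ofMatrix {f : Fin n → ℝ} {g : ℕ → ℝ}
    (hg : ∀ (k : ℕ) (hk : k < (entries A).length),
      g k = A (entries A)[k].1 (entries A)[k].2 * f (entries A)[k].2) (i : Fin m) :
    (ofMatrix A).rowSum g (ofMatrix A).s i = ∑ j, A i j * f j := by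
  calc (ofMatrix A).rowSum g (ofMatrix A).s i
      = ∑ k : Fin (entries A).length, if (ofMatrix A).row k = i then g k else 0 :=
        (Fin.sum_univ_eq_sum_range (fun k => if (ofMatrix A).row k = i then g k else 0) _).symm
    _ = ∑ k : Fin (entries A).length, (fun p : Fin m × Fin n =>
          if p.1 = i then A p.1 p.2 * f p.2 else 0) (entries A)[k.1] := by
        refine sum_congr rfl fun k _ => ?_
        simp only [ofMatrix_row A k.2, Fin.val_inj, hg k k.2]
    _ = ∑ i', ∑ j, if i' = i then A i' j * f j else 0 :=
        sum_entries A (f := fun p => if p.1 = i then A p.1 p.2 * f p.2 else 0)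
          fun p hp => by simp only [hp, zero_mul, ite_self]
    _ = ∑ j, A i j * f j := by
        rw [sum_comm]
        simp

theorem represents_ofMatrix : (ofMatrix A).Represents A := by
  intro (u : EuclideanSpace ℝ (Fin n)) (i : Fin m)
  refine (act_apply A u i).trans (rowSum_ofMatrix A (f := fun j => u j) (fun k hk => ?_) i).symm
  rw [ofMatrix_val A hk, ofMatrix_col A hk]
  exact congrArg _ (coord_val u _)

variable {A}

/-- Integrality turns non-zero entries into entries of absolute value at least one. -/
theorem isBalanced_ofMatrix (hA : ZeroSumPowTwo A) : (ofMatrix A).IsBalanced := by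
  obtain ⟨Z, rfl, hrow, -, hsum, -⟩ := hA
  set A : Matrix (Fin m) (Fin n) ℝ := Z.map (fun z : ℤ => (z : ℝ)) with hA
  refine ⟨fun k hk => ?_, fun k hk => ?_, fun k hk => ?_, fun i hi => ?_, fun i hi => ?_⟩
  · have hk' : k < (entries A).length := hk
    rw [ofMatrix_row A hk']
    exact (entries A)[k].1.2
  · have hk' : k < (entries A).length := hk
    rw [ofMatrix_col A hk']
    exact (entries A)[k].2.2
  · have hk' : k < (entries A).length := hk
    rw [ofMatrix_val A hk']
    have h := mem_entries.1 (List.getElem_mem hk')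
    simp only [hA, Matrix.map_apply] at h ⊢
    have h' : Z (entries A)[k].1 (entries A)[k].2 ≠ 0 := by exact_mod_cast h
    exact_mod_cast Int.one_le_abs h'
  · have h := rowSum_ofMatrix A (f := fun _ => 1) (g := (ofMatrix A).val)
      (fun k hk => by rw [ofMatrix_val A hk, mul_one]) ⟨i, hi⟩
    rw [h]
    simp only [mul_one, hA, Matrix.map_apply]
    exact_mod_cast hsum ⟨i, hi⟩
  · obtain ⟨j, hj⟩ := hrow ⟨i, hi⟩
    have h : (⟨⟨i, hi⟩, j⟩ : Fin m × Fin n) ∈ entries A :=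
      mem_entries.2 (by simp only [hA, Matrix.map_apply]; exact_mod_cast hj)
    obtain ⟨k, hk, hkj⟩ := List.mem_iff_getElem.1 h
    refine ⟨k, hk, ?_⟩
    rw [ofMatrix_row A hk, hkj]

end SparseSystem

/-! ### Extreme entries and monotonicity of the parameter bound -/

theorem abs_le_maxAbs {ι : Type} [Finite ι] (v : ι → ℝ) (i : ι) : |v i| ≤ maxAbs v :=
  le_ciSup (f := fun i => |v i|) (Set.finite_range _).bddAbove i

theorem maxAbs_le {ι : Type} {v : ι → ℝ} {M : ℝ} (hM : 0 ≤ M) (h : ∀ i, |v i| ≤ M) :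
    maxAbs v ≤ M := Real.iSup_le h hM

theorem one_div_minNonzeroAbs_le {ι : Type} {v : ι → ℝ} {M : ℝ} (hM : 0 < M)
    (h : ∀ i, v i ≠ 0 → 1 / M ≤ |v i|) : 1 / minNonzeroAbs v ≤ M := by
  rw [minNonzeroAbs]
  rcases Set.eq_empty_or_nonempty {a | ∃ i, v i ≠ 0 ∧ a = |v i|} with h0 | h0
  · rw [h0, Real.sInf_empty, div_zero]
    exact hM.le
  · have h1 : 1 / M ≤ sInf {a | ∃ i, v i ≠ 0 ∧ a = |v i|} := by
      refine le_csInf h0 ?_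
      rintro a ⟨i, hi, rfl⟩
      exact h i hi
    exact (one_div_le hM (lt_of_lt_of_le (by positivity) h1)).1 h1

/-- Finiteness makes the infimum attained and hence positive. Were it zero, its reciprocal would be
zero by convention and the hypothesis would say nothing. -/
theorem one_div_le_abs {ι : Type} [Finite ι] {v : ι → ℝ} {M : ℝ}
    (h : 1 / minNonzeroAbs v ≤ M) {i : ι} (hi : v i ≠ 0) : 1 / M ≤ |v i| := by
  have hfin : {a | ∃ i, v i ≠ 0 ∧ a = |v i|}.Finite :=
    (Set.finite_range fun i => |v i|).subset (by rintro a ⟨i, -, rfl⟩; exact ⟨i, rfl⟩)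
  have hmem : |v i| ∈ {a | ∃ i, v i ≠ 0 ∧ a = |v i|} := ⟨i, hi, rfl⟩
  have hle : minNonzeroAbs v ≤ |v i| := csInf_le hfin.bddBelow hmem
  obtain ⟨j, hj, hja⟩ := Set.Nonempty.csInf_mem ⟨_, hmem⟩ hfin
  have hpos : 0 < minNonzeroAbs v := by
    rw [minNonzeroAbs, hja]
    exact abs_pos.2 hj
  refine le_trans ?_ hle
  exact (one_div_le hpos (lt_of_lt_of_le (by positivity) h)).1 h

theorem monotoneOn_blowup {C : ℝ} (hC : 0 ≤ C) : MonotoneOn (blowup C) (Set.Ici (1, 1, 1, 1)) := by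
  rintro ⟨s, U, K, e⟩ h1 ⟨s', U', K', e'⟩ - h2
  simp only [Set.mem_Ici, Prod.mk_le_mk] at h1 h2
  obtain ⟨hs, hU, hK, he⟩ := h1
  obtain ⟨hs', hU', hK', he'⟩ := h2
  have hl : 0 ≤ Real.log (s * U) := Real.log_nonneg (one_le_mul_of_one_le_of_one_le hs hU)
  have hl' : Real.log (s * U) ≤ Real.log (s' * U') :=
    Real.log_le_log (by positivity) (mul_le_mul hs' hU' (by positivity) (by linarith))
  have hr : s ^ (3 / 2 : ℝ) ≤ s' ^ (3 / 2 : ℝ) :=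
    Real.rpow_le_rpow (by linarith) hs' (by norm_num)
  have hlr : Real.log (s * U) ^ (1 / 2 : ℝ) ≤ Real.log (s' * U') ^ (1 / 2 : ℝ) :=
    Real.rpow_le_rpow hl hl' (by norm_num)
  have hlr0 : 0 ≤ Real.log (s * U) ^ (1 / 2 : ℝ) := Real.rpow_nonneg hl _
  simp only [blowup, Prod.mk_le_mk]
  generalize Real.log (s * U) ^ (1 / 2 : ℝ) = x at *
  generalize Real.log (s' * U') ^ (1 / 2 : ℝ) = x' at *
  generalize Real.log (s * U) = l at *
  generalize Real.log (s' * U') = l' at *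
  have : 0 ≤ s ^ (3 / 2 : ℝ) := Real.rpow_nonneg (by linarith) _
  generalize s ^ (3 / 2 : ℝ) = z at *
  generalize s' ^ (3 / 2 : ℝ) = z' at *
  have : 0 ≤ s := by linarith
  have : 0 ≤ U := by linarith
  have : 0 ≤ K := by linarith
  have : 0 ≤ e := by linarith
  have : 0 ≤ s' := by linarith
  have : 0 ≤ U' := by linarith
  have : 0 ≤ K' := by linarith
  have : 0 ≤ z' := by linarith
  refine ⟨?_, ?_, ?_, ?_⟩ <;> gcongr

theorem mapsTo_blowup {C : ℝ} (hC : 0 ≤ C) :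
    Set.MapsTo (blowup C) (Set.Ici (1, 1, 1, 1)) (Set.Ici (0, 0, 0, 0)) := by
  rintro ⟨s, U, K, e⟩ h
  simp only [Set.mem_Ici, Prod.mk_le_mk] at h
  obtain ⟨hs, hU, hK, he⟩ := h
  have hl : 0 ≤ Real.log (s * U) := Real.log_nonneg (one_le_mul_of_one_le_of_one_le hs hU)
  have hlr : 0 ≤ Real.log (s * U) ^ (1 / 2 : ℝ) := Real.rpow_nonneg hl _
  have hz : 0 ≤ s ^ (3 / 2 : ℝ) := Real.rpow_nonneg (by linarith) _
  simp only [blowup, Set.mem_Ici, Prod.mk_le_mk]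
  refine ⟨?_, ?_, ?_, ?_⟩ <;> positivity

/-! ### Assembling programs and parameter bounds -/

namespace SparseSystem

variable {D : SparseSystem}

theorem trussRhs_eq (hD : D.IsBalanced) (c : EuclideanSpace ℝ (Fin D.m)) (e : Fin D.bars) :
    D.trussRhs (coord c) e = act D.spread c e := (act_spread hD c e).symm

theorem mapsInstance {A : Matrix (Fin D.m) (Fin D.n) ℝ} (hD : D.IsBalanced)
    (hs : D.s = nnz A) (hs1 : 1 ≤ D.s) (hm : D.m ≤ D.s)
    (hrow : ∀ k (hk : k < (entries A).length), D.row k = (entries A)[k].1)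
    (hcol : ∀ k (hk : k < (entries A).length), D.col k = (entries A)[k].2)
    (hval : ∀ k (hk : k < (entries A).length), D.val k = A (entries A)[k].1 (entries A)[k].2)
    (c : EuclideanSpace ℝ (Fin D.m)) (ε : ℝ) :
    MapsInstance buildProg (235 * nnz A) A c ε D.truss (act D.spread c) ε := by
  rintro σ ⟨h0, h1, h2, h3⟩ hc hε
  have hlen : D.s = (entries A).length := by rw [hs, length_entries]
  obtain ⟨t, τ, ht, hex, hτ⟩ := runs_buildProg hD (c := coord c) (ε := ε) (σ := σ) h0 h1
    (by rw [hs]; exact h2) hε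
    (fun k hk => by
      rw [hlen] at hk
      rw [hrow k hk]; exact (h3 k hk).1)
    (fun k hk => by
      rw [hlen] at hk
      rw [hcol k hk]; exact (h3 k hk).2.1)
    (fun k hk => by
      rw [hlen] at hk
      rw [hval k hk]; exact (h3 k hk).2.2)
    (fun i hi => by rw [coord_of_lt c hi]; exact hc ⟨i, hi⟩)
  refine ⟨t, τ, ht.trans ?_, hex, ⟨hτ.rows, hτ.cols, ?_, fun k hk => ?_⟩, fun e => ?_, hτ.eps⟩
  -- The running time is at most `(22 + 54 + 159) * s` because `m ≤ s` and `1 ≤ s`.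
  · rw [← hs]; omega
  · rw [nnz_truss hD]; exact hτ.size
  · have hL := map_entries_truss hD
    have hk' : k < (D.output D.bars).length := by
      rw [← hL, List.length_map]; exact hk
    have h := hτ.tape.2 k hk'
    have hget : (D.output D.bars)[k] = (((entries D.truss)[k].1 : ℕ), ((entries D.truss)[k].2 : ℕ),
        D.truss (entries D.truss)[k].1 (entries D.truss)[k].2) := by
      simp only [← hL, List.getElem_map]
    rw [hget] at h
    exact h
  · rw [hτ.rhs e e.2, trussRhs_eq hD]

theorem mapsSolution {A : Matrix (Fin D.m) (Fin D.n) ℝ} (hn : D.n ≤ nnz A) (hs1 : 1 ≤ nnz A)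
    (y : EuclideanSpace ℝ (Fin (D.joints * 2))) :
    MapsSolution recoverProg (235 * nnz A) A D.truss y (recover y) := by
  rintro σ ⟨-, h1, -⟩ - hy
  obtain ⟨t, τ, ht, hex, hτ⟩ := runs_recoverProg (y := coord y) (σ := σ) h1 (fun j hj => by
    have h : 2 * j < D.joints * 2 := by rw [joints]; omega
    rw [coord_of_lt y h]
    exact hy ⟨2 * j, h⟩)
  refine ⟨t, τ, by omega, hex, fun j => ?_⟩
  rw [hτ j j.2]
  rfl

/-- The logarithms need only a lower bound: a zero-sum row has two entries, so `s * U` is at least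
two and its logarithm at least `1 / 2`. The condition number decides the constant, `7500` divided by
`(1 / 2) ^ 2`. -/
theorem complexity_truss_le (hD : D.IsBalanced) {A : Matrix (Fin D.m) (Fin D.n) ℝ}
    (hA : D.Represents A) (hs : D.s = nnz A) (hm0 : 0 < D.m) (hm : D.m ≤ D.s) (hn : D.n ≤ D.s)
    (hA0 : A ≠ 0) (hB0 : D.truss ≠ 0)
    (hval : ∀ k < D.s, ∃ i j, D.val k = A i j) (c : EuclideanSpace ℝ (Fin D.m)) {ε : ℝ}
    (hε : 0 < ε) :
    complexity D.truss (act D.spread c) ε ≤ blowup 30000 (complexity A c ε) := by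
  have hs2 : 2 ≤ D.s := (hD.two_le_rank hm0).trans (D.rank_le _ _)
  have hs1 : 1 ≤ D.s := by omega
  have hs2' : (2 : ℝ) ≤ D.s := by exact_mod_cast hs2
  have hmR : (D.m : ℝ) ≤ D.s := by exact_mod_cast hm
  have hK := one_le_condNumber hA0
  simp only [complexity, blowup, Prod.mk_le_mk]
  rw [← hs]
  set U := max (max (maxAbs fun p : Fin D.m × Fin D.n => A p.1 p.2) (maxAbs fun i => c i))
      (max (1 / minNonzeroAbs fun p : Fin D.m × Fin D.n => A p.1 p.2)
        (1 / minNonzeroAbs fun i => c i)) with hUdef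
  have hAU : ∀ i j, |A i j| ≤ U := fun i j =>
    (abs_le_maxAbs (fun p : Fin D.m × Fin D.n => A p.1 p.2) (i, j)).trans
      ((le_max_left _ _).trans (le_max_left _ _))
  have hcU : ∀ i, |c i| ≤ U := fun i =>
    (abs_le_maxAbs (fun i => c i) i).trans ((le_max_right _ _).trans (le_max_left _ _))
  have hcU' : ∀ i, c i ≠ 0 → 1 / U ≤ |c i| := fun i hi =>
    one_div_le_abs (v := fun i => c i) ((le_max_right _ _).trans (le_max_right _ _)) hi
  clear_value U
  have hvalU : ∀ k < D.s, |D.val k| ≤ U := fun k hk => by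
    obtain ⟨i, j, h⟩ := hval k hk
    rw [h]; exact hAU i j
  obtain ⟨i₀, j₀, h₀⟩ := hval 0 hs1
  have hA1 : 1 ≤ |A i₀ j₀| := by rw [← h₀]; exact hD.one_le_abs 0 hs1
  have hU : 1 ≤ U := hA1.trans (hAU i₀ j₀)
  have hmax : 1 ≤ sigmaMax A := one_le_sigmaMax hA1
  have hlog : 1 / 2 ≤ Real.log (D.s * U) := by
    have h1 : Real.log 2 ≤ Real.log (D.s * U) :=
      Real.log_le_log (by norm_num) (by nlinarith)
    linarith [Real.log_two_gt_d9]
  have hsq := Real.sqrt_nonneg (D.s : ℝ)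
  have hsq1 : 1 ≤ Real.sqrt (D.s : ℝ) := Real.one_le_sqrt.2 (by linarith)
  refine ⟨?_, ?_, ?_, ?_⟩
  · rw [cast_nnz_truss hD]
    nlinarith
  · have hrp : (D.s : ℝ) ^ (3 / 2 : ℝ) = D.s * Real.sqrt D.s := by
      rw [Real.sqrt_eq_rpow, ← Real.rpow_one_add' (by positivity) (by norm_num)]
      norm_num
    have hlr : 1 / 2 ≤ Real.log (D.s * U) ^ (1 / 2 : ℝ) := by
      rw [← Real.sqrt_eq_rpow]
      exact Real.le_sqrt_of_sq_le (by linarith)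
    rw [hrp]
    have hT : 5 * (D.s * Real.sqrt D.s) * U ≤
        30000 * (D.s * Real.sqrt D.s * U * Real.log (D.s * U) ^ (1 / 2 : ℝ)) := by
      have : 0 ≤ D.s * Real.sqrt D.s * U := by positivity
      nlinarith
    refine le_trans ?_ hT
    have hss : 1 ≤ D.s * Real.sqrt D.s := one_le_mul_of_one_le_of_one_le (by linarith) hsq1
    have hsU : U ≤ D.s * Real.sqrt D.s * U := le_mul_of_one_le_left (by linarith) hss
    have hsp : ∀ e, act D.spread c e =
        coord c (D.bar e).owner / D.scale (D.bar e).owner := act_spread hD c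
    refine max_le (max_le ?_ ?_) (max_le ?_ ?_)
    · exact maxAbs_le (by positivity) fun p => (truss_entry_bounds hD hs1 hU hvalU p.1 p.2).1
    · refine maxAbs_le (by positivity) fun e => ?_
      rw [hsp, abs_div, abs_of_pos (scale_pos _), coord_of_lt _ (hD.owner_lt e.2)]
      refine (div_le_self (abs_nonneg _) (one_le_scale _)).trans ((hcU _).trans ?_)
      linarith
    · refine one_div_minNonzeroAbs_le (by positivity) fun p hp => le_trans ?_
        ((truss_entry_bounds hD hs1 hU hvalU p.1 p.2).2 hp)
      exact one_div_le_one_div_of_le (by norm_num) (by linarith)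
    · refine one_div_minNonzeroAbs_le (by positivity) fun e he => ?_
      rw [hsp, coord_of_lt _ (hD.owner_lt e.2)] at he ⊢
      have h1 := hcU' _ (div_ne_zero_iff.1 he).1
      rw [abs_div, abs_of_pos (scale_pos _)]
      -- A non-zero right-hand side shrinks by at most the factor `scale`.
      calc 1 / (5 * (D.s * Real.sqrt D.s) * U) ≤ 1 / (U * (5 / 2 * Real.sqrt D.s)) := by
            refine one_div_le_one_div_of_le (by positivity) ?_
            have : 0 ≤ Real.sqrt D.s * U := by positivity
            nlinarith
        _ = 1 / U / (5 / 2 * Real.sqrt D.s) := by rw [div_div]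
        _ ≤ _ := div_le_div₀ (abs_nonneg _) h1 (scale_pos _) (scale_le hs1 _)
  · refine (condNumber_truss_le hD hs1 hU hvalU hm hn hA hA0 hB0 hmax).trans ?_
    have h1 : 1 / 4 ≤ Real.log (D.s * U) ^ 2 := by nlinarith
    have h2 : 0 ≤ condNumber A * (D.s : ℝ) ^ 4 * U ^ 2 := by positivity
    nlinarith
  · have h1 : 1 ≤ D.s * U ^ 2 := one_le_mul_of_one_le_of_one_le (by linarith) (one_le_pow₀ hU)
    have h2 : 0 < ε⁻¹ := inv_pos.2 hε
    have h3 : ε⁻¹ ≤ D.s * U ^ 2 * ε⁻¹ := le_mul_of_one_le_left h2.le h1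
    linarith

end SparseSystem

end TrussReduction

end

open TrussReduction SparseSystem in
/-- There is a constant for the `O`-notation such that zero-sum power-of-two integer matrices are
efficiently reducible, with the corresponding parameter blow-up, to 2D truss incidence matrices. -/
theorem mainTheorem8 :
    ∃ C : ℝ, 0 < C ∧
      TrussReduction.EfficientlyReducible TrussReduction.ZeroSumPowTwo TrussReduction.Truss2D
        (TrussReduction.blowup C) := by
  refine ⟨30000, by norm_num, monotoneOn_blowup (by norm_num), mapsTo_blowup (by norm_num),
    buildProg, recoverProg, 235, fun m n A c ε hA hI => ?_⟩
  obtain ⟨hA0, hmn, hε, hε1⟩ := hI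
  let D := ofMatrix A
  have hD : D.IsBalanced := isBalanced_ofMatrix hA
  have hrep : D.Represents A := represents_ofMatrix A
  have hs : D.s = nnz A := length_entries A
  have hm : D.m ≤ D.s := by rw [hs]; exact (le_max_left _ _).trans hmn
  have hn : D.n ≤ D.s := by rw [hs]; exact (le_max_right _ _).trans hmn
  obtain ⟨i, j, hij⟩ : ∃ i j, A i j ≠ 0 := by
    by_contra! h
    exact hA0 (Matrix.ext h)
  have hm0 : 0 < D.m := i.pos
  have hs1 : 1 ≤ D.s := hm0.trans_le hm
  have hnnz : 12 * D.s + 2 * D.m = nnz D.truss := by exact_mod_cast (cast_nnz_truss hD).symm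
  have hB0 : D.truss ≠ 0 := by
    intro h
    rw [h] at hnnz
    simp only [nnz, Matrix.zero_apply, ne_eq, not_true_eq_false, Finset.filter_false,
      Finset.card_empty] at hnnz
    omega
  refine ⟨D.bars, D.joints * 2, D.truss, act D.spread c, ε, hD.truss2D, ⟨hB0, ?_, hε, hε1⟩,
    mapsInstance hD hs hs1 hm (fun k => ofMatrix_row A) (fun k => ofMatrix_col A)
      (fun k => ofMatrix_val A) c ε,
    complexity_truss_le hD hrep hs hm0 hm hn hA0 hB0 ?_ c hε,
    fun y => ⟨recover y, mapsSolution (hs ▸ hn) (hs ▸ hs1) y, ?_⟩⟩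
  -- There are `4 * s + m` rows and `2 * (n + m + 2 * s)` columns; with `n ≤ s` both are at most `12
  -- * s + 2 * m`.
  · rw [← hnnz, bars, joints]
    exact max_le (by omega) (by omega)
  · intro k hk
    exact ⟨_, _, dif_pos hk⟩
  -- Here only solvability matters, not the size of the solution, so any bound of at least one on
  -- the entries will do.
  · have hU : 1 ≤ max 1 (maxAbs fun p : Fin D.m × Fin D.n => A p.1 p.2) := le_max_left _ _
    refine isSolution_of_isSolution (act D.spread) (act D.spread.transpose) (inner_act _)
      (act_spread_transpose_spread hD) (act_spread_transpose_truss hD hrep) fun w u h => ?_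
    have hval : ∀ k < D.s, |D.val k| ≤ max 1 (maxAbs fun p : Fin D.m × Fin D.n => A p.1 p.2) := by
      intro k hk
      refine le_trans ?_ (le_max_right _ _)
      rw [ofMatrix_val A hk]
      exact abs_le_maxAbs (fun p : Fin m × Fin n => A p.1 p.2) _
    obtain ⟨z, hz, -⟩ := exists_act_truss_eq hD hs1 hU hval hm hn hrep h
    exact ⟨z, hz⟩
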